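/- For $j=1,2,3$ let $\tau_j\in\mathbb C$ with $\operatorname{Im}\tau_j>0$, let $E_j=\mathbb C/\langle 1,\tau_j\rangle$, and let $\mathcal L_j\colon E_j\to\mathbb P^1$ be the Legendre function, i.e. the even double cover with $\mathcal L_j(0)=1$ that has its zeros at $\pm\frac14$ and its poles at $\frac{\tau_j}2\pm\frac14$. Put $b_j=\mathcal L_j(\tau_j/4)$, $T=E_1\times E_2\times E_3$, and let $\pi'\colon T\to(\mathbb P^1)^3$ be the map $(z_1,z_2,z_3)\mapsto(\mathcal L_1(z_1)/b_1,\mathcal L_2(z_2)/b_2,\mathcal L_3(z_3)/b_3)$. Let $\mathcal H=(\mathcal H_1)^3\cong(\mathbb Z/2)^6$ act on $(\mathbb P^1)^3$, where $\mathcal H_1\cong(\mathbb Z/2)^2$ acts on $\mathbb P^1$ by $(s:t)\mapsto(t:s)$ and $(s:t)\mapsto(s:-t)$. A Burniat hypersurface is $\hat X=\pi'^{-1}(Y)$, where $Y\subset(\mathbb P^1)^3$ is an irreducible Del Pezzo surface of degree $6$ (an irreducible divisor of multidegree $(1,1,1)$) that is invariant under some subgroup $H\cong(\mathbb Z/2)^2$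 of $\mathcal H$. Let $(\zeta_j,\eta_j,\epsilon_j)\in(\mathbb Z/2)^3$ act on $E_j$ by $z_j\mapsto(-1)^{\zeta_j+\eta_j+\epsilon_j}z_j+\eta_j\frac{\tau_j}2+\epsilon_j\frac12$, so that $(\mathbb Z/2)^9$ acts on $T$, and put $$\mathcal G_0=\{(\zeta_j,\eta_j,\epsilon_j)_{j=1,2,3}\mid \eta_1=\eta_2=\eta_3,\ \epsilon_1+\epsilon_2+\epsilon_3=0\}.$$ Let $G\cong(\mathbb Z/2)^3$ be a subgroup of $\mathcal G_0$ that maps a Burniat hypersurface $\hat X$ to itself and acts freely on it. Let $\hat S=\hat X/G$, a reduced complex analytic surface; it is the quotient model of a generalized Burniat type surface, namely of the minimal resolution of $\hat S$. Then one of the following holds: 1. $\hat X$ and $\hat S$ are both smooth; 2. the singular locus of $\hat X$ consists of exactly eight points, each of them a node (a point at which the complex space is locally isomorphic to the cone $x^2+y^2+z^2=0$ in $\mathbb C^3$ at its vertex), and the singular locus of $\hat S$ consists of exactly one point, which is a node. In particular, for every generalized Burniat type surface (regular or not), $\hat S$ is either smooth or its singular locus is given by exactly one node. -/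

import Mathlib

namespace Burniat

open Filter Topology

/-! ### Elliptic curves `ℂ / ⟨1, τ⟩` and the Legendre function -/

/-- The pair of periods `(1, τ)`. -/
noncomputable def periods (τ : UpperHalfPlane) : PeriodPair where
  ω₁ := 1
  ω₂ := (τ : ℂ)
  indep := by
    rw [LinearIndependent.pair_iff]
    intro s t h
    have him := congrArg Complex.im h
    have hre := congrArg Complex.re h
    have hτ : (τ : ℂ).im ≠ 0 := τ.im_ne_zero
    simp only [Complex.real_smul, mul_one, Complex.add_im, Complex.ofReal_im, Complex.mul_im,
      Complex.ofReal_re, zero_mul, add_zero, zero_add, Complex.zero_im] at him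
    have ht : t = 0 := by
      rcases mul_eq_zero.mp him with h0 | h0
      · exact h0
      · exact absurd h0 hτ
    subst ht
    simpa using hre

/-- The elliptic curve `E = ℂ / ⟨1, τ⟩`. -/
abbrev E (τ : UpperHalfPlane) : Type := ℂ ⧸ (periods τ).lattice

/-- The projection `ℂ → E`. -/
noncomputable def toE (τ : UpperHalfPlane) (z : ℂ) : E τ := Submodule.Quotient.mk z

/-- The projective line, with `∞ = (1 : 0)` and `x = (x : 1)` for `x : ℂ`. -/
abbrev P1 : Type := OnePoint ℂ

open Classical in
/-- The Legendre function as a function on `ℂ` with values in the projective line: the map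
`(℘(z) - ℘(1/4)) / (℘(z) - ℘(1/4 + τ/2))`, which takes the value `1` at the lattice points (the
poles of `℘`), vanishes at `± 1/4` and has its poles at `τ/2 ± 1/4`. -/
noncomputable def legendreLift (τ : UpperHalfPlane) (z : ℂ) : P1 :=
  if z ∈ (periods τ).lattice then ((1 : ℂ) : P1)
  else if (periods τ).weierstrassP z = (periods τ).weierstrassP (1 / 4 + τ / 2) then OnePoint.infty
  else (((periods τ).weierstrassP z - (periods τ).weierstrassP (1 / 4)) /
    ((periods τ).weierstrassP z - (periods τ).weierstrassP (1 / 4 + τ / 2)) : ℂ)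

theorem legendreLift_congr (τ : UpperHalfPlane) (z w : ℂ) (h : z - w ∈ (periods τ).lattice) :
    legendreLift τ z = legendreLift τ w := by
  have h1 : (periods τ).weierstrassP z = (periods τ).weierstrassP w := by
    have := (periods τ).weierstrassP_add_coe w ⟨z - w, h⟩
    simpa using this
  have h2 : z ∈ (periods τ).lattice ↔ w ∈ (periods τ).lattice := by
    constructor
    · intro hz
      simpa using sub_mem hz h
    · intro hw
      simpa using add_mem h hw
  simp only [legendreLift, h1]
  by_cases hw : w ∈ (periods τ).lattice
  · rw [if_pos hw, if_pos (h2.mpr hw)]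
  · rw [if_neg hw, if_neg (fun hz => hw (h2.mp hz))]

/-- The Legendre function `𝓛 : E → ℙ¹`. -/
noncomputable def legendre (τ : UpperHalfPlane) (x : E τ) : P1 :=
  Quotient.liftOn' x (legendreLift τ) fun z w h =>
    legendreLift_congr τ z w ((Submodule.quotientRel_def _).mp h)

/-- The number `b = 𝓛(τ/4)`. -/
noncomputable def legendreB (τ : UpperHalfPlane) : ℂ :=
  ((periods τ).weierstrassP (τ / 4) - (periods τ).weierstrassP (1 / 4)) /
    ((periods τ).weierstrassP (τ / 4) - (periods τ).weierstrassP (1 / 4 + τ / 2))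

/-! ### The action of `(ℤ/2)³` on `E` and of `(ℤ/2)⁹` on `T = E₁ × E₂ × E₃` -/

/-- `x ↦ (-1)ˢ x` for `s ∈ ℤ/2`. -/
def sgn {A : Type*} [AddCommGroup A] (s : ZMod 2) (x : A) : A := if s = 0 then x else -x

/-- `s ↦ s · c` for `s ∈ ℤ/2`. -/
def shift {A : Type*} [AddCommGroup A] (s : ZMod 2) (c : A) : A := if s = 0 then 0 else c

/-- The action of `(ζ, η, ε) ∈ (ℤ/2)³` on `E`: it is generated by
`z ↦ -z` for `(1,0,0)`, `z ↦ -z + τ/2` for `(0,1,0)` and `z ↦ -z + 1/2` for `(0,0,1)`, so that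
`(ζ, η, ε)` acts by `z ↦ (-1)^(ζ+η+ε) z + η τ/2 + ε/2`. -/
noncomputable def actE (τ : UpperHalfPlane) (g : Fin 3 → ZMod 2) (x : E τ) : E τ :=
  sgn (g 0 + g 1 + g 2) x + shift (g 1) (toE τ (τ / 2)) + shift (g 2) (toE τ (1 / 2))

/-- The group `𝒢 ≅ (ℤ/2)⁹`; the element `g` has the coordinates
`ζⱼ = g j 0`, `ηⱼ = g j 1`, `εⱼ = g j 2`. -/
abbrev GG : Type := Fin 3 → Fin 3 → ZMod 2

/-- The product `T = E₁ × E₂ × E₃`. -/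
abbrev T (τ : Fin 3 → UpperHalfPlane) : Type := ∀ j, E (τ j)

/-- The projection `ℂ³ → T`. -/
noncomputable def toT (τ : Fin 3 → UpperHalfPlane) (z : Fin 3 → ℂ) : T τ := fun j => toE (τ j) (z j)

/-- The action of `𝒢` on `T`. -/
noncomputable def act (τ : Fin 3 → UpperHalfPlane) (g : GG) (x : T τ) : T τ :=
  fun j => actE (τ j) (g j) (x j)

/-- The subgroup `𝒢₀ = {η₁ = η₂ = η₃, ε₁ + ε₂ + ε₃ = 0}` of `𝒢`. -/
def GG0 : AddSubgroup GG where
  carrier := {g | g 0 1 = g 1 1 ∧ g 1 1 = g 2 1 ∧ g 0 2 + g 1 2 + g 2 2 = 0}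
  zero_mem' := by simp
  add_mem' := by
    rintro a b ⟨h1, h2, h3⟩ ⟨k1, k2, k3⟩
    refine ⟨by simp [h1, k1], by simp [h2, k2], ?_⟩
    simp only [Pi.add_apply]
    linear_combination h3 + k3
  neg_mem' := by
    rintro a ⟨h1, h2, h3⟩
    refine ⟨by simp [h1], by simp [h2], ?_⟩
    simp only [Pi.neg_apply]
    linear_combination -h3

theorem zmod2_cases (s : ZMod 2) : s = 0 ∨ s = 1 := by
  revert s; decide

theorem sgn_sgn {A : Type*} [AddCommGroup A] (s t : ZMod 2) (x : A) :
    sgn s (sgn t x) = sgn (s + t) x := by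
  have h11 : (1 : ZMod 2) + 1 = 0 := by decide
  rcases zmod2_cases s with rfl | rfl <;> rcases zmod2_cases t with rfl | rfl <;> simp [sgn, h11]

theorem sgn_add {A : Type*} [AddCommGroup A] (s : ZMod 2) (x y : A) :
    sgn s (x + y) = sgn s x + sgn s y := by
  rcases zmod2_cases s with rfl | rfl <;> simp [sgn, add_comm]

theorem sgn_shift {A : Type*} [AddCommGroup A] (s t : ZMod 2) (c : A) (hc : c + c = 0) :
    sgn s (shift t c) = shift t c := by
  have hc' : -c = c := neg_eq_of_add_eq_zero_left hc
  rcases zmod2_cases s with rfl | rfl <;> rcases zmod2_cases t with rfl | rfl <;>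
    simp [sgn, shift, hc']

theorem shift_add {A : Type*} [AddCommGroup A] (s t : ZMod 2) (c : A) (hc : c + c = 0) :
    shift (s + t) c = shift s c + shift t c := by
  have h11 : (1 : ZMod 2) + 1 = 0 := by decide
  rcases zmod2_cases s with rfl | rfl <;> rcases zmod2_cases t with rfl | rfl <;>
    simp [shift, h11, hc]

theorem toE_half_add (τ : UpperHalfPlane) : toE τ (1 / 2) + toE τ (1 / 2) = 0 := by
  rw [toE, ← Submodule.Quotient.mk_add, Submodule.Quotient.mk_eq_zero]
  norm_num
  exact (periods τ).ω₁_mem_lattice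

theorem toE_tau_half_add (τ : UpperHalfPlane) : toE τ (τ / 2) + toE τ (τ / 2) = 0 := by
  rw [toE, ← Submodule.Quotient.mk_add, Submodule.Quotient.mk_eq_zero, add_halves]
  exact (periods τ).ω₂_mem_lattice

theorem actE_add (τ : UpperHalfPlane) (g h : Fin 3 → ZMod 2) (x : E τ) :
    actE τ (g + h) x = actE τ g (actE τ h x) := by
  simp only [actE, Pi.add_apply, sgn_add, sgn_sgn,
    sgn_shift _ _ _ (toE_half_add τ), sgn_shift _ _ _ (toE_tau_half_add τ),
    shift_add _ _ _ (toE_half_add τ), shift_add _ _ _ (toE_tau_half_add τ)]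
  rw [show g 0 + h 0 + (g 1 + h 1) + (g 2 + h 2) = g 0 + g 1 + g 2 + (h 0 + h 1 + h 2) by ring]
  abel

theorem act_zero (τ : Fin 3 → UpperHalfPlane) (x : T τ) : act τ 0 x = x := by
  funext j
  simp [act, actE, sgn, shift]

theorem act_add (τ : Fin 3 → UpperHalfPlane) (g h : GG) (x : T τ) :
    act τ (g + h) x = act τ g (act τ h x) := by
  funext j
  exact actE_add (τ j) (g j) (h j) (x j)

/-! ### Del Pezzo surfaces in `ℙ¹ × ℙ¹ × ℙ¹` and Burniat hypersurfaces -/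

/-- The threefold `ℙ¹ × ℙ¹ × ℙ¹`. -/
abbrev P1Cube : Type := Fin 3 → P1

/-- Homogeneous coordinates `(s : t)` of a point of `ℙ¹`. -/
noncomputable def hom : P1 → Fin 2 → ℂ
  | none => ![1, 0]
  | some x => ![x, 1]

/-- The form of multidegree `(1,1,1)` with coefficients `c`, in the homogeneous coordinates
`X (j, 0), X (j, 1)` of the `j`-th factor. -/
noncomputable def triForm (c : Fin 2 → Fin 2 → Fin 2 → ℂ) : MvPolynomial (Fin 3 × Fin 2) ℂ :=
  ∑ i, ∑ k, ∑ l, MvPolynomial.C (c i k l) *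
    MvPolynomial.X (0, i) * MvPolynomial.X (1, k) * MvPolynomial.X (2, l)

/-- `Y` is an irreducible Del Pezzo surface of degree `6` in `ℙ¹ × ℙ¹ × ℙ¹`, that is, an
irreducible divisor of multidegree `(1,1,1)`. -/
def IsDelPezzo (Y : Set P1Cube) : Prop :=
  ∃ c : Fin 2 → Fin 2 → Fin 2 → ℂ, Irreducible (triForm c) ∧
    Y = {x | MvPolynomial.eval (fun m : Fin 3 × Fin 2 => hom (x m.1) m.2) (triForm c) = 0}

open Classical in
/-- The involution `(s : t) ↦ (t : s)` of `ℙ¹`. -/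
noncomputable def swapP1 : P1 → P1
  | none => ((0 : ℂ) : P1)
  | some x => if x = 0 then OnePoint.infty else ((x⁻¹ : ℂ) : P1)

/-- The involution `(s : t) ↦ (s : -t)` of `ℙ¹`. -/
noncomputable def negP1 (x : P1) : P1 := OnePoint.map (fun y : ℂ => -y) x

/-- The group `ℋ ≅ (ℤ/2)⁶`, three copies of `ℋ₁ ≅ (ℤ/2)²`. -/
abbrev HH : Type := Fin 3 → Fin 2 → ZMod 2

/-- The action of `ℋ` on `ℙ¹ × ℙ¹ × ℙ¹`. -/
noncomputable def actP1 (h : HH) (x : P1Cube) : P1Cube := fun j =>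
  (if h j 0 = 0 then id else swapP1) ((if h j 1 = 0 then id else negP1) (x j))

/-- The map `π' : T → ℙ¹ × ℙ¹ × ℙ¹`, `(z₁, z₂, z₃) ↦ (𝓛₁(z₁)/b₁, 𝓛₂(z₂)/b₂, 𝓛₃(z₃)/b₃)`. -/
noncomputable def piMap (τ : Fin 3 → UpperHalfPlane) (x : T τ) : P1Cube := fun j =>
  OnePoint.map (fun y : ℂ => y / legendreB (τ j)) (legendre (τ j) (x j))

/-- Burniat hypersurfaces in `T`: the inverse images under `π'` of irreducible Del Pezzo surfaces
of degree `6` that are invariant under a subgroup `H ≅ (ℤ/2)²` of `ℋ`. -/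
def IsBurniatHypersurface (τ : Fin 3 → UpperHalfPlane) (X : Set (T τ)) : Prop :=
  ∃ (Y : Set P1Cube) (H : AddSubgroup HH), IsDelPezzo Y ∧
    Nonempty (H ≃+ (Fin 2 → ZMod 2)) ∧ (∀ h ∈ H, ∀ y ∈ Y, actP1 h y ∈ Y) ∧
    X = piMap τ ⁻¹' Y

/-- `X` is a Burniat hypersurface in `T` and `G ≅ (ℤ/2)³` is a subgroup of `𝒢₀` that acts freely on
`X`: the data of a generalized Burniat type surface. -/
structure IsGBTPair (τ : Fin 3 → UpperHalfPlane) (X : Set (T τ)) (G : AddSubgroup GG) : Prop where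
  burniat : IsBurniatHypersurface τ X
  le : G ≤ GG0
  iso : Nonempty (G ≃+ (Fin 3 → ZMod 2))
  invariant : ∀ g ∈ G, ∀ x ∈ X, act τ g x ∈ X
  free : ∀ g ∈ G, g ≠ 0 → ∀ x ∈ X, act τ g x ≠ x

/-- Two points of `X` are identified when they lie in the same `G`-orbit. -/
def orbitSetoid (τ : Fin 3 → UpperHalfPlane) (X : Set (T τ)) (G : AddSubgroup GG) : Setoid X where
  r x y := ∃ g ∈ G, act τ g x.1 = y.1
  iseqv :=
    { refl := fun x => ⟨0, G.zero_mem, act_zero τ x.1⟩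
      symm := by
        rintro x y ⟨g, hg, h⟩
        exact ⟨-g, G.neg_mem hg, by rw [← h, ← act_add, neg_add_cancel, act_zero]⟩
      trans := by
        rintro x y z ⟨g, hg, h⟩ ⟨k, hk, h'⟩
        exact ⟨k + g, G.add_mem hk hg, by rw [act_add, h, h']⟩ }

/-- The quotient model `X / G`, with the quotient topology. -/
abbrev Model (τ : Fin 3 → UpperHalfPlane) (X : Set (T τ)) (G : AddSubgroup GG) : Type :=
  Quotient (orbitSetoid τ X G)

/-! ### Complex analytic structure, smooth points and nodes

A reduced complex space is described by its topology together with its sheaf of holomorphic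
functions, given by the predicate "`f` is holomorphic near the point `p`". -/

/-- Holomorphic functions on a subset `A` of `ℂⁿ`: local restrictions of holomorphic functions. -/
def HolSub {n : ℕ} (A : Set (Fin n → ℂ)) (f : A → ℂ) (p : A) : Prop :=
  ∃ F : (Fin n → ℂ) → ℂ, AnalyticAt ℂ F p.1 ∧ ∀ᶠ w in 𝓝 p.1, ∀ h : w ∈ A, f ⟨w, h⟩ = F w

/-- Holomorphic functions on a subset `X` of `T`: local restrictions of holomorphic functions on
`T`, in the coordinates of the universal covering `ℂ³`. -/
def HolT (τ : Fin 3 → UpperHalfPlane) (X : Set (T τ)) (f : X → ℂ) (p : X) : Prop :=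
  ∀ z : Fin 3 → ℂ, toT τ z = p.1 →
    ∃ F : (Fin 3 → ℂ) → ℂ, AnalyticAt ℂ F z ∧
      ∀ᶠ w in 𝓝 z, ∀ h : toT τ w ∈ X, f ⟨toT τ w, h⟩ = F w

/-- Holomorphic functions on the quotient `X / G`: those whose pull-back to `X` is holomorphic. -/
def HolModel (τ : Fin 3 → UpperHalfPlane) (X : Set (T τ)) (G : AddSubgroup GG)
    (f : Model τ X G → ℂ) (q : Model τ X G) : Prop :=
  ∀ x : X, Quotient.mk (orbitSetoid τ X G) x = q →
    HolT τ X (fun y => f (Quotient.mk (orbitSetoid τ X G) y)) x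

/-- The germs of `(A, O)` at `p` and of `(B, O')` at `p'` are isomorphic: some homeomorphism between
neighbourhoods of `p` and `p'` identifies the holomorphic functions. -/
def GermIso {A B : Type*} [TopologicalSpace A] [TopologicalSpace B]
    (O : (A → ℂ) → A → Prop) (p : A) (O' : (B → ℂ) → B → Prop) (p' : B) : Prop :=
  ∃ e : OpenPartialHomeomorph A B, p ∈ e.source ∧ e p = p' ∧
    ∀ x ∈ e.source, ∀ f : B → ℂ, O' f (e x) ↔ O (fun y => f (e y)) x

/-- `p` is a smooth point of a complex surface: the germ is that of `ℂ²` at `0`. -/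
def IsSmoothPoint {A : Type*} [TopologicalSpace A] (O : (A → ℂ) → A → Prop) (p : A) : Prop :=
  GermIso O p (fun (f : (Fin 2 → ℂ) → ℂ) z => AnalyticAt ℂ f z) 0

/-- The quadric cone `x² + y² + z² = 0` in `ℂ³`. -/
def cone : Set (Fin 3 → ℂ) := {v | v 0 ^ 2 + v 1 ^ 2 + v 2 ^ 2 = 0}

/-- The vertex of the cone. -/
def vertex : cone := ⟨0, by simp [cone]⟩

/-- `p` is a node (an ordinary double point): the germ is that of the cone at its vertex. -/
def IsNode {A : Type*} [TopologicalSpace A] (O : (A → ℂ) → A → Prop) (p : A) : Prop :=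
  GermIso O p (HolSub cone) vertex

/-- The singular locus. -/
def singularLocus {A : Type*} [TopologicalSpace A] (O : (A → ℂ) → A → Prop) : Set A :=
  {p | ¬ IsSmoothPoint O p}

end Burniat

namespace Burniat

open Filter Topology

section Elliptic

/-- Liouville's theorem for elliptic functions without poles. -/
theorem exists_tendsto_const_of_periodic (L : PeriodPair) {f : ℂ → ℂ} (hf : Meromorphic f)
    (hper : ∀ z, ∀ l ∈ L.lattice, f (z + l) = f z) (hord : ∀ z, 0 ≤ meromorphicOrderAt f z) :
    ∃ c, ∀ z, Tendsto f (𝓝[≠] z) (𝓝 c) := by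
  choose g hg using fun z => tendsto_nhds_of_meromorphicOrderAt_nonneg (hf z) (hord z)
  have hdiff : Differentiable ℂ g := by
    intro z
    obtain ⟨h, hh, hfh⟩ := (hf z).meromorphicOrderAt_nonneg_iff.mp (hord z)
    have hgz : g z = h z :=
      tendsto_nhds_unique (hg z) ((hh.continuousAt.continuousWithinAt.tendsto).congr' hfh.symm)
    have h2 : ∀ᶠ w in 𝓝[≠] z, g w = h w := by
      filter_upwards [eventually_eventually_nhdsWithin.mpr hfh, self_mem_nhdsWithin,
        hh.eventually_analyticAt.filter_mono nhdsWithin_le_nhds] with w hw hwz hwa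
      have hw' : f =ᶠ[𝓝 w] h := by
        rwa [IsOpen.nhdsWithin_eq isOpen_compl_singleton hwz] at hw
      exact tendsto_nhds_unique (hg w)
        ((hwa.continuousAt.continuousWithinAt.tendsto).congr'
          (hw'.filter_mono nhdsWithin_le_nhds).symm)
    have h3 : g =ᶠ[𝓝 z] h := by
      rw [eventually_nhdsWithin_iff] at h2
      filter_upwards [h2] with w hw
      by_cases hwz : w = z
      · rw [hwz, hgz]
      · exact hw hwz
    exact hh.differentiableAt.congr_of_eventuallyEq h3
  have hgper : ∀ z w, w ∈ L.lattice → g (z + w) = g z := by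
    intro z w hw
    refine tendsto_nhds_unique (f := fun y => f (y + w)) (l := 𝓝[≠] z) ?_ ?_
    · refine (hg (z + w)).comp ?_
      refine tendsto_nhdsWithin_of_tendsto_nhds_of_eventually_within _
        ((continuous_add_const w).tendsto z |>.mono_left nhdsWithin_le_nhds) ?_
      filter_upwards [self_mem_nhdsWithin] with y hy
      simpa using hy
    · simpa [hper _ w hw] using hg z
  have hb := (IsZLattice.isCompact_range_of_periodic L.lattice g hdiff.continuous hgper).isBounded
  exact ⟨g 0, fun z => hdiff.apply_eq_apply_of_bounded hb z 0 ▸ hg z⟩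

variable (L : PeriodPair)

theorem meromorphic_weierstrassP_sub (a : ℂ) : Meromorphic fun z => L.weierstrassP z - a :=
  fun z => (L.meromorphic_weierstrassP z).sub (MeromorphicAt.const a z)

theorem meromorphic_comp_add_const {f : ℂ → ℂ} (hf : Meromorphic f) (c : ℂ) :
    Meromorphic fun z => f (z + c) := fun z =>
  meromorphicAt_comp_add_const_iff_meromorphicAt.mpr (hf (z + c))

theorem meromorphicOrderAt_comp_add (f : ℂ → ℂ) (c z : ℂ) :
    meromorphicOrderAt (fun z => f (z + c)) z = meromorphicOrderAt f (z + c) :=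
  meromorphicOrderAt_comp_add_const_eq_meromorphicOrderAt

theorem meromorphicOrderAt_comp_sub (f : ℂ → ℂ) (c z : ℂ) :
    meromorphicOrderAt (fun z => f (z - c)) z = meromorphicOrderAt f (z - c) :=
  meromorphicOrderAt_comp_sub_const_eq_meromorphicOrderAt

variable {L}

theorem order_sub_of_mem {l : ℂ} (hl : l ∈ L.lattice) (a : ℂ) :
    meromorphicOrderAt (fun z => L.weierstrassP z - a) l = -2 := by
  have h := meromorphicOrderAt_add_eq_left_of_lt (f₁ := L.weierstrassP) (f₂ := fun _ => -a)
    (x := l) (MeromorphicAt.const _ _) (by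
      rw [L.order_weierstrassP l hl]
      exact lt_of_lt_of_le (by decide) analyticAt_const.meromorphicOrderAt_nonneg)
  rw [L.order_weierstrassP l hl] at h
  simpa [sub_eq_add_neg, Pi.add_def] using h

theorem order_sub_ne_top (a z : ℂ) :
    meromorphicOrderAt (fun z => L.weierstrassP z - a) z ≠ ⊤ :=
  MeromorphicOn.meromorphicOrderAt_ne_top_of_isPreconnected (U := Set.univ) (x := 0)
    (fun z _ => meromorphic_weierstrassP_sub L a z) isPreconnected_univ trivial trivial (by
      rw [order_sub_of_mem L.lattice.zero_mem]; decide)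

theorem analyticAt_weierstrassP {z : ℂ} (hz : z ∉ L.lattice) : AnalyticAt ℂ L.weierstrassP z :=
  L.analyticOnNhd_weierstrassP z hz

theorem analyticAt_weierstrassP_sub {z : ℂ} (hz : z ∉ L.lattice) (a : ℂ) :
    AnalyticAt ℂ (fun z => L.weierstrassP z - a) z :=
  (analyticAt_weierstrassP hz).sub analyticAt_const

theorem order_sub_nonneg {z : ℂ} (hz : z ∉ L.lattice) (a : ℂ) :
    0 ≤ meromorphicOrderAt (fun z => L.weierstrassP z - a) z :=
  (analyticAt_weierstrassP_sub hz a).meromorphicOrderAt_nonneg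

theorem order_sub_eq_zero {z a : ℂ} (hz : z ∉ L.lattice) (h : L.weierstrassP z ≠ a) :
    meromorphicOrderAt (fun z => L.weierstrassP z - a) z = 0 := by
  have h0 := (analyticAt_weierstrassP_sub hz a).analyticOrderAt_eq_zero.mpr (sub_ne_zero.mpr h)
  rw [(analyticAt_weierstrassP_sub hz a).meromorphicOrderAt_eq, h0]; rfl

theorem order_sub_pos {z a : ℂ} (hz : z ∉ L.lattice) (h : L.weierstrassP z = a) :
    1 ≤ meromorphicOrderAt (fun z => L.weierstrassP z - a) z := by
  refine (natCast_le_analyticOrderAt_iff_iteratedDeriv_eq_zero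
    (analyticAt_weierstrassP_sub hz a) (n := 1)).mpr ?_ |> fun h1 => ?_
  · rw [(analyticAt_weierstrassP_sub hz a).meromorphicOrderAt_eq]
    exact ENat.monotone_map_iff.mpr Nat.mono_cast h1
  · intro i hi
    obtain rfl : i = 0 := by omega
    simp [h]

theorem two_le_order_sub {z a : ℂ} (hz : z ∉ L.lattice) (h : L.weierstrassP z = a)
    (h' : L.derivWeierstrassP z = 0) :
    2 ≤ meromorphicOrderAt (fun z => L.weierstrassP z - a) z := by
  refine (natCast_le_analyticOrderAt_iff_iteratedDeriv_eq_zero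
    (analyticAt_weierstrassP_sub hz a) (n := 2)).mpr ?_ |> fun h1 => ?_
  · rw [(analyticAt_weierstrassP_sub hz a).meromorphicOrderAt_eq]
    exact ENat.monotone_map_iff.mpr Nat.mono_cast h1
  · intro i hi
    obtain rfl | rfl : i = 0 ∨ i = 1 := by omega
    · simp [h]
    · simp [iteratedDeriv_one, h', L.deriv_weierstrassP]

theorem order_sub_eq_one {z a : ℂ} (hz : z ∉ L.lattice) (h : L.weierstrassP z = a)
    (h' : L.derivWeierstrassP z ≠ 0) :
    meromorphicOrderAt (fun z => L.weierstrassP z - a) z = 1 := by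
  have h0 := (analyticAt_weierstrassP hz).analyticOrderAt_sub_eq_one_of_deriv_ne_zero
    (by rwa [L.deriv_weierstrassP])
  rw [h] at h0
  rw [(analyticAt_weierstrassP_sub hz a).meromorphicOrderAt_eq, h0]; rfl

theorem weierstrassP_add_of_mem (z : ℂ) {l : ℂ} (hl : l ∈ L.lattice) :
    L.weierstrassP (z + l) = L.weierstrassP z := L.weierstrassP_add_coe z ⟨l, hl⟩

theorem weierstrassP_eq_of_sub_mem {z w : ℂ} (h : z - w ∈ L.lattice) :
    L.weierstrassP z = L.weierstrassP w := by
  simpa using weierstrassP_add_of_mem w h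

theorem weierstrassP_eq_of_add_mem {z w : ℂ} (h : z + w ∈ L.lattice) :
    L.weierstrassP z = L.weierstrassP w := by
  rw [← L.weierstrassP_neg w]
  exact weierstrassP_eq_of_sub_mem (by simpa using h)

theorem derivWeierstrassP_eq_zero {a : ℂ} (h2 : 2 * a ∈ L.lattice) :
    L.derivWeierstrassP a = 0 := by
  have h := L.derivWeierstrassP_add_coe (-a) ⟨2 * a, h2⟩
  rw [L.derivWeierstrassP_neg, show -a + 2 * a = a by ring] at h
  linear_combination h / 2


theorem pole_zero_cancel {x y : WithTop ℤ} (hx : x = -2) (hy : 2 ≤ y) : 0 ≤ x + y := by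
  subst hx
  exact le_trans (by decide : (0 : WithTop ℤ) ≤ -2 + 2) (add_le_add le_rfl hy)

theorem notMem_lattice_add {a z : ℂ} (ha : a ∉ L.lattice) (hz : z ∈ L.lattice) :
    z + a ∉ L.lattice := fun h => ha (by simpa using sub_mem h hz)

/-- An elliptic function without poles that has a zero vanishes. -/
theorem eq_zero_of_periodic {f : ℂ → ℂ} (hf : Meromorphic f)
    (hper : ∀ z, ∀ l ∈ L.lattice, f (z + l) = f z) (hord : ∀ z, 0 ≤ meromorphicOrderAt f z) :
    (∃ z, 0 < meromorphicOrderAt f z) → ∀ z, ContinuousAt f z → f z = 0 := by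
  rintro ⟨z₀, hz₀⟩ z hz
  obtain ⟨c, hc⟩ := exists_tendsto_const_of_periodic L hf hper hord
  have : c = 0 := tendsto_nhds_unique (hc z₀) (tendsto_zero_of_meromorphicOrderAt_pos hz₀)
  subst this
  exact tendsto_nhds_unique (hz.tendsto.mono_left nhdsWithin_le_nhds) (hc z)

/-- For a half period `a`, the product of `℘(z) - ℘(a)` and its translate by `a` is constant. -/
theorem exists_halfPeriod_product {a : ℂ} (ha : a ∉ L.lattice) (h2 : 2 * a ∈ L.lattice) :
    ∃ C ≠ 0, (∀ z, z ∉ L.lattice → z + a ∉ L.lattice →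
      (L.weierstrassP z - L.weierstrassP a) * (L.weierstrassP (z + a) - L.weierstrassP a) = C) ∧
      meromorphicOrderAt (fun z => L.weierstrassP z - L.weierstrassP a) a = 2 := by
  set D : ℂ → ℂ := fun z => L.weierstrassP z - L.weierstrassP a with hD
  set f : ℂ → ℂ := fun z => D z * D (z + a) with hf
  have hDm : Meromorphic D := meromorphic_weierstrassP_sub L _
  have hDp : ∀ z, ∀ l ∈ L.lattice, D (z + l) = D z := fun z l hl => by
    simp only [hD, weierstrassP_add_of_mem z hl]
  have hfm : Meromorphic f := fun z => (hDm z).mul (meromorphic_comp_add_const hDm a z)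
  have hfo : ∀ z, meromorphicOrderAt f z = meromorphicOrderAt D z + meromorphicOrderAt D (z + a) :=
    fun z => by
      rw [← meromorphicOrderAt_comp_add]
      exact meromorphicOrderAt_mul (hDm z) (meromorphic_comp_add_const hDm a z)
  have h0 : ∀ z, z - a ∈ L.lattice → 2 ≤ meromorphicOrderAt D z := fun z hz =>
    two_le_order_sub (fun h => ha (by simpa using sub_mem h hz)) (weierstrassP_eq_of_sub_mem hz)
      (derivWeierstrassP_eq_zero (by
        have := add_mem h2 (add_mem hz hz)
        rwa [show 2 * a + (z - a + (z - a)) = 2 * z by ring] at this))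
  have hnn : ∀ z, 0 ≤ meromorphicOrderAt f z := by
    intro z
    rw [hfo]
    by_cases hz : z ∈ L.lattice
    · exact pole_zero_cancel (order_sub_of_mem hz _) (h0 _ (by simpa using hz))
    by_cases hza : z + a ∈ L.lattice
    · rw [add_comm]
      refine pole_zero_cancel (order_sub_of_mem hza _) (h0 _ ?_)
      have := sub_mem hza h2
      rwa [show z + a - 2 * a = z - a by ring] at this
    · exact add_nonneg (order_sub_nonneg hz _) (order_sub_nonneg hza _)
  obtain ⟨C, hC⟩ := exists_tendsto_const_of_periodic L hfm (fun z l hl => by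
    simp only [hf, hDp z l hl, show z + l + a = z + a + l by ring, hDp (z + a) l hl]) hnn
  have hC0 : C ≠ 0 := by
    rintro rfl
    have hconst : ∀ z, ContinuousAt f z → f z = 0 := fun z hz =>
      tendsto_nhds_unique (hz.tendsto.mono_left nhdsWithin_le_nhds) (hC z)
    have h1 : f =ᶠ[𝓝[≠] (0 : ℂ)] 0 := by
      filter_upwards [(hfm 0).eventually_analyticAt] with z hz
      exact hconst z hz.continuousAt
    have h2 := meromorphicOrderAt_eq_top_iff.mpr h1
    rw [hfo] at h2
    rcases WithTop.add_eq_top.mp h2 with h | h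
    · exact order_sub_ne_top _ _ h
    · exact order_sub_ne_top _ _ h
  refine ⟨C, hC0, fun z hz hza => ?_, ?_⟩
  · have hcont : ContinuousAt f z := by
      have h1 := (analyticAt_weierstrassP_sub hz (L.weierstrassP a)).continuousAt
      have h2 : ContinuousAt (fun z => D (z + a)) z :=
        ContinuousAt.comp (f := fun z => z + a) (g := D)
          (analyticAt_weierstrassP_sub hza (L.weierstrassP a)).continuousAt
          (continuous_add_const a).continuousAt
      exact h1.mul h2
    exact tendsto_nhds_unique (hcont.tendsto.mono_left nhdsWithin_le_nhds) (hC z)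
  · have h3 : meromorphicOrderAt f a = 0 :=
      (tendsto_ne_zero_iff_meromorphicOrderAt_eq_zero (hfm a)).mp ⟨C, hC0, hC a⟩
    rw [hfo, ← two_mul, order_sub_of_mem h2] at h3
    revert h3
    change meromorphicOrderAt D a + -2 = 0 → _
    cases hh : meromorphicOrderAt D a with
    | top => intro h; exact absurd h (by decide)
    | coe n =>
      intro h
      have : ((n + -2 : ℤ) : WithTop ℤ) = ((0 : ℤ) : WithTop ℤ) := by
        rw [WithTop.coe_add]; exact h
      have := WithTop.coe_injective this
      have : n = 2 := by omega
      subst this; rfl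

theorem derivWeierstrassP_ne_zero {a : ℂ} (h2 : 2 * a ∉ L.lattice) :
    L.derivWeierstrassP a ≠ 0 := by
  intro hd
  have ha : a ∉ L.lattice := fun h => h2 (by rw [two_mul]; exact add_mem h h)
  set D : ℂ → ℂ := fun z => L.weierstrassP z - L.weierstrassP a with hD
  set f : ℂ → ℂ := fun z => D z * (D (z + a) * D (z - a)) with hf
  have hDm : Meromorphic D := meromorphic_weierstrassP_sub L _
  have hDa := meromorphic_comp_add_const hDm a
  have hDa' : Meromorphic fun z => D (z - a) := by
    simpa [sub_eq_add_neg] using meromorphic_comp_add_const hDm (-a)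
  have hDp : ∀ z, ∀ l ∈ L.lattice, D (z + l) = D z := fun z l hl => by
    simp only [hD, weierstrassP_add_of_mem z hl]
  have hfm : Meromorphic f := fun z => (hDm z).mul ((hDa z).mul (hDa' z))
  have hfo : ∀ z, meromorphicOrderAt f z = meromorphicOrderAt D z +
      (meromorphicOrderAt D (z + a) + meromorphicOrderAt D (z - a)) :=
    fun z => by
      rw [← meromorphicOrderAt_comp_add, ← meromorphicOrderAt_comp_sub]
      have h1 : meromorphicOrderAt (fun z => D (z + a) * D (z - a)) z = _ :=
        meromorphicOrderAt_mul (hDa z) (hDa' z)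
      rw [← h1]
      exact meromorphicOrderAt_mul (hDm z) ((hDa z).mul (hDa' z))
  have h0 : ∀ z, z - a ∈ L.lattice → 2 ≤ meromorphicOrderAt D z := fun z hz =>
    two_le_order_sub (fun h => ha (by simpa using sub_mem h hz)) (weierstrassP_eq_of_sub_mem hz)
      (by
        have := L.derivWeierstrassP_add_coe a ⟨z - a, hz⟩
        simp only [add_sub_cancel] at this
        rw [this, hd])
  have h0' : ∀ z, z + a ∈ L.lattice → 2 ≤ meromorphicOrderAt D z := fun z hz =>
    two_le_order_sub (fun h => ha (by simpa using sub_mem hz h)) (weierstrassP_eq_of_add_mem hz)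
      (by
        have := L.derivWeierstrassP_add_coe (-a) ⟨z + a, hz⟩
        rw [L.derivWeierstrassP_neg, hd] at this
        simpa using this)
  have hpos : ∀ z ∈ L.lattice, 2 ≤ meromorphicOrderAt f z := fun z hz => by
    rw [hfo, order_sub_of_mem hz]
    have h1 := h0 (z + a) (by simpa using hz)
    have h2 := h0' (z - a) (by simpa using hz)
    exact le_trans (by decide : (2 : WithTop ℤ) ≤ -2 + (2 + 2))
      (add_le_add le_rfl (add_le_add h1 h2))
  have key : ∀ z, z - a ∈ L.lattice → z ∉ L.lattice ∧ z + a ∉ L.lattice := fun z hz =>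
    ⟨fun h => ha (by simpa using sub_mem h hz),
      fun h => h2 (by have := sub_mem h hz; rwa [show z + a - (z - a) = 2 * a by ring] at this)⟩
  have hnn : ∀ z, 0 ≤ meromorphicOrderAt f z := by
    intro z
    by_cases hz : z ∈ L.lattice
    · exact le_trans (by decide) (hpos z hz)
    rw [hfo]
    by_cases hza : z - a ∈ L.lattice
    · rw [add_comm (meromorphicOrderAt D (z + a)), ← add_assoc, add_comm (meromorphicOrderAt D z)]
      exact add_nonneg (pole_zero_cancel (order_sub_of_mem hza _) (h0 _ hza))
        (order_sub_nonneg (key z hza).2 _)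
    by_cases hza' : z + a ∈ L.lattice
    · rw [← add_assoc, add_comm (meromorphicOrderAt D z)]
      exact add_nonneg (pole_zero_cancel (order_sub_of_mem hza' _) (h0' _ hza'))
        (order_sub_nonneg hza _)
    · exact add_nonneg (order_sub_nonneg hz _)
        (add_nonneg (order_sub_nonneg hza' _) (order_sub_nonneg hza _))
  have hconst := eq_zero_of_periodic (L := L) hfm (fun z l hl => by
    simp only [hf, hDp z l hl, show z + l + a = z + a + l by ring, hDp (z + a) l hl,
      show z + l - a = z - a + l by ring, hDp (z - a) l hl]) hnn
    ⟨0, lt_of_lt_of_le (by decide) (hpos 0 L.lattice.zero_mem)⟩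
  have h1 : f =ᶠ[𝓝[≠] (0 : ℂ)] 0 := by
    filter_upwards [(hfm 0).eventually_analyticAt] with z hz
    exact hconst z hz.continuousAt
  have h3 := meromorphicOrderAt_eq_top_iff.mpr h1
  rw [hfo] at h3
  rcases WithTop.add_eq_top.mp h3 with h | h
  · exact order_sub_ne_top _ _ h
  rcases WithTop.add_eq_top.mp h with h | h
  · exact order_sub_ne_top _ _ h
  · exact order_sub_ne_top _ _ h


theorem even_order_of_even {f : ℂ → ℂ} (hf : MeromorphicAt f 0) (heven : ∀ z, f (-z) = f z) {n : ℤ}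
    (hn : meromorphicOrderAt f 0 = n) : Even n := by
  obtain ⟨g, hg, hg0, hfg⟩ := (meromorphicOrderAt_eq_int_iff hf).mp hn
  by_contra hodd
  rw [Int.not_even_iff_odd] at hodd
  have hneg : Tendsto (fun z : ℂ => -z) (𝓝[≠] 0) (𝓝[≠] 0) := by
    refine tendsto_nhdsWithin_of_tendsto_nhds_of_eventually_within _ ?_ ?_
    · have : Tendsto (fun z : ℂ => -z) (𝓝 0) (𝓝 (-0)) := continuous_neg.tendsto 0
      rw [neg_zero] at this
      exact this.mono_left nhdsWithin_le_nhds
    · filter_upwards [self_mem_nhdsWithin] with z hz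
      simpa using hz
  have h1 : ∀ᶠ z in 𝓝[≠] (0 : ℂ), g z = -g (-z) := by
    filter_upwards [hfg, hneg.eventually hfg, self_mem_nhdsWithin] with z h1 h2 hz
    rw [heven, h1] at h2
    simp only [sub_zero, smul_eq_mul, hodd.neg_zpow] at h2
    have : z ^ n ≠ 0 := zpow_ne_zero _ hz
    exact mul_left_cancel₀ this (by rw [h2]; ring)
  have h2 : Tendsto g (𝓝[≠] 0) (𝓝 (g 0)) := hg.continuousAt.tendsto.mono_left nhdsWithin_le_nhds
  have h3 : g 0 = -g 0 :=
    tendsto_nhds_unique h2 (((h2.comp hneg).neg).congr' (h1.mono fun z hz => hz.symm))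
  exact hg0 (by linear_combination h3 / 2)

theorem order_sq_mul (f : ℂ → ℂ) (hf : MeromorphicAt f 0) :
    meromorphicOrderAt (fun z => z ^ 2 * f z) 0 = 2 + meromorphicOrderAt f 0 := by
  have h1 : meromorphicOrderAt (fun z : ℂ => z ^ 2) 0 = 2 := by
    have h := meromorphicOrderAt_pow_id_sub_const (𝕜 := ℂ) (x := 0) (n := 2)
    simpa [Pi.pow_def] using h
  rw [← h1]
  exact meromorphicOrderAt_mul (by fun_prop) hf

/-- An even function with at most a pole of order three at `0` is a multiple of `℘` up to a
holomorphic function. -/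
theorem exists_sub_mul_weierstrassP {f : ℂ → ℂ} (hf : MeromorphicAt f 0)
    (heven : ∀ z, f (-z) = f z) (hord : -3 ≤ meromorphicOrderAt f 0) :
    ∃ c : ℂ, 0 ≤ meromorphicOrderAt (fun z => f z - c * L.weierstrassP z) 0 := by
  have hP := L.meromorphic_weierstrassP 0
  have hPo : meromorphicOrderAt (fun z => z ^ 2 * L.weierstrassP z) 0 = 0 := by
    rw [order_sq_mul _ hP, L.order_weierstrassP 0 L.lattice.zero_mem]; decide
  obtain ⟨d, hd, hdt⟩ := tendsto_ne_zero_of_meromorphicOrderAt_eq_zero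
    (f := fun z => z ^ 2 * L.weierstrassP z) (by fun_prop) hPo
  have hfo : 0 ≤ meromorphicOrderAt (fun z => z ^ 2 * f z) 0 := by
    rw [order_sq_mul _ hf]
    cases hn : meromorphicOrderAt f 0 with
    | top => exact le_of_eq_of_le rfl le_top
    | coe n =>
      have he := even_order_of_even hf heven hn
      rw [hn] at hord
      have h3 : (-3 : ℤ) ≤ n := WithTop.coe_le_coe.mp hord
      obtain ⟨k, rfl⟩ := he
      have : (0 : ℤ) ≤ 2 + (k + k) := by omega
      exact WithTop.coe_le_coe.mpr this
  obtain ⟨e, het⟩ := tendsto_nhds_of_meromorphicOrderAt_nonneg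
    (f := fun z => z ^ 2 * f z) (by fun_prop) hfo
  refine ⟨e / d, ?_⟩
  set h : ℂ → ℂ := fun z => f z - e / d * L.weierstrassP z with hh
  have hhm : MeromorphicAt h 0 := by fun_prop
  have hlim : Tendsto (fun z => z ^ 2 * h z) (𝓝[≠] 0) (𝓝 0) := by
    have := het.sub (hdt.const_mul (e / d))
    rw [div_mul_cancel₀ _ hd, sub_self] at this
    refine this.congr fun z => ?_
    simp only [hh]; ring
  have hpos := (tendsto_zero_iff_meromorphicOrderAt_pos (by fun_prop)).mp hlim
  rw [order_sq_mul _ hhm] at hpos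
  cases hn : meromorphicOrderAt h 0 with
  | top => exact le_top
  | coe n =>
    have he := even_order_of_even hhm (fun z => by simp only [hh, heven, L.weierstrassP_neg]) hn
    rw [hn] at hpos
    have h3 : (0 : ℤ) < 2 + n := WithTop.coe_lt_coe.mp hpos
    obtain ⟨k, rfl⟩ := he
    have : (0 : ℤ) ≤ k + k := by omega
    exact WithTop.coe_le_coe.mpr this

theorem eq_of_weierstrassP_eq {a w : ℂ} (ha : a ∉ L.lattice) (hw : w ∉ L.lattice)
    (h : L.weierstrassP w = L.weierstrassP a) : w - a ∈ L.lattice ∨ w + a ∈ L.lattice := by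
  by_contra! hcon
  obtain ⟨hwa, hwa'⟩ := hcon
  by_cases h2 : 2 * a ∈ L.lattice
  · obtain ⟨C, hC, hprod, -⟩ := exists_halfPeriod_product ha h2
    have := hprod w hw hwa'
    rw [h, sub_self, zero_mul] at this
    exact hC this.symm
  set D : ℂ → ℂ := fun z => L.weierstrassP z - L.weierstrassP a with hD
  set S : ℂ → ℂ := fun z => D (z + a) + D (z - a) with hS
  set f : ℂ → ℂ := fun z => D z * (D z * S z) with hf
  have hDm : Meromorphic D := meromorphic_weierstrassP_sub L _
  have hDa := meromorphic_comp_add_const hDm a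
  have hDa' : Meromorphic fun z => D (z - a) := by
    simpa [sub_eq_add_neg] using meromorphic_comp_add_const hDm (-a)
  have hSm : Meromorphic S := fun z => (hDa z).add (hDa' z)
  have hfm : Meromorphic f := fun z => (hDm z).mul ((hDm z).mul (hSm z))
  have hfo : ∀ z, meromorphicOrderAt f z = meromorphicOrderAt D z +
      (meromorphicOrderAt D z + meromorphicOrderAt S z) := fun z => by
    have h1 : meromorphicOrderAt (fun z => D z * S z) z = _ := meromorphicOrderAt_mul (hDm z) (hSm z)
    rw [← h1]
    exact meromorphicOrderAt_mul (hDm z) ((hDm z).mul (hSm z))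
  have hSo : ∀ z, min (meromorphicOrderAt D (z + a)) (meromorphicOrderAt D (z - a)) ≤
      meromorphicOrderAt S z := fun z => by
    rw [← meromorphicOrderAt_comp_add, ← meromorphicOrderAt_comp_sub]
    exact meromorphicOrderAt_add (hDa z) (hDa' z)
  have hDp : ∀ z, ∀ l ∈ L.lattice, D (z + l) = D z := fun z l hl => by
    simp only [hD, weierstrassP_add_of_mem z hl]
  have hDneg : ∀ z, D (-z) = D z := fun z => by simp only [hD, L.weierstrassP_neg]
  have hfp : ∀ z, ∀ l ∈ L.lattice, f (z + l) = f z := fun z l hl => by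
    simp only [hf, hS, hDp z l hl, show z + l + a = z + a + l by ring, hDp (z + a) l hl,
      show z + l - a = z - a + l by ring, hDp (z - a) l hl]
  have hfeven : ∀ z, f (-z) = f z := fun z => by
    simp only [hf, hS, hDneg]
    rw [show -z + a = -(z - a) by ring, show -z - a = -(z + a) by ring, hDneg, hDneg,
      add_comm (D (z - a))]
  have hD1 : ∀ z, z ∉ L.lattice → L.weierstrassP z = L.weierstrassP a →
      1 ≤ meromorphicOrderAt D z := fun z hz h => order_sub_pos hz h
  have hf0 : -3 ≤ meromorphicOrderAt f 0 := by
    have h1 : 1 ≤ meromorphicOrderAt S 0 := by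
      refine le_trans (le_min (hD1 _ (by simpa using ha) (by simp)) (hD1 _ ?_ ?_)) (hSo 0)
      · simpa using ha
      · simp [L.weierstrassP_neg]
    rw [hfo, order_sub_of_mem L.lattice.zero_mem]
    exact le_trans (by decide : (-3 : WithTop ℤ) ≤ -2 + (-2 + 1))
      (add_le_add le_rfl (add_le_add le_rfl h1))
  have hDle : ∀ z, -2 ≤ meromorphicOrderAt D z := fun z => by
    by_cases hz : z ∈ L.lattice
    · rw [order_sub_of_mem hz]
    · exact le_trans (by decide) (order_sub_nonneg hz _)
  have hfnn : ∀ z, z ∉ L.lattice → 0 ≤ meromorphicOrderAt f z := by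
    intro z hz
    have hgen : L.weierstrassP z = L.weierstrassP a → 0 ≤ meromorphicOrderAt f z := fun hza => by
      have h1 := hD1 z hz hza
      rw [hfo]
      exact le_trans (by decide : (0 : WithTop ℤ) ≤ 1 + (1 + -2)) (add_le_add h1 (add_le_add h1
        (le_trans (le_min (hDle _) (hDle _)) (hSo z))))
    by_cases h1 : z - a ∈ L.lattice
    · exact hgen (weierstrassP_eq_of_sub_mem h1)
    by_cases h2 : z + a ∈ L.lattice
    · exact hgen (weierstrassP_eq_of_add_mem h2)
    rw [hfo]
    exact add_nonneg (order_sub_nonneg hz _) (add_nonneg (order_sub_nonneg hz _)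
      (le_trans (le_min (order_sub_nonneg h2 _) (order_sub_nonneg h1 _)) (hSo z)))
  obtain ⟨c, hc⟩ := exists_sub_mul_weierstrassP (L := L) (hfm 0) hfeven hf0
  set k : ℂ → ℂ := fun z => f z - c * L.weierstrassP z with hk
  have hPm := L.meromorphic_weierstrassP
  have hkm : Meromorphic k := fun z => (hfm z).sub ((MeromorphicAt.const c z).mul (hPm z))
  have hkp : ∀ z, ∀ l ∈ L.lattice, k (z + l) = k z := fun z l hl => by
    simp only [hk, hfp z l hl, weierstrassP_add_of_mem z hl]
  have hknn : ∀ z, 0 ≤ meromorphicOrderAt k z := by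
    intro z
    by_cases hz : z ∈ L.lattice
    · have h1 := meromorphicOrderAt_comp_add k z 0
      rw [zero_add] at h1
      rw [← h1]
      simpa only [hkp _ z hz] using hc
    · have hA : AnalyticAt ℂ (fun z => -(c * L.weierstrassP z)) z :=
        (analyticAt_const.mul (analyticAt_weierstrassP hz)).neg
      have h1 := meromorphicOrderAt_add (hfm z) hA.meromorphicAt
      refine le_trans (le_min (hfnn z hz) hA.meromorphicOrderAt_nonneg) (h1.trans_eq ?_)
      simp [hk, sub_eq_add_neg, Pi.add_def]
  obtain ⟨C, hC⟩ := exists_tendsto_const_of_periodic L hkm hkp hknn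
  have hDc : ∀ z, z ∉ L.lattice → ContinuousAt D z := fun z hz =>
    (analyticAt_weierstrassP_sub hz _).continuousAt
  have hwval : C = -(c * L.weierstrassP a) := by
    have hcont : ContinuousAt k w := by
      have h1 : ContinuousAt (fun z => D (z + a)) w :=
        ContinuousAt.comp (f := fun z => z + a) (g := D) (hDc _ hwa')
          (continuous_add_const a).continuousAt
      have h2 : ContinuousAt (fun z => D (z - a)) w :=
        ContinuousAt.comp (f := fun z => z - a) (g := D) (hDc _ hwa)
          (continuous_id.sub continuous_const).continuousAt
      exact ((hDc w hw).mul ((hDc w hw).mul (h1.add h2))).sub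
        (continuousAt_const.mul (analyticAt_weierstrassP hw).continuousAt)
    have h1 := tendsto_nhds_unique (hC w) (hcont.tendsto.mono_left nhdsWithin_le_nhds)
    rw [h1]
    simp [hk, hf, hD, h]
  have hfa : Tendsto f (𝓝[≠] a) (𝓝 0) := by
    have h1 := (hC a).add (((analyticAt_weierstrassP ha).continuousAt.tendsto.mono_left
      nhdsWithin_le_nhds).const_mul c)
    rw [hwval, neg_add_cancel] at h1
    refine h1.congr fun z => ?_
    simp [hk]
  have hpos := (tendsto_zero_iff_meromorphicOrderAt_pos (hfm a)).mp hfa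
  have hDa1 : meromorphicOrderAt D a = 1 :=
    order_sub_eq_one ha rfl (derivWeierstrassP_ne_zero h2)
  have hSa : meromorphicOrderAt S a = -2 := by
    have h0 : meromorphicOrderAt (fun z => D (z - a)) a = -2 := by
      rw [meromorphicOrderAt_comp_sub, sub_self, order_sub_of_mem L.lattice.zero_mem]
    rw [← h0]
    refine meromorphicOrderAt_add_eq_right_of_lt (hDa a) ?_
    rw [h0, meromorphicOrderAt_comp_add, ← two_mul]
    exact lt_of_lt_of_le (by decide) (order_sub_nonneg h2 _)
  rw [hfo, hDa1, hSa] at hpos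
  exact absurd hpos (by decide)

theorem weierstrassP_eq_iff {z w : ℂ} (hz : z ∉ L.lattice) (hw : w ∉ L.lattice) :
    L.weierstrassP z = L.weierstrassP w ↔ z - w ∈ L.lattice ∨ z + w ∈ L.lattice :=
  ⟨eq_of_weierstrassP_eq hw hz, fun h =>
    h.elim weierstrassP_eq_of_sub_mem weierstrassP_eq_of_add_mem⟩

variable (L) in
theorem exists_weierstrassP_eq (v : ℂ) : ∃ z, z ∉ L.lattice ∧ L.weierstrassP z = v := by
  by_contra! hcon
  set f : ℂ → ℂ := (fun z => L.weierstrassP z - v)⁻¹ with hf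
  have hm := meromorphic_weierstrassP_sub L v
  have hfm : Meromorphic f := fun z => (hm z).inv
  have h0 : meromorphicOrderAt f 0 = 2 := by
    rw [hf, meromorphicOrderAt_inv, order_sub_of_mem L.lattice.zero_mem]; rfl
  have hz := L.ω₁_div_two_notMem_lattice
  refine inv_ne_zero (sub_ne_zero.mpr (hcon _ hz)) ?_
  refine eq_zero_of_periodic (L := L) hfm (fun z l hl => ?_) (fun z => ?_)
    ⟨0, by rw [h0]; decide⟩ (L.ω₁ / 2) ?_
  · simp [hf, weierstrassP_add_of_mem z hl]
  · rw [hf, meromorphicOrderAt_inv]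
    by_cases hz : z ∈ L.lattice
    · rw [order_sub_of_mem hz]; decide
    · rw [order_sub_eq_zero hz (hcon z hz)]; decide
  · exact (analyticAt_weierstrassP_sub hz v).continuousAt.inv₀ (sub_ne_zero.mpr (hcon _ hz))

end Elliptic

section HomogeneousCoordinates

/-- `(s : t)` are homogeneous coordinates of the point `x` of the projective line. -/
def IsHom (x : P1) (s t : ℂ) : Prop := (s ≠ 0 ∨ t ≠ 0) ∧ s * hom x 1 = t * hom x 0

@[simp] theorem hom_infty : hom OnePoint.infty = ![1, 0] := rfl

@[simp] theorem hom_coe (v : ℂ) : hom (v : P1) = ![v, 1] := rfl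

theorem hom_ne_zero (x : P1) : hom x 0 ≠ 0 ∨ hom x 1 ≠ 0 := by
  induction x using OnePoint.rec <;> simp

theorem isHom_hom (x : P1) : IsHom x (hom x 0) (hom x 1) := ⟨hom_ne_zero x, by ring⟩

theorem isHom_infty {s t : ℂ} : IsHom OnePoint.infty s t ↔ s ≠ 0 ∧ t = 0 := by
  simp only [IsHom, hom_infty, Matrix.cons_val_one, Matrix.cons_val_zero, mul_zero, mul_one]
  constructor
  · rintro ⟨h, h'⟩
    subst h'
    simpa using h
  · rintro ⟨h, rfl⟩
    exact ⟨Or.inl h, rfl⟩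

theorem isHom_coe {v s t : ℂ} : IsHom (v : P1) s t ↔ t ≠ 0 ∧ s = t * v := by
  simp only [IsHom, hom_coe, Matrix.cons_val_one, Matrix.cons_val_zero, mul_one]
  constructor
  · rintro ⟨h, rfl⟩
    exact ⟨fun h0 => by simp [h0] at h, rfl⟩
  · rintro ⟨h, rfl⟩
    exact ⟨Or.inr h, rfl⟩

theorem IsHom.exists_smul {x : P1} {s t : ℂ} (h : IsHom x s t) :
    ∃ c : ℂ, c ≠ 0 ∧ s = c * hom x 0 ∧ t = c * hom x 1 := by
  induction x using OnePoint.rec with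
  | infty =>
    obtain ⟨h1, h2⟩ := isHom_infty.mp h
    exact ⟨s, h1, by simp, by simpa using h2⟩
  | coe v =>
    obtain ⟨h1, h2⟩ := isHom_coe.mp h
    exact ⟨t, h1, by simpa using h2, by simp⟩

theorem IsHom.eq_iff {x y : P1} {s t s' t' : ℂ} (h : IsHom x s t) (h' : IsHom y s' t') :
    x = y ↔ s * t' = s' * t := by
  induction x using OnePoint.rec with
  | infty =>
    obtain ⟨h1, rfl⟩ := isHom_infty.mp h
    induction y using OnePoint.rec with
    | infty => obtain ⟨h1, rfl⟩ := isHom_infty.mp h'; simp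
    | coe w => obtain ⟨h3, rfl⟩ := isHom_coe.mp h'; simp [h1, h3]
  | coe v =>
    obtain ⟨h1, rfl⟩ := isHom_coe.mp h
    induction y using OnePoint.rec with
    | infty => obtain ⟨h3, rfl⟩ := isHom_infty.mp h'; simp [h1, h3]
    | coe w =>
      obtain ⟨h3, rfl⟩ := isHom_coe.mp h'
      rw [OnePoint.coe_eq_coe]
      constructor
      · rintro rfl; ring
      · intro h
        have : t * t' * (v - w) = 0 := by linear_combination h
        simpa [h1, h3, sub_eq_zero] using this

theorem exists_isHom {s t : ℂ} (h : s ≠ 0 ∨ t ≠ 0) : ∃ x : P1, IsHom x s t := by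
  by_cases ht : t = 0
  · exact ⟨OnePoint.infty, isHom_infty.mpr ⟨by simpa [ht] using h, ht⟩⟩
  · exact ⟨((s / t : ℂ) : P1), isHom_coe.mpr ⟨ht, by field_simp⟩⟩

theorem IsHom.negP1 {x : P1} {s t : ℂ} (h : IsHom x s t) : IsHom (negP1 x) (-s) t := by
  induction x using OnePoint.rec with
  | infty =>
    obtain ⟨h1, rfl⟩ := isHom_infty.mp h
    exact isHom_infty.mpr ⟨neg_ne_zero.mpr h1, rfl⟩
  | coe v =>
    obtain ⟨h1, rfl⟩ := isHom_coe.mp h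
    exact isHom_coe.mpr ⟨h1, by ring⟩

end HomogeneousCoordinates

section Legendre

variable (τ : UpperHalfPlane)

/-- The coordinate `𝓛(z) / b` on the projective line, as a function of `z ∈ ℂ`. -/
noncomputable def coordP (z : ℂ) : P1 :=
  OnePoint.map (fun y : ℂ => y / legendreB τ) (legendreLift τ z)

variable {τ}

theorem mem_periods_iff (α β : ℚ) :
    (α + β * τ : ℂ) ∈ (periods τ).lattice ↔ α.den = 1 ∧ β.den = 1 := by
  have h := PeriodPair.mul_ω₁_add_mul_ω₂_mem_lattice (L := periods τ) (α := α) (β := β)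
  rwa [show (periods τ).ω₁ = 1 from rfl, show (periods τ).ω₂ = (τ : ℂ) from rfl, mul_one] at h

theorem mem_periods_of {z : ℂ} (α β : ℚ) (hz : z = α + β * τ) (h : α.den = 1 ∧ β.den = 1) :
    z ∈ (periods τ).lattice := hz ▸ (mem_periods_iff α β).mpr h

theorem notMem_periods_of {z : ℂ} (α β : ℚ) (hz : z = α + β * τ) (h : ¬ (α.den = 1 ∧ β.den = 1)) :
    z ∉ (periods τ).lattice := hz ▸ fun h' => h ((mem_periods_iff α β).mp h')

theorem quarter_notMem : (1 / 4 : ℂ) ∉ (periods τ).lattice :=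
  notMem_periods_of (1 / 4) 0 (by push_cast; ring) (by norm_num)

theorem pole_notMem : (1 / 4 + τ / 2 : ℂ) ∉ (periods τ).lattice :=
  notMem_periods_of (1 / 4) (1 / 2) (by push_cast; ring) (by norm_num)

theorem tau_quarter_notMem : (τ / 4 : ℂ) ∉ (periods τ).lattice :=
  notMem_periods_of 0 (1 / 4) (by push_cast; ring) (by norm_num)

theorem half_notMem : (1 / 2 : ℂ) ∉ (periods τ).lattice :=
  notMem_periods_of (1 / 2) 0 (by push_cast; ring) (by norm_num)

variable (τ)

theorem weierstrassP_quarter_ne :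
    (periods τ).weierstrassP (1 / 4) ≠ (periods τ).weierstrassP (1 / 4 + τ / 2) := by
  rw [Ne, weierstrassP_eq_iff quarter_notMem pole_notMem, not_or]
  exact ⟨notMem_periods_of 0 (-1 / 2) (by push_cast; ring) (by norm_num),
    notMem_periods_of (1 / 2) (1 / 2) (by push_cast; ring) (by norm_num)⟩

theorem weierstrassP_tau_quarter_ne :
    (periods τ).weierstrassP (τ / 4) ≠ (periods τ).weierstrassP (1 / 4) := by
  rw [Ne, weierstrassP_eq_iff tau_quarter_notMem quarter_notMem, not_or]
  exact ⟨notMem_periods_of (-1 / 4) (1 / 4) (by push_cast; ring) (by norm_num),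
    notMem_periods_of (1 / 4) (1 / 4) (by push_cast; ring) (by norm_num)⟩

theorem weierstrassP_tau_quarter_ne' :
    (periods τ).weierstrassP (τ / 4) ≠ (periods τ).weierstrassP (1 / 4 + τ / 2) := by
  rw [Ne, weierstrassP_eq_iff tau_quarter_notMem pole_notMem, not_or]
  exact ⟨notMem_periods_of (-1 / 4) (-1 / 4) (by push_cast; ring) (by norm_num),
    notMem_periods_of (1 / 4) (3 / 4) (by push_cast; ring) (by norm_num)⟩

theorem legendreB_ne_zero : legendreB τ ≠ 0 :=
  div_ne_zero (sub_ne_zero.mpr (weierstrassP_tau_quarter_ne τ))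
    (sub_ne_zero.mpr (weierstrassP_tau_quarter_ne' τ))

variable {τ}

theorem isHom_coordP {z : ℂ} (hz : z ∉ (periods τ).lattice) :
    IsHom (coordP τ z) ((periods τ).weierstrassP z - (periods τ).weierstrassP (1 / 4))
      (legendreB τ * ((periods τ).weierstrassP z - (periods τ).weierstrassP (1 / 4 + τ / 2))) := by
  have hb := legendreB_ne_zero τ
  by_cases h : (periods τ).weierstrassP z = (periods τ).weierstrassP (1 / 4 + τ / 2)
  · have : coordP τ z = OnePoint.infty := by
      simp only [coordP, legendreLift, if_neg hz, if_pos h]; rfl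
    rw [this, isHom_infty, h]
    exact ⟨sub_ne_zero.mpr (weierstrassP_quarter_ne τ).symm, by simp⟩
  · have h' := sub_ne_zero.mpr h
    have : coordP τ z = (((periods τ).weierstrassP z - (periods τ).weierstrassP (1 / 4)) /
        ((periods τ).weierstrassP z - (periods τ).weierstrassP (1 / 4 + τ / 2)) /
          legendreB τ : ℂ) := by
      simp only [coordP, legendreLift, if_neg hz, if_neg h]; rfl
    rw [this, isHom_coe]
    refine ⟨mul_ne_zero hb h', ?_⟩
    generalize (periods τ).weierstrassP z - (periods τ).weierstrassP (1 / 4 + τ / 2) = t at h' ⊢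
    field_simp

theorem isHom_coordP_of_mem {z : ℂ} (hz : z ∈ (periods τ).lattice) :
    IsHom (coordP τ z) 1 (legendreB τ) := by
  have hb := legendreB_ne_zero τ
  have : coordP τ z = (1 / legendreB τ : ℂ) := by
    simp only [coordP, legendreLift, if_pos hz]; rfl
  rw [this, isHom_coe]
  exact ⟨hb, by field_simp⟩

theorem coordP_eq_iff {z w : ℂ} : coordP τ z = coordP τ w ↔
    z - w ∈ (periods τ).lattice ∨ z + w ∈ (periods τ).lattice := by
  have hb := legendreB_ne_zero τ
  have he := sub_ne_zero.mpr (weierstrassP_quarter_ne τ)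
  have hmix : ∀ {z w : ℂ}, z ∈ (periods τ).lattice → w ∉ (periods τ).lattice →
      coordP τ z ≠ coordP τ w := fun {z w} hz hw h => by
    rw [(isHom_coordP_of_mem hz).eq_iff (isHom_coordP hw)] at h
    refine mul_ne_zero hb he ?_
    linear_combination h
  by_cases hz : z ∈ (periods τ).lattice
  · by_cases hw : w ∈ (periods τ).lattice
    · exact iff_of_true (((isHom_coordP_of_mem hz).eq_iff (isHom_coordP_of_mem hw)).mpr rfl)
        (Or.inl (sub_mem hz hw))
    · refine iff_of_false (hmix hz hw) ?_
      rintro (h | h)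
      · exact hw (by simpa using sub_mem hz h)
      · exact hw (by simpa using sub_mem h hz)
  · by_cases hw : w ∈ (periods τ).lattice
    · refine iff_of_false (hmix hw hz).symm ?_
      rintro (h | h)
      · exact hz (by simpa using add_mem h hw)
      · exact hz (by simpa using sub_mem h hw)
    · rw [(isHom_coordP hz).eq_iff (isHom_coordP hw), ← weierstrassP_eq_iff hz hw]
      constructor
      · intro h
        have : legendreB τ * ((periods τ).weierstrassP (1 / 4) -
            (periods τ).weierstrassP (1 / 4 + τ / 2)) *
              ((periods τ).weierstrassP z - (periods τ).weierstrassP w) = 0 := by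
          linear_combination h
        exact sub_eq_zero.mp ((mul_eq_zero.mp this).resolve_left (mul_ne_zero hb he))
      · intro h
        rw [h]

theorem coordP_neg (z : ℂ) : coordP τ (-z) = coordP τ z :=
  coordP_eq_iff.mpr (Or.inr (by simp))

theorem coordP_add_half (z : ℂ) : coordP τ (z + 1 / 2) = negP1 (coordP τ z) := by
  have ha : (1 / 2 : ℂ) ∉ (periods τ).lattice := half_notMem
  have h2 : 2 * (1 / 2 : ℂ) ∈ (periods τ).lattice :=
    mem_periods_of 1 0 (by push_cast; ring) (by norm_num)
  obtain ⟨C, -, hC, -⟩ := exists_halfPeriod_product ha h2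
  have h1 := hC (1 / 4) quarter_notMem
    (notMem_periods_of (3 / 4) 0 (by push_cast; ring) (by norm_num))
  rw [weierstrassP_eq_of_add_mem (z := 1 / 4 + 1 / 2) (w := 1 / 4)
    (mem_periods_of 1 0 (by push_cast; ring) (by norm_num))] at h1
  have h1' := hC (1 / 4 + τ / 2) pole_notMem
    (notMem_periods_of (3 / 4) (1 / 2) (by push_cast; ring) (by norm_num))
  rw [weierstrassP_eq_of_add_mem (z := 1 / 4 + τ / 2 + 1 / 2) (w := 1 / 4 + τ / 2)
    (mem_periods_of 1 1 (by push_cast; ring) (by norm_num))] at h1'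
  have he := sub_ne_zero.mpr (weierstrassP_quarter_ne τ)
  set P := (periods τ).weierstrassP
  have hsum : P (1 / 4) + P (1 / 4 + τ / 2) = 2 * P (1 / 2) := by
    apply mul_left_cancel₀ he
    linear_combination h1 - h1'
  by_cases hz : z ∈ (periods τ).lattice
  · have hza : z + 1 / 2 ∉ (periods τ).lattice := notMem_lattice_add ha hz
    rw [(isHom_coordP hza).eq_iff (isHom_coordP_of_mem hz).negP1,
      weierstrassP_eq_of_sub_mem (z := z + 1 / 2) (w := 1 / 2) (by simpa using hz)]
    change (P _ - P _) * _ = -1 * (_ * (P _ - P _))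
    linear_combination -legendreB τ * hsum
  by_cases hza : z + 1 / 2 ∈ (periods τ).lattice
  · rw [(isHom_coordP_of_mem hza).eq_iff (isHom_coordP hz).negP1,
      weierstrassP_eq_of_add_mem (z := z) (w := 1 / 2) hza]
    change 1 * (_ * (P _ - P _)) = -(P _ - P _) * _
    linear_combination -legendreB τ * hsum
  · rw [(isHom_coordP hza).eq_iff (isHom_coordP hz).negP1]
    have h3 := hC z hz hza
    change (P _ - P _) * (_ * (P _ - P _)) = -(P _ - P _) * (_ * (P _ - P _))
    obtain he' : P (1 / 4 + τ / 2) = 2 * P (1 / 2) - P (1 / 4) := by linear_combination hsum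
    rw [he']
    linear_combination 2 * legendreB τ * (h3 - h1)

theorem coordP_quarter : coordP τ (1 / 4) = ((0 : ℂ) : P1) := by
  rw [(isHom_coordP quarter_notMem).eq_iff (isHom_hom _)]
  simp

theorem coordP_pole : coordP τ (1 / 4 + τ / 2) = OnePoint.infty := by
  rw [(isHom_coordP pole_notMem).eq_iff (isHom_hom _)]
  simp

theorem coordP_surjective : Function.Surjective (coordP τ) := by
  have hb := legendreB_ne_zero τ
  intro x
  induction x using OnePoint.rec with
  | infty => exact ⟨_, coordP_pole⟩
  | coe v =>
    by_cases hv : v * legendreB τ = 1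
    · refine ⟨0, ?_⟩
      rw [(isHom_coordP_of_mem (zero_mem _)).eq_iff (isHom_hom _)]
      simp [hv]
    · have hv' := sub_ne_zero.mpr (Ne.symm hv)
      obtain ⟨z, hz, hzv⟩ := exists_weierstrassP_eq (periods τ)
        (((periods τ).weierstrassP (1 / 4) - v * legendreB τ *
          (periods τ).weierstrassP (1 / 4 + τ / 2)) / (1 - v * legendreB τ))
      refine ⟨z, ?_⟩
      rw [(isHom_coordP hz).eq_iff (isHom_hom _), hzv]
      simp
      field_simp
      ring

theorem two_mul_mem_of_sub_or_add {z w : ℂ} (h : z - w ∈ (periods τ).lattice ∨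
    z + w ∈ (periods τ).lattice) (hz : 2 * z ∈ (periods τ).lattice) :
    2 * w ∈ (periods τ).lattice := by
  rcases h with h | h
  · have := sub_mem hz (add_mem h h)
    rwa [show 2 * z - (z - w + (z - w)) = 2 * w by ring] at this
  · have := sub_mem (add_mem h h) hz
    rwa [show z + w + (z + w) - 2 * z = 2 * w by ring] at this

/-- The branch values of the coordinate are neither `0` nor `∞`. -/
theorem hom_coordP_ne_zero {z : ℂ} (hz : 2 * z ∈ (periods τ).lattice) (i : Fin 2) :
    hom (coordP τ z) i ≠ 0 := by
  have h0 : coordP τ z ≠ ((0 : ℂ) : P1) := by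
    rw [← coordP_quarter (τ := τ)]
    intro h
    refine half_notMem (τ := τ) ?_
    have := two_mul_mem_of_sub_or_add (coordP_eq_iff.mp h) hz
    rwa [show 2 * (1 / 4 : ℂ) = 1 / 2 by ring] at this
  have h1 : coordP τ z ≠ OnePoint.infty := by
    rw [← coordP_pole (τ := τ)]
    intro h
    have := two_mul_mem_of_sub_or_add (coordP_eq_iff.mp h) hz
    exact notMem_periods_of (1 / 2) 1 (by push_cast; ring) (by norm_num) this
  obtain ⟨v, hv⟩ := OnePoint.ne_infty_iff_exists.mp h1
  rw [← hv] at h0 ⊢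
  have hv0 : v ≠ 0 := by
    rintro rfl
    exact h0 rfl
  fin_cases i <;> simp [hv0]

end Legendre

theorem exists_analytic_sqrt {V : Type*} [NormedAddCommGroup V] [NormedSpace ℂ V] {A : V → ℂ}
    {p : V} (hA : AnalyticAt ℂ A p) (h0 : A p ≠ 0) :
    ∃ B : V → ℂ, AnalyticAt ℂ B p ∧ B p ≠ 0 ∧ ∀ᶠ w in 𝓝 p, B w ^ 2 = A w := by
  obtain ⟨c, hc⟩ := IsAlgClosed.exists_pow_nat_eq (A p) (n := 2) two_pos
  have hc0 : c ≠ 0 := by rintro rfl; simp at hc; exact h0 hc.symm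
  refine ⟨fun w => c * Complex.exp (Complex.log (A w / A p) / 2), ?_, ?_, ?_⟩
  · have h1 : AnalyticAt ℂ (fun w => A w / A p) p := hA.div analyticAt_const h0
    have h2 : AnalyticAt ℂ (fun w => Complex.log (A w / A p)) p :=
      h1.clog (by simp [div_self h0])
    exact analyticAt_const.mul ((h2.div analyticAt_const two_ne_zero).cexp)
  · exact mul_ne_zero hc0 (Complex.exp_ne_zero _)
  · filter_upwards [hA.continuousAt.eventually_ne h0] with w hw
    rw [mul_pow, ← Complex.exp_nat_mul, hc]
    push_cast
    rw [mul_div_cancel₀ _ (two_ne_zero' ℂ), Complex.exp_log (div_ne_zero hw h0),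
      mul_div_cancel₀ _ h0]

/-- A holomorphic function with a zero of order one or two is the first or second power of a
local coordinate. -/
theorem exists_root_coordinate {ψ : ℂ → ℂ} {z₀ : ℂ} (hψ : MeromorphicAt ψ z₀) (h0 : ψ z₀ = 0)
    {k : ℕ} (hk : k = 1 ∨ k = 2) (hord : meromorphicOrderAt ψ z₀ = ((k : ℤ) : WithTop ℤ)) :
    ∃ u : ℂ → ℂ, AnalyticAt ℂ u z₀ ∧ u z₀ = 0 ∧ deriv u z₀ ≠ 0 ∧
      ∀ᶠ z in 𝓝 z₀, u z ^ k = ψ z := by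
  obtain ⟨g, hg, hg0, hψg⟩ := (meromorphicOrderAt_eq_int_iff hψ).mp hord
  obtain ⟨B, hB, hB0, hBk⟩ : ∃ B : ℂ → ℂ, AnalyticAt ℂ B z₀ ∧ B z₀ ≠ 0 ∧
      ∀ᶠ z in 𝓝 z₀, B z ^ k = g z := by
    rcases hk with rfl | rfl
    · exact ⟨g, hg, hg0, by simp⟩
    · exact exists_analytic_sqrt hg hg0
  refine ⟨fun z => (z - z₀) * B z, by fun_prop, by simp, ?_, ?_⟩
  · have h1 : HasDerivAt (fun z => (z - z₀) * B z) (1 * B z₀ + (z₀ - z₀) * deriv B z₀) z₀ :=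
      ((hasDerivAt_id z₀).sub_const z₀).mul hB.differentiableAt.hasDerivAt
    rw [h1.deriv]
    simpa using hB0
  · rw [eventually_nhdsWithin_iff] at hψg
    filter_upwards [hψg, hBk] with z hz hBz
    by_cases hzz : z = z₀
    · subst hzz
      rcases hk with rfl | rfl <;> simp [h0]
    · rw [hz hzz, mul_pow, hBz]
      simp

/-- The affine line through the homogeneous coordinates of `p`, in the standard chart at `p`. -/
noncomputable def lineAt : P1 → ℂ → Fin 2 → ℂ
  | none, X => ![1, X]
  | some v, X => ![v + X, 1]

@[simp] theorem lineAt_infty (X : ℂ) : lineAt OnePoint.infty X = ![1, X] := rfl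

@[simp] theorem lineAt_coe (v X : ℂ) : lineAt (v : P1) X = ![v + X, 1] := rfl

theorem lineAt_zero (p : P1) : lineAt p 0 = hom p := by
  induction p using OnePoint.rec <;> simp

open Classical in
/-- The ramification index of the coordinate at `z`. -/
noncomputable def ramIndex (τ : UpperHalfPlane) (z : ℂ) : ℕ :=
  if 2 * z ∈ (periods τ).lattice then 2 else 1

theorem ramIndex_eq (τ : UpperHalfPlane) (z : ℂ) : ramIndex τ z = 1 ∨ ramIndex τ z = 2 := by
  unfold ramIndex; split_ifs <;> simp

variable {τ : UpperHalfPlane}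

theorem order_weierstrassP_sub {z₀ : ℂ} (hz : z₀ ∉ (periods τ).lattice) :
    meromorphicOrderAt (fun z => (periods τ).weierstrassP z - (periods τ).weierstrassP z₀) z₀ =
      ((ramIndex τ z₀ : ℤ) : WithTop ℤ) := by
  unfold ramIndex
  split_ifs with h
  · obtain ⟨-, -, -, h2⟩ := exists_halfPeriod_product hz h
    exact h2
  · exact order_sub_eq_one hz rfl (derivWeierstrassP_ne_zero h)

theorem analyticAt_inv_weierstrassP {L : PeriodPair} {l : ℂ} (hl : l ∈ L.lattice) :
    AnalyticAt ℂ L.weierstrassP⁻¹ l ∧ meromorphicOrderAt L.weierstrassP⁻¹ l = 2 ∧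
      L.weierstrassP⁻¹ l = 0 := by
  have h1 : L.weierstrassP⁻¹ l = 0 := by simpa using L.weierstrassP_coe ⟨l, hl⟩
  have h2 : meromorphicOrderAt L.weierstrassP⁻¹ l = 2 := by
    rw [meromorphicOrderAt_inv, L.order_weierstrassP l hl]; rfl
  exact ⟨AnalyticAt.of_meromorphicOrderAt_pos (by rw [h2]; decide) h1, h2, h1⟩

theorem exists_coordinate_of_unit {z₀ : ℂ} {ψ g : ℂ → ℂ} (hψ : AnalyticAt ℂ ψ z₀)
    (h0 : ψ z₀ = 0) (hord : meromorphicOrderAt ψ z₀ = ((ramIndex τ z₀ : ℤ) : WithTop ℤ))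
    (hg : AnalyticAt ℂ g z₀) (hg0 : g z₀ ≠ 0)
    (h : ∀ᶠ z in 𝓝 z₀, IsHom (coordP τ z) (lineAt (coordP τ z₀) (ψ z * g z) 0)
      (lineAt (coordP τ z₀) (ψ z * g z) 1)) :
    ∃ u : ℂ → ℂ, AnalyticAt ℂ u z₀ ∧ u z₀ = 0 ∧ deriv u z₀ ≠ 0 ∧
      ∀ᶠ z in 𝓝 z₀, IsHom (coordP τ z) (lineAt (coordP τ z₀) (u z ^ ramIndex τ z₀) 0)
        (lineAt (coordP τ z₀) (u z ^ ramIndex τ z₀) 1) := by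
  have ho : meromorphicOrderAt (fun z => ψ z * g z) z₀ = ((ramIndex τ z₀ : ℤ) : WithTop ℤ) := by
    rw [← hord]
    have h1 : meromorphicOrderAt (fun z => ψ z * g z) z₀ = _ :=
      meromorphicOrderAt_mul hψ.meromorphicAt hg.meromorphicAt
    have h2 : meromorphicOrderAt g z₀ = 0 := by
      rw [hg.meromorphicOrderAt_eq, hg.analyticOrderAt_eq_zero.mpr hg0]; rfl
    rw [h1, h2, add_zero]
  obtain ⟨u, hu, hu0, hu', huk⟩ := exists_root_coordinate (hψ.mul hg).meromorphicAt
    (by simp [h0]) (ramIndex_eq τ z₀) ho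
  refine ⟨u, hu, hu0, hu', ?_⟩
  filter_upwards [h, huk] with z hz hzu
  rw [hzu]
  exact hz

/-- Near `z₀` the coordinate is, in a standard chart, the first or second power of a local
coordinate of `ℂ` at `z₀`. -/
theorem exists_local_coordinate (τ : UpperHalfPlane) (z₀ : ℂ) :
    ∃ u : ℂ → ℂ, AnalyticAt ℂ u z₀ ∧ u z₀ = 0 ∧ deriv u z₀ ≠ 0 ∧
      ∀ᶠ z in 𝓝 z₀, IsHom (coordP τ z) (lineAt (coordP τ z₀) (u z ^ ramIndex τ z₀) 0)
        (lineAt (coordP τ z₀) (u z ^ ramIndex τ z₀) 1) := by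
  have hb := legendreB_ne_zero τ
  have he := sub_ne_zero.mpr (weierstrassP_quarter_ne τ)
  by_cases hz : z₀ ∈ (periods τ).lattice
  · obtain ⟨hQ, hQo, hQ0⟩ := analyticAt_inv_weierstrassP hz
    set P := (periods τ).weierstrassP
    set e := P (1 / 4)
    set e' := P (1 / 4 + τ / 2)
    set b := legendreB τ
    have hden : AnalyticAt ℂ (fun z => b * (1 - e' * P⁻¹ z)) z₀ :=
      analyticAt_const.mul (analyticAt_const.sub (analyticAt_const.mul hQ))
    have hden0 : b * (1 - e' * P⁻¹ z₀) ≠ 0 := by rw [hQ0]; simpa using hb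
    have hr : ramIndex τ z₀ = 2 := if_pos (by rw [two_mul]; exact add_mem hz hz)
    refine exists_coordinate_of_unit (ψ := P⁻¹) (g := fun z => (e' - e) / (b * (1 - e' * P⁻¹ z)))
      hQ hQ0 (by rw [hQo, hr]; rfl) (analyticAt_const.div hden hden0)
      (div_ne_zero (by rw [← neg_sub]; exact neg_ne_zero.mpr he) hden0) ?_
    have hz0 : coordP τ z₀ = ((1 / b : ℂ) : P1) := by
      rw [(isHom_coordP_of_mem hz).eq_iff (isHom_hom _)]
      simp only [hom_coe, Matrix.cons_val_one, Matrix.cons_val_zero]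
      exact (one_div_mul_cancel hb).symm ▸ (one_mul 1)
    have hne : ∀ᶠ z in 𝓝[≠] z₀, P z ≠ 0 := by
      have := tendsto_cobounded_of_meromorphicOrderAt_neg (f := P) (x := z₀)
        (by rw [(periods τ).order_weierstrassP z₀ hz]; decide)
      exact this.eventually (show ∀ᶠ y in Bornology.cobounded ℂ, y ≠ 0 from
        Bornology.isBounded_singleton (x := (0 : ℂ)))
    have hnl := mem_nhdsWithin_of_mem_nhds (t := {z₀}ᶜ)
      ((periods τ).compl_lattice_sdiff_singleton_mem_nhds z₀)
    have hev : ∀ᶠ z in 𝓝[≠] z₀, P z ≠ 0 ∧ z ∉ (periods τ).lattice := by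
      filter_upwards [hne, hnl, self_mem_nhdsWithin] with z h1 h2 h3
      exact ⟨h1, fun h => h2 ⟨h, h3⟩⟩
    rw [eventually_nhdsWithin_iff] at hev
    filter_upwards [hev, hden.continuousAt.eventually_ne hden0] with z h1 h2
    rw [hz0]
    by_cases hzz : z = z₀
    · subst hzz
      rw [hQ0, zero_mul, hz0, lineAt_zero]
      exact isHom_hom _
    · obtain ⟨hp, hzl⟩ := h1 hzz
      have h3 := isHom_coordP hzl
      have h4 : coordP τ z = ((1 / b + P⁻¹ z * ((e' - e) / (b * (1 - e' * P⁻¹ z))) : ℂ) : P1) := by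
        rw [h3.eq_iff (isHom_hom _)]
        simp only [hom_coe, Matrix.cons_val_one, Matrix.cons_val_zero, Pi.inv_apply] at h2 ⊢
        change (P z - e) * 1 = _ * (b * (P z - e'))
        have h5 : 1 - e' * (P z)⁻¹ ≠ 0 := right_ne_zero_of_mul h2
        have h6 : P z - e' ≠ 0 := fun h => h5 (by
          have : e' = P z := by linear_combination -h
          rw [this, mul_inv_cancel₀ hp, sub_self])
        generalize P z = p at *
        have h7 : p⁻¹ * ((e' - e) / (b * (1 - e' * p⁻¹))) = (e' - e) / (b * (p - e')) := by
          rw [show b * (p - e') = p * (b * (1 - e' * p⁻¹)) by field_simp]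
          field_simp
        rw [h7]
        field_simp
        ring
      rw [h4]
      exact isHom_hom (_ : P1)
  · have hψ := analyticAt_weierstrassP_sub hz ((periods τ).weierstrassP z₀)
    have ho := order_weierstrassP_sub hz
    have hA := analyticAt_weierstrassP hz
    have hz0 := isHom_coordP hz
    have hnl := (periods τ).isClosed_lattice.isOpen_compl.mem_nhds hz
    have hC : ∀ z, z ∉ (periods τ).lattice → _ := fun z hz => isHom_coordP (τ := τ) hz
    set P := (periods τ).weierstrassP
    set e := P (1 / 4)
    set e' := P (1 / 4 + τ / 2)
    set b := legendreB τ
    by_cases ht : P z₀ = e'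
    · have hzi : coordP τ z₀ = OnePoint.infty := by
        rw [hz0.eq_iff (isHom_hom _)]
        simp [ht]
      have hs0 : P z₀ - e ≠ 0 := by rw [ht, ← neg_sub]; exact neg_ne_zero.mpr he
      have hs : AnalyticAt ℂ (fun z => P z - e) z₀ := hA.sub analyticAt_const
      refine exists_coordinate_of_unit hψ (sub_self _) ho (g := fun z => b / (P z - e))
        (analyticAt_const.div hs hs0) (div_ne_zero hb hs0) ?_
      filter_upwards [hnl, hs.continuousAt.eventually_ne hs0] with z hzl hzs
      rw [hzi, ht]
      refine ⟨by simp, ?_⟩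
      obtain ⟨c, hc, h1, h2⟩ := (hC z hzl).exists_smul
      simp only [lineAt_infty, Matrix.cons_val_one, Matrix.cons_val_zero]
      have h1' : hom (coordP τ z) 0 = (P z - e) / c := by rw [h1]; field_simp
      have h2' : hom (coordP τ z) 1 = b * (P z - e') / c := by rw [h2]; field_simp
      rw [h1', h2']
      field_simp
    · have ht0 : b * (P z₀ - e') ≠ 0 := mul_ne_zero hb (sub_ne_zero.mpr ht)
      have htA : AnalyticAt ℂ (fun z => b * (P z - e')) z₀ :=
        analyticAt_const.mul (hA.sub analyticAt_const)
      have hzv : coordP τ z₀ = (((P z₀ - e) / (b * (P z₀ - e')) : ℂ) : P1) := by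
        rw [hz0.eq_iff (isHom_hom _)]
        simp only [hom_coe, Matrix.cons_val_one, Matrix.cons_val_zero]
        rw [div_mul_cancel₀ _ ht0, mul_one]
      refine exists_coordinate_of_unit hψ (sub_self _) ho
        (g := fun z => b * (e - e') / (b * (P z - e') * (b * (P z₀ - e'))))
        (analyticAt_const.div (htA.mul analyticAt_const) (mul_ne_zero ht0 ht0))
        (div_ne_zero (mul_ne_zero hb he) (mul_ne_zero ht0 ht0)) ?_
      filter_upwards [hnl, htA.continuousAt.eventually_ne ht0] with z hzl hzt
      have h4 : coordP τ z = (((P z₀ - e) / (b * (P z₀ - e')) + (P z - P z₀) *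
          (b * (e - e') / (b * (P z - e') * (b * (P z₀ - e')))) : ℂ) : P1) := by
        rw [(hC z hzl).eq_iff (isHom_hom _)]
        simp only [hom_coe, Matrix.cons_val_one, Matrix.cons_val_zero]
        have h5 := right_ne_zero_of_mul hzt
        have h6 := right_ne_zero_of_mul ht0
        change (P z - e) * 1 = _ * (b * (P z - e'))
        generalize P z = p at *
        generalize P z₀ = p₀ at *
        field_simp
        ring
      rw [hzv, h4]
      exact isHom_hom (_ : P1)

section Germs

variable {A B C : Type*} [TopologicalSpace A] [TopologicalSpace B] [TopologicalSpace C]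

/-- Membership in `O` at a point depends only on the germ of the function. -/
def IsLocalPred (O : (A → ℂ) → A → Prop) : Prop :=
  ∀ ⦃f g : A → ℂ⦄ ⦃p : A⦄, f =ᶠ[𝓝 p] g → O f p → O g p

theorem IsLocalPred.iff {O : (A → ℂ) → A → Prop} (hO : IsLocalPred O) {f g : A → ℂ} {p : A}
    (h : f =ᶠ[𝓝 p] g) : O f p ↔ O g p :=
  ⟨hO h, hO h.symm⟩

theorem GermIso.symm {O : (A → ℂ) → A → Prop} {p : A} {O' : (B → ℂ) → B → Prop} {p' : B}
    (hO : IsLocalPred O) (h : GermIso O p O' p') : GermIso O' p' O p := by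
  obtain ⟨e, hp, hpe, he⟩ := h
  refine ⟨e.symm, by rw [← hpe]; exact e.map_source hp, by rw [← hpe]; exact e.left_inv hp, ?_⟩
  intro y hy f
  have hx : e.symm y ∈ e.source := e.map_target hy
  have h1 := he _ hx (fun b => f (e.symm b))
  rw [e.right_inv hy] at h1
  rw [h1]
  refine hO.iff ?_
  filter_upwards [e.open_source.mem_nhds hx] with a ha
  rw [e.left_inv ha]

theorem GermIso.trans {O : (A → ℂ) → A → Prop} {p : A} {O' : (B → ℂ) → B → Prop} {p' : B}
    {O'' : (C → ℂ) → C → Prop} {p'' : C} (h : GermIso O p O' p') (h' : GermIso O' p' O'' p'') :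
    GermIso O p O'' p'' := by
  obtain ⟨e, hp, hpe, he⟩ := h
  obtain ⟨e', hp', hpe', he'⟩ := h'
  refine ⟨e.trans e', ?_, ?_, ?_⟩
  · rw [OpenPartialHomeomorph.trans_source]
    exact ⟨hp, by rw [Set.mem_preimage, hpe]; exact hp'⟩
  · rw [OpenPartialHomeomorph.coe_trans, Function.comp_apply, hpe, hpe']
  · intro x hx f
    rw [OpenPartialHomeomorph.trans_source] at hx
    exact (he' _ hx.2 f).trans (he _ hx.1 _)

theorem eventually_nhds_subtype {V : Set A} {p : V} {Q : V → Prop} :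
    (∀ᶠ v in 𝓝 p, Q v) ↔ ∀ᶠ w in 𝓝 p.1, ∀ h : w ∈ V, Q ⟨w, h⟩ := by
  rw [nhds_subtype_eq_comap, eventually_comap]
  constructor
  · intro h
    filter_upwards [h] with w hw hV
    exact hw ⟨w, hV⟩ rfl
  · intro h
    filter_upwards [h] with w hw v hv
    subst hv
    exact hw v.2

theorem isLocalPred_holSub {n : ℕ} (V : Set (Fin n → ℂ)) : IsLocalPred (HolSub V) := by
  rintro f g p hfg ⟨F, hF, hf⟩
  refine ⟨F, hF, ?_⟩
  filter_upwards [hf, eventually_nhds_subtype.mp hfg] with w h1 h2 h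
  rw [← h2 h, h1 h]

/-- Restriction of a local homeomorphism to subsets that correspond to each other. -/
theorem exists_subtype_homeomorph (φ : OpenPartialHomeomorph A B) (V : Set A) (X : Set B)
    (h : ∀ a ∈ φ.source, a ∈ V ↔ φ a ∈ X) {a₀ : A} (ha : a₀ ∈ φ.source) (haV : a₀ ∈ V) :
    ∃ e : OpenPartialHomeomorph V X, (∀ v, v ∈ e.source ↔ v.1 ∈ φ.source) ∧
      ∀ v ∈ e.source, (e v).1 = φ v.1 := by
  classical
  have h' : ∀ b ∈ φ.target, b ∈ X → φ.symm b ∈ V := fun b hb hbX => by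
    rw [h _ (φ.map_target hb), φ.right_inv hb]
    exact hbX
  have hb₀ : φ a₀ ∈ X := (h _ ha).mp haV
  set F : V → X := fun v => if hv : v.1 ∈ φ.source then ⟨φ v.1, (h _ hv).mp v.2⟩ else ⟨_, hb₀⟩
  set I : X → V := fun b => if hb : b.1 ∈ φ.target then ⟨φ.symm b.1, h' _ hb b.2⟩ else ⟨_, haV⟩
  have hF : ∀ v : V, v.1 ∈ φ.source → (F v).1 = φ v.1 := fun v hv => by simp only [F, dif_pos hv]
  have hI : ∀ b : X, b.1 ∈ φ.target → (I b).1 = φ.symm b.1 := fun b hb => by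
    simp only [I, dif_pos hb]
  refine ⟨{ toFun := F, invFun := I, source := {v | v.1 ∈ φ.source}, target := {b | b.1 ∈ φ.target},
            map_source' := fun v hv => ?_, map_target' := fun b hb => ?_,
            left_inv' := fun v hv => ?_, right_inv' := fun b hb => ?_,
            continuousOn_toFun := ?_, continuousOn_invFun := ?_,
            open_source := φ.open_source.preimage continuous_subtype_val,
            open_target := φ.open_target.preimage continuous_subtype_val },
          fun v => Iff.rfl, fun v hv => hF v hv⟩
  · change (F v).1 ∈ φ.target
    rw [hF v hv]; exact φ.map_source hv
  · change (I b).1 ∈ φ.source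
    rw [hI b hb]; exact φ.map_target hb
  · refine Subtype.ext ?_
    rw [hI _ (by rw [hF v hv]; exact φ.map_source hv), hF v hv, φ.left_inv hv]
  · refine Subtype.ext ?_
    rw [hF _ (by rw [hI b hb]; exact φ.map_target hb), hI b hb, φ.right_inv hb]
  · rw [continuousOn_iff_continuous_domRestrict, continuous_induced_rng]
    refine (continuousOn_iff_continuous_domRestrict.mp
      (φ.continuousOn.comp continuous_subtype_val.continuousOn
        (s := {v : V | v.1 ∈ φ.source}) fun v hv => hv)).congr fun v => ?_
    exact (hF v.1 v.2).symm
  · rw [continuousOn_iff_continuous_domRestrict, continuous_induced_rng]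
    refine (continuousOn_iff_continuous_domRestrict.mp
      (φ.continuousOn_symm.comp continuous_subtype_val.continuousOn
        (s := {b : X | b.1 ∈ φ.target}) fun v hv => hv)).congr fun b => ?_
    exact (hI b.1 b.2).symm

end Germs

section Analytic

/-- A local biholomorphic map identifies the germs of corresponding subsets. -/
theorem germIso_of_fderiv {n : ℕ} {V W : Set (Fin n → ℂ)} {z₀ : Fin n → ℂ}
    {Ψ : (Fin n → ℂ) → (Fin n → ℂ)} (hΨ : AnalyticAt ℂ Ψ z₀)
    (i : (Fin n → ℂ) ≃L[ℂ] (Fin n → ℂ)) (hi : HasFDerivAt Ψ (i : (Fin n → ℂ) →L[ℂ] _) z₀)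
    (hV : ∀ᶠ w in 𝓝 z₀, w ∈ V ↔ Ψ w ∈ W) (hz : z₀ ∈ V) (hw : Ψ z₀ ∈ W) :
    GermIso (HolSub V) ⟨z₀, hz⟩ (HolSub W) ⟨Ψ z₀, hw⟩ := by
  have hs : HasStrictFDerivAt Ψ (i : (Fin n → ℂ) →L[ℂ] _) z₀ := by
    have := hΨ.hasStrictFDerivAt
    rwa [hi.fderiv] at this
  set φ₀ := hs.toOpenPartialHomeomorph Ψ with hφ₀
  have hcoe : (φ₀ : (Fin n → ℂ) → (Fin n → ℂ)) = Ψ := rfl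
  have hz₀ : z₀ ∈ φ₀.source := hs.mem_toOpenPartialHomeomorph_source
  obtain ⟨p, hp⟩ := hΨ
  have hsymm : AnalyticAt ℂ φ₀.symm (φ₀ z₀) := by
    refine (φ₀.hasFPowerSeriesAt_symm (i := i) hz₀ hp ?_).analyticAt
    have h1 := hp.hasFDerivAt.unique hi
    rw [← h1]
    simp
  have hev : ∀ᶠ w in 𝓝 z₀, (w ∈ V ↔ Ψ w ∈ W) ∧ AnalyticAt ℂ Ψ w ∧ AnalyticAt ℂ φ₀.symm (Ψ w) := by
    have h1 : AnalyticAt ℂ Ψ z₀ := ⟨p, hp⟩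
    exact hV.and (h1.eventually_analyticAt.and
      (h1.continuousAt.eventually hsymm.eventually_analyticAt))
  obtain ⟨U, hU, hUo, hzU⟩ := eventually_nhds_iff.mp hev
  set φ := φ₀.restrOpen U hUo
  have hφs : ∀ w, w ∈ φ.source ↔ w ∈ φ₀.source ∧ w ∈ U := fun w => Iff.rfl
  obtain ⟨e, hes, hev⟩ := exists_subtype_homeomorph φ V W (fun a ha => (hU a ha.2).1)
    ((hφs _).mpr ⟨hz₀, hzU⟩) hz
  refine ⟨e, (hes _).mpr ((hφs _).mpr ⟨hz₀, hzU⟩),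
    Subtype.ext (hev _ ((hes _).mpr ((hφs _).mpr ⟨hz₀, hzU⟩))), ?_⟩
  intro x hx f
  have hxs := (hes x).mp hx
  have hxU := ((hφs _).mp hxs).2
  have hxe : (e x).1 = Ψ x.1 := hev x hx
  constructor
  · rintro ⟨F, hF, hf⟩
    rw [hxe] at hF hf
    refine ⟨fun w => F (Ψ w), AnalyticAt.fun_comp hF (hU _ hxU).2.1, ?_⟩
    filter_upwards [(hU _ hxU).2.1.continuousAt.eventually hf, φ.open_source.mem_nhds hxs]
      with w h1 h2 h
    have h3 : (e ⟨w, h⟩).1 = Ψ w := hev ⟨w, h⟩ ((hes _).mpr h2)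
    have h4 := h1 (h3 ▸ (e ⟨w, h⟩).2)
    rw [← h4]
    exact congrArg f (Subtype.ext h3)
  · rintro ⟨F, hF, hf⟩
    have hback : φ₀.symm (Ψ x.1) = x.1 := φ₀.left_inv ((hφs _).mp hxs).1
    have hc := (hU _ hxU).2.2
    refine ⟨fun y => F (φ₀.symm y), ?_, ?_⟩
    · rw [hxe]
      exact AnalyticAt.fun_comp (by rwa [hback]) hc
    · rw [hxe]
      have ht : Tendsto φ₀.symm (𝓝 (Ψ x.1)) (𝓝 x.1) := by
        have := hc.continuousAt.tendsto
        rwa [hback] at this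
      filter_upwards [ht.eventually hf, ht.eventually (φ.open_source.mem_nhds hxs),
        φ₀.open_target.mem_nhds (φ₀.map_source ((hφs _).mp hxs).1)] with y h1 h2 h3 h
      have h5 : Ψ (φ₀.symm y) = y := φ₀.right_inv h3
      have h6 : φ₀.symm y ∈ V := by
        rw [(hU _ ((hφs _).mp h2).2).1, h5]; exact h
      rw [← h1 h6]
      refine congrArg f (Subtype.ext ?_)
      rw [hev ⟨_, h6⟩ ((hes _).mpr h2)]
      exact h5.symm

theorem isSmoothPoint_hyperplane (j : Fin 3) :
    IsSmoothPoint (HolSub {w : Fin 3 → ℂ | w j = 0}) ⟨0, rfl⟩ := by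
  have hc : Continuous fun u : Fin 2 → ℂ => (j.insertNth (0 : ℂ) u : Fin 3 → ℂ) := by
    refine continuous_pi fun k => ?_
    induction k using Fin.succAboveCases j with
    | x => simpa using continuous_const
    | p i => simpa using continuous_apply i
  let e : {w : Fin 3 → ℂ | w j = 0} ≃ₜ (Fin 2 → ℂ) :=
    { toFun := fun w i => w.1 (j.succAbove i)
      invFun := fun u => ⟨j.insertNth (0 : ℂ) u, by simp⟩
      left_inv := fun w => by
        refine Subtype.ext (funext fun k => ?_)
        induction k using Fin.succAboveCases j with
        | x => simpa using w.2.symm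
        | p i => simp
      right_inv := fun u => by ext i; simp
      continuous_toFun := continuous_pi fun i => (continuous_apply _).comp continuous_subtype_val
      continuous_invFun := continuous_induced_rng.mpr hc }
  have hins : ∀ u, AnalyticAt ℂ (fun u : Fin 2 → ℂ => (j.insertNth (0 : ℂ) u : Fin 3 → ℂ)) u := by
    intro u
    rw [analyticAt_pi_iff]
    intro k
    induction k using Fin.succAboveCases j with
    | x => simpa using analyticAt_const
    | p i =>
      simp only [Fin.insertNth_apply_succAbove]
      exact (ContinuousLinearMap.proj (R := ℂ) (φ := fun _ : Fin 2 => ℂ) i).analyticAt u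
  refine ⟨e.toOpenPartialHomeomorph, trivial, rfl, ?_⟩
  intro x _ f
  constructor
  · intro hf
    refine ⟨fun w => f fun i => w (j.succAbove i), ?_, ?_⟩
    · refine AnalyticAt.fun_comp (f := fun (w : Fin 3 → ℂ) (i : Fin 2) => w (j.succAbove i)) hf ?_
      rw [analyticAt_pi_iff]
      exact fun i => (ContinuousLinearMap.proj (R := ℂ) (φ := fun _ : Fin 3 => ℂ) _).analyticAt _
    · exact Eventually.of_forall fun w h => rfl
  · rintro ⟨F, hF, hf⟩
    have h1 : (j.insertNth (0 : ℂ) (e x) : Fin 3 → ℂ) = x.1 :=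
      congrArg Subtype.val (e.left_inv x)
    have h2 : AnalyticAt ℂ (fun u : Fin 2 → ℂ => F (j.insertNth (0 : ℂ) u)) (e x) :=
      AnalyticAt.fun_comp (by rw [h1]; exact hF) (hins _)
    refine h2.congr ?_
    have h3 := hc.tendsto (e x)
    simp only [h1] at h3
    filter_upwards [h3.eventually hf] with u hu
    rw [← hu (by simp)]
    exact congrArg f (e.right_inv u)

end Analytic

section Torus

theorem toE_eq_iff {τ : UpperHalfPlane} {z w : ℂ} :
    toE τ z = toE τ w ↔ z - w ∈ (periods τ).lattice := Submodule.Quotient.eq _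

theorem continuous_toE (τ : UpperHalfPlane) : Continuous (toE τ) := continuous_quotient_mk'

theorem isOpenMap_toE (τ : UpperHalfPlane) : IsOpenMap (toE τ) :=
  Submodule.isOpenMap_mkQ (periods τ).lattice

theorem toE_surjective (τ : UpperHalfPlane) : Function.Surjective (toE τ) :=
  Submodule.Quotient.mk_surjective _

instance (τ : UpperHalfPlane) : T2Space (E τ) := by
  have : IsClosed ((periods τ).lattice : Set ℂ) := (periods τ).isClosed_lattice
  infer_instance

variable (τ : Fin 3 → UpperHalfPlane)

theorem continuous_toT : Continuous (toT τ) :=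
  continuous_pi fun j => (continuous_toE (τ j)).comp (continuous_apply j)

theorem isOpenMap_toT : IsOpenMap (toT τ) :=
  IsOpenMap.piMap (f := fun j => toE (τ j)) (fun j => isOpenMap_toE (τ j))
    (Eventually.of_forall fun j => toE_surjective (τ j))

theorem toT_surjective : Function.Surjective (toT τ) := fun x => by
  choose z hz using fun j => toE_surjective (τ j) (x j)
  exact ⟨z, funext hz⟩

theorem exists_injOn_toT (z : Fin 3 → ℂ) : ∃ r > 0, Set.InjOn (toT τ) (Metric.ball z r) := by
  have h : ∀ j, ∃ r > 0, ∀ l ∈ (periods (τ j)).lattice, ‖l‖ < r → l = 0 := by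
    intro j
    obtain ⟨r, hr, h⟩ := Metric.mem_nhds_iff.mp
      ((periods (τ j)).compl_lattice_sdiff_singleton_mem_nhds 0)
    refine ⟨r, hr, fun l hl hlr => ?_⟩
    by_contra h0
    exact h (by simpa using hlr : l ∈ Metric.ball 0 r) ⟨hl, h0⟩
  choose r hr h using h
  have hmin : 0 < min (r 0) (min (r 1) (r 2)) := lt_min (hr 0) (lt_min (hr 1) (hr 2))
  refine ⟨min (r 0) (min (r 1) (r 2)) / 2, by positivity, fun w hw w' hw' heq => funext fun j => ?_⟩
  have h1 : w j - w' j ∈ (periods (τ j)).lattice := toE_eq_iff.mp (congrFun heq j)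
  have h2 : dist (w j) (w' j) < min (r 0) (min (r 1) (r 2)) := by
    have h3 := dist_triangle_right w w' z
    rw [Metric.mem_ball] at hw hw'
    exact lt_of_le_of_lt (dist_le_pi_dist w w' j) (by linarith)
  have h4 : min (r 0) (min (r 1) (r 2)) ≤ r j := by fin_cases j <;> simp
  rw [dist_eq_norm] at h2
  exact sub_eq_zero.mp (h j _ h1 (h2.trans_le h4))

variable (X : Set (T τ))

theorem isLocalPred_holT : IsLocalPred (HolT τ X) := by
  intro f g p hfg hf z hz
  obtain ⟨F, hF, hFe⟩ := hf z hz
  refine ⟨F, hF, ?_⟩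
  have h1 := (continuous_toT τ).tendsto z
  rw [hz] at h1
  filter_upwards [hFe, h1.eventually (eventually_nhds_subtype.mp hfg)] with w h2 h3 h
  rw [← h3 h, h2 h]

/-- The germ of `X` in `T` is that of its preimage in `ℂ³`. -/
theorem germIso_toT {z : Fin 3 → ℂ} (hz : toT τ z ∈ X) :
    GermIso (HolSub {w | toT τ w ∈ X}) ⟨z, hz⟩ (HolT τ X) ⟨toT τ z, hz⟩ := by
  obtain ⟨r, hr, hinj⟩ := exists_injOn_toT τ z
  let φ : OpenPartialHomeomorph (Fin 3 → ℂ) (T τ) :=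
    OpenPartialHomeomorph.ofContinuousOpen (hinj.toPartialEquiv (toT τ) (Metric.ball z r))
      (continuous_toT τ).continuousOn (isOpenMap_toT τ) Metric.isOpen_ball
  have hφ : ∀ w, φ w = toT τ w := fun w => rfl
  have hzs : z ∈ φ.source := Metric.mem_ball_self hr
  obtain ⟨e, hes, hev⟩ := exists_subtype_homeomorph φ {w | toT τ w ∈ X} X
    (fun a _ => Iff.rfl) hzs hz
  refine ⟨e, (hes _).mpr hzs, Subtype.ext (hev _ ((hes _).mpr hzs)), ?_⟩
  intro v hv f
  have hvs := (hes v).mp hv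
  have hve : (e v).1 = toT τ v.1 := hev v hv
  have hval : ∀ w (h : toT τ w ∈ X), w ∈ φ.source → e ⟨w, h⟩ = ⟨toT τ w, h⟩ := fun w h hw =>
    Subtype.ext (hev ⟨w, h⟩ ((hes _).mpr hw))
  constructor
  · intro hf
    obtain ⟨F, hF, hFe⟩ := hf v.1 hve.symm
    refine ⟨F, hF, ?_⟩
    filter_upwards [hFe, φ.open_source.mem_nhds hvs] with w h1 h2 h
    rw [← h1 h, hval w h h2]
  · rintro ⟨F, hF, hFe⟩ z' hz'
    rw [hve] at hz'
    have hper : ∀ w, toT τ (w - z' + v.1) = toT τ w := fun w => funext fun j => by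
      refine toE_eq_iff.mpr ?_
      have h1 := toE_eq_iff.mp (congrFun hz'.symm j)
      rwa [show (w - z' + v.1) j - w j = v.1 j - z' j by
        simp only [Pi.add_apply, Pi.sub_apply]; ring]
    have hA : AnalyticAt ℂ (fun w : Fin 3 → ℂ => w - z' + v.1) z' := by fun_prop
    refine ⟨fun w => F (w - z' + v.1), AnalyticAt.fun_comp (by simpa using hF) hA, ?_⟩
    have ht : Tendsto (fun w : Fin 3 → ℂ => w - z' + v.1) (𝓝 z') (𝓝 v.1) := by
      have := hA.continuousAt.tendsto
      simpa using this
    filter_upwards [ht.eventually hFe, ht.eventually (φ.open_source.mem_nhds hvs)] with w h1 h2 h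
    have h3 : toT τ (w - z' + v.1) ∈ X := by rw [hper]; exact h
    rw [← h1 h3, hval _ h3 h2]
    exact congrArg f (Subtype.ext (hper w).symm)

end Torus

section Action

variable (τ : Fin 3 → UpperHalfPlane)

theorem sgn_toE (τ : UpperHalfPlane) (s : ZMod 2) (z : ℂ) : sgn s (toE τ z) = toE τ (sgn s z) := by
  rcases zmod2_cases s with rfl | rfl <;> simp [sgn, toE]

theorem shift_toE (τ : UpperHalfPlane) (s : ZMod 2) (c : ℂ) :
    shift s (toE τ c) = toE τ (shift s c) := by
  rcases zmod2_cases s with rfl | rfl <;> simp [shift, toE]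

/-- The action of `𝒢` lifted to `ℂ³`. -/
noncomputable def actLift (g : GG) (z : Fin 3 → ℂ) : Fin 3 → ℂ := fun j =>
  sgn (g j 0 + g j 1 + g j 2) (z j) + shift (g j 1) ((τ j : ℂ) / 2) + shift (g j 2) (1 / 2)

theorem act_toT (g : GG) (z : Fin 3 → ℂ) : act τ g (toT τ z) = toT τ (actLift τ g z) := by
  funext j
  simp only [act, actE, toT, actLift, sgn_toE, shift_toE]
  rfl

theorem analyticAt_actLift (g : GG) (z : Fin 3 → ℂ) : AnalyticAt ℂ (actLift τ g) z := by
  rw [analyticAt_pi_iff]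
  intro j
  have h : AnalyticAt ℂ (fun w : Fin 3 → ℂ => w j) z :=
    (ContinuousLinearMap.proj (R := ℂ) (φ := fun _ : Fin 3 => ℂ) j).analyticAt _
  have h1 : AnalyticAt ℂ (fun w : Fin 3 → ℂ => sgn (g j 0 + g j 1 + g j 2) (w j)) z := by
    rcases zmod2_cases (g j 0 + g j 1 + g j 2) with h0 | h0 <;> rw [h0]
    · simpa [sgn] using h
    · simp only [sgn, one_ne_zero, if_false]
      exact h.neg
  exact (h1.add analyticAt_const).add analyticAt_const

theorem continuous_act (g : GG) : Continuous (act τ g) := by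
  refine continuous_pi fun j => ?_
  have h : Continuous fun x : T τ => sgn (g j 0 + g j 1 + g j 2) (x j) := by
    rcases zmod2_cases (g j 0 + g j 1 + g j 2) with h0 | h0 <;> rw [h0]
    · simpa [sgn] using continuous_apply j
    · simp only [sgn, one_ne_zero, if_false]
      exact (continuous_apply j).neg
  exact (h.add continuous_const).add continuous_const

theorem gg_add_self (g : GG) : g + g = 0 := by
  funext i j
  exact CharTwo.add_self_eq_zero (g i j)

theorem act_act (g : GG) (x : T τ) : act τ g (act τ g x) = x := by
  rw [← act_add, gg_add_self, act_zero]

variable {τ} {X : Set (T τ)} {G : AddSubgroup GG}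

theorem holT_of_act {g : GG} (hg : ∀ x ∈ X, act τ g x ∈ X) {f : X → ℂ}
    (hf : ∀ x : X, f ⟨act τ g x.1, hg _ x.2⟩ = f x) (x : X)
    (h : HolT τ X f ⟨act τ g x.1, hg _ x.2⟩) : HolT τ X f x := by
  intro z hz
  obtain ⟨F, hF, hFe⟩ := h (actLift τ g z) (by rw [← act_toT, hz])
  have hA := analyticAt_actLift τ g z
  refine ⟨fun w => F (actLift τ g w), AnalyticAt.fun_comp hF hA, ?_⟩
  filter_upwards [hA.continuousAt.eventually hFe] with w h1 hw
  have h2 : toT τ (actLift τ g w) ∈ X := by rw [← act_toT]; exact hg _ hw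
  rw [← h1 h2, ← hf]
  exact congrArg f (Subtype.ext (act_toT τ g w))

theorem IsGBTPair.mk_eq_mk {x y : X} : Quotient.mk (orbitSetoid τ X G) x =
    Quotient.mk (orbitSetoid τ X G) y ↔ ∃ g ∈ G, act τ g x.1 = y.1 :=
  Quotient.eq (r := orbitSetoid τ X G)

theorem IsGBTPair.exists_disjoint_nhds (h : IsGBTPair τ X G) (x : X) :
    ∃ U : Set X, IsOpen U ∧ x ∈ U ∧
      Set.InjOn (Quotient.mk (orbitSetoid τ X G)) U := by
  have key : ∀ g ∈ G, g ≠ 0 → ∃ U : Set X, IsOpen U ∧ x ∈ U ∧ ∀ y ∈ U, ∀ y' ∈ U,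
      act τ g y.1 ≠ y'.1 := by
    intro g hg hg0
    obtain ⟨V, W, hV, hW, hxV, hxW, hVW⟩ := t2_separation (h.free g hg hg0 x.1 x.2)
    refine ⟨{y | act τ g y.1 ∈ V ∧ y.1 ∈ W}, ?_, ⟨hxV, hxW⟩, ?_⟩
    · exact (hV.preimage ((continuous_act τ g).comp continuous_subtype_val)).inter
        (hW.preimage continuous_subtype_val)
    · intro y hy y' hy' heq
      exact Set.disjoint_left.mp hVW hy.1 (heq ▸ hy'.2)
  choose! U hU hxU hUd using key
  refine ⟨⋂ g : {g : GG // g ∈ G ∧ g ≠ 0}, U g.1, isOpen_iInter_of_finite fun g => hU _ g.2.1 g.2.2,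
    Set.mem_iInter.mpr fun g => hxU _ g.2.1 g.2.2, ?_⟩
  intro y hy y' hy' heq
  obtain ⟨g, hg, hgy⟩ := IsGBTPair.mk_eq_mk.mp heq
  by_cases hg0 : g = 0
  · subst hg0
    rw [act_zero] at hgy
    exact Subtype.ext hgy
  · exact absurd hgy (hUd g hg hg0 y (Set.mem_iInter.mp hy ⟨g, hg, hg0⟩) y'
      (Set.mem_iInter.mp hy' ⟨g, hg, hg0⟩))

theorem IsGBTPair.isOpenMap_mk (h : IsGBTPair τ X G) :
    IsOpenMap (Quotient.mk (orbitSetoid τ X G)) := by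
  intro U hU
  rw [← isQuotientMap_quotient_mk'.isOpen_preimage]
  have : Quotient.mk (orbitSetoid τ X G) ⁻¹' (Quotient.mk (orbitSetoid τ X G) '' U) =
      ⋃ g : G, {x : X | (⟨act τ g.1 x.1, h.invariant g.1 g.2 x.1 x.2⟩ : X) ∈ U} := by
    ext x
    simp only [Set.mem_preimage, Set.mem_image, Set.mem_iUnion, Set.mem_ofPred_eq]
    constructor
    · rintro ⟨y, hy, hyx⟩
      obtain ⟨g, hg, hgx⟩ := IsGBTPair.mk_eq_mk.mp hyx.symm
      refine ⟨⟨g, hg⟩, ?_⟩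
      rwa [show (⟨act τ g x.1, h.invariant g hg x.1 x.2⟩ : X) = y from Subtype.ext hgx]
    · rintro ⟨g, hg⟩
      exact ⟨_, hg, (IsGBTPair.mk_eq_mk.mpr ⟨g.1, g.2, rfl⟩).symm⟩
  change IsOpen (Quotient.mk (orbitSetoid τ X G) ⁻¹' _)
  rw [this]
  refine isOpen_iUnion fun g => hU.preimage ?_
  exact continuous_induced_rng.mpr ((continuous_act τ g.1).comp continuous_subtype_val)

/-- The quotient map by the free action is a local isomorphism. -/
theorem IsGBTPair.germIso_mk (h : IsGBTPair τ X G) (x : X) :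
    GermIso (HolT τ X) x (HolModel τ X G) (Quotient.mk (orbitSetoid τ X G) x) := by
  obtain ⟨U, hU, hxU, hinj⟩ := h.exists_disjoint_nhds x
  have : Nonempty X := ⟨x⟩
  let e : OpenPartialHomeomorph X (Model τ X G) :=
    OpenPartialHomeomorph.ofContinuousOpen
      (hinj.toPartialEquiv (Quotient.mk (orbitSetoid τ X G)) U)
      continuous_quotient_mk'.continuousOn h.isOpenMap_mk hU
  refine ⟨e, hxU, rfl, fun y _ f => ⟨fun hf => hf y rfl, fun hf y' hy' => ?_⟩⟩
  obtain ⟨g, hg, hgy⟩ := IsGBTPair.mk_eq_mk.mp hy'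
  refine holT_of_act (h.invariant g hg) (fun z => ?_) y' ?_
  · exact congrArg f (IsGBTPair.mk_eq_mk.mpr ⟨g, hg, act_act τ g z.1⟩)
  · rwa [show (⟨act τ g y'.1, h.invariant g hg y'.1 y'.2⟩ : X) = y from Subtype.ext hgy]

theorem IsGBTPair.isSmoothPoint_mk_iff (h : IsGBTPair τ X G) (x : X) :
    IsSmoothPoint (HolModel τ X G) (Quotient.mk (orbitSetoid τ X G) x) ↔
      IsSmoothPoint (HolT τ X) x :=
  ⟨fun hs => (h.germIso_mk x).trans hs,
    fun hs => (GermIso.symm (isLocalPred_holT τ X) (h.germIso_mk x)).trans hs⟩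

theorem IsGBTPair.isNode_mk (h : IsGBTPair τ X G) {x : X} (hx : IsNode (HolT τ X) x) :
    IsNode (HolModel τ X G) (Quotient.mk (orbitSetoid τ X G) x) :=
  (GermIso.symm (isLocalPred_holT τ X) (h.germIso_mk x)).trans hx

theorem IsGBTPair.card_eq (h : IsGBTPair τ X G) : Nat.card G = 8 := by
  obtain ⟨i⟩ := h.iso
  rw [Nat.card_congr i.toEquiv]
  simp

/-- The orbit map of a point of `X`. -/
noncomputable def orbitMap (h : IsGBTPair τ X G) (x : X) (g : G) : X :=
  ⟨act τ g.1 x.1, h.invariant g.1 g.2 x.1 x.2⟩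

theorem IsGBTPair.ncard_orbit (h : IsGBTPair τ X G) (x : X) :
    (Set.range (orbitMap h x)).ncard = 8 := by
  rw [Set.ncard_range_of_injective, h.card_eq]
  intro g g' hgg
  have h2 : act τ g.1 x.1 = act τ g'.1 x.1 := congrArg Subtype.val hgg
  by_contra hne
  have h3 : g.1 + g'.1 ≠ 0 := fun h0 => hne (Subtype.ext (by
    have := eq_neg_of_add_eq_zero_left h0
    rw [this, neg_eq_of_add_eq_zero_left (gg_add_self g'.1)]))
  refine h.free (g.1 + g'.1) (G.add_mem g.2 g'.2) h3 x.1 x.2 ?_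
  rw [act_add, ← h2, act_act]

theorem IsGBTPair.mk_mem_singularLocus (h : IsGBTPair τ X G) (x : X) :
    Quotient.mk (orbitSetoid τ X G) x ∈ singularLocus (HolModel τ X G) ↔
      x ∈ singularLocus (HolT τ X) := not_congr (h.isSmoothPoint_mk_iff x)

theorem IsGBTPair.orbit_subset (h : IsGBTPair τ X G) {x : X}
    (hx : x ∈ singularLocus (HolT τ X)) :
    Set.range (orbitMap h x) ⊆ singularLocus (HolT τ X) := by
  rintro y ⟨g, rfl⟩
  rw [← h.mk_mem_singularLocus, show Quotient.mk (orbitSetoid τ X G) (orbitMap h x g) =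
    Quotient.mk _ x from (IsGBTPair.mk_eq_mk.mpr ⟨g.1, g.2, rfl⟩).symm, h.mk_mem_singularLocus]
  exact hx

/-- The description of the singular loci when the singular points form at most one orbit. -/
theorem IsGBTPair.conclusion (h : IsGBTPair τ X G)
    (hnode : ∀ x ∈ singularLocus (HolT τ X), IsNode (HolT τ X) x)
    (horb : ∀ x ∈ singularLocus (HolT τ X), ∀ y ∈ singularLocus (HolT τ X),
      ∃ g ∈ G, act τ g x.1 = y.1) :
    (singularLocus (HolT τ X) = ∅ ∧ singularLocus (HolModel τ X G) = ∅) ∨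
      ((singularLocus (HolT τ X)).ncard = 8 ∧
        (∀ x ∈ singularLocus (HolT τ X), IsNode (HolT τ X) x) ∧
        ∃ q : Model τ X G, singularLocus (HolModel τ X G) = {q} ∧
          IsNode (HolModel τ X G) q) := by
  rcases (singularLocus (HolT τ X)).eq_empty_or_nonempty with h0 | ⟨x, hx⟩
  · refine Or.inl ⟨h0, Set.eq_empty_of_forall_notMem fun q hq => ?_⟩
    obtain ⟨x, rfl⟩ := Quotient.exists_rep q
    have := (h.mk_mem_singularLocus x).mp hq
    rw [h0] at this
    exact this
  · refine Or.inr ⟨?_, hnode, Quotient.mk _ x, ?_, h.isNode_mk (hnode x hx)⟩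
    · have h1 : singularLocus (HolT τ X) = Set.range (orbitMap h x) :=
        Set.Subset.antisymm (fun y hy => by
          obtain ⟨g, hg, hgy⟩ := horb x hx y hy
          exact ⟨⟨g, hg⟩, Subtype.ext hgy⟩) (h.orbit_subset hx)
      rw [h1, h.ncard_orbit]
    · ext q
      obtain ⟨y, rfl⟩ := Quotient.exists_rep q
      rw [h.mk_mem_singularLocus, Set.mem_singleton_iff]
      constructor
      · intro hy
        obtain ⟨g, hg, hgy⟩ := horb y hy x hx
        exact IsGBTPair.mk_eq_mk.mpr ⟨g, hg, hgy⟩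
      · intro hy
        rwa [← h.mk_mem_singularLocus, hy, h.mk_mem_singularLocus]

end Action

section NormalForms

theorem germIso_of_injective {n : ℕ} {V W : Set (Fin n → ℂ)} {z₀ : Fin n → ℂ}
    {Ψ : (Fin n → ℂ) → (Fin n → ℂ)} (hΨ : AnalyticAt ℂ Ψ z₀)
    {D : (Fin n → ℂ) →L[ℂ] (Fin n → ℂ)} (hD : HasFDerivAt Ψ D z₀) (hinj : ∀ h, D h = 0 → h = 0)
    (hV : ∀ᶠ w in 𝓝 z₀, w ∈ V ↔ Ψ w ∈ W) (hz : z₀ ∈ V) {w₀ : Fin n → ℂ} (hw : w₀ ∈ W)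
    (hΨw : Ψ z₀ = w₀) : GermIso (HolSub V) ⟨z₀, hz⟩ (HolSub W) ⟨w₀, hw⟩ := by
  subst hΨw
  have hinj' : Function.Injective (D : (Fin n → ℂ) →ₗ[ℂ] (Fin n → ℂ)) :=
    (injective_iff_map_eq_zero _).mpr hinj
  refine germIso_of_fderiv hΨ (LinearEquiv.ofInjectiveEndo _ hinj').toContinuousLinearEquiv ?_ hV hz hw
  convert hD using 1
  ext1 h
  rfl

theorem analyticAt_of_contDiff {n : ℕ} {f : (Fin n → ℂ) → ℂ} {w : Fin n → ℂ}
    (h : ContDiff ℂ (⊤ : WithTop ℕ∞) f) : AnalyticAt ℂ f w :=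
  contDiff_omega_iff_analyticOnNhd.mp h w (Set.mem_univ w)

theorem analyticAt_apply {n : ℕ} (j : Fin n) (w : Fin n → ℂ) :
    AnalyticAt ℂ (fun w : Fin n → ℂ => w j) w :=
  (ContinuousLinearMap.proj (R := ℂ) (φ := fun _ : Fin n => ℂ) j).analyticAt w

/-- A zero of a function with nonzero derivative along a coordinate axis is a smooth point. -/
theorem isSmoothPoint_of_line {V : Set (Fin 3 → ℂ)} (h0 : 0 ∈ V) {Φ : (Fin 3 → ℂ) → ℂ}
    (hΦ : AnalyticAt ℂ Φ 0) (hV : ∀ w, w ∈ V ↔ Φ w = 0) (j : Fin 3) {p : ℂ} (hp : p ≠ 0)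
    (hline : ∀ t : ℂ, Φ (Pi.single j t) = p * t) : IsSmoothPoint (HolSub V) ⟨0, h0⟩ := by
  set Ψ : (Fin 3 → ℂ) → (Fin 3 → ℂ) := fun w => Function.update w j (Φ w)
  set d := fderiv ℂ Φ 0
  have hd : HasFDerivAt Φ d 0 := hΦ.differentiableAt.hasFDerivAt
  have hdj : d (Pi.single j 1) = p := by
    have h1 : HasDerivAt (fun t : ℂ => t • (Pi.single j 1 : Fin 3 → ℂ)) (Pi.single j 1) 0 := by
      simpa using (hasDerivAt_id (0 : ℂ)).smul_const (Pi.single j 1 : Fin 3 → ℂ)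
    have h2 := HasFDerivAt.comp_hasDerivAt (l := Φ) (l' := d)
      (f := fun t : ℂ => t • (Pi.single j 1 : Fin 3 → ℂ)) (0 : ℂ) (by rwa [zero_smul]) h1
    have h3 : HasDerivAt (fun t : ℂ => p * t) p 0 := by
      simpa using (hasDerivAt_id (0 : ℂ)).const_mul p
    refine h2.unique (h3.congr_of_eventuallyEq (Eventually.of_forall fun t => ?_))
    simp only [Function.comp_apply]
    rw [← hline t, ← Pi.single_smul, smul_eq_mul, mul_one]
  set D : (Fin 3 → ℂ) →L[ℂ] (Fin 3 → ℂ) := ContinuousLinearMap.pi fun i =>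
    if i = j then d else ContinuousLinearMap.proj i with hDdef
  have hΨa : AnalyticAt ℂ Ψ 0 := by
    rw [analyticAt_pi_iff]
    intro i
    by_cases hi : i = j
    · subst hi; simpa [Ψ] using hΦ
    · simp only [Function.update_of_ne hi]
      exact analyticAt_apply i 0
  have hΨd : HasFDerivAt Ψ D 0 := by
    rw [hasFDerivAt_pi']
    intro i
    have hDi : (ContinuousLinearMap.proj i).comp D =
      if i = j then d else ContinuousLinearMap.proj i := by
        ext1 h; simp [hDdef]
    rw [hDi]
    by_cases hi : i = j
    · subst hi; simpa [Ψ] using hd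
    · simp only [Ψ, Function.update_of_ne hi, if_neg hi]
      exact (ContinuousLinearMap.proj (R := ℂ) (φ := fun _ : Fin 3 => ℂ) i).hasFDerivAt
  refine (germIso_of_injective (W := {w : Fin 3 → ℂ | w j = 0}) (w₀ := 0) hΨa hΨd ?_
    (Eventually.of_forall fun w => ?_) h0 (hw := rfl) ?_).trans (isSmoothPoint_hyperplane j)
  · intro h hh
    have hother : ∀ i, i ≠ j → h i = 0 := fun i hi => by
      have := congrFun hh i
      simpa [hDdef, hi] using this
    have hs : h = h j • Pi.single j 1 := by
      funext i
      by_cases hi : i = j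
      · subst hi; simp
      · simp [hi, hother i hi]
    have h1 := congrFun hh j
    simp only [hDdef, ContinuousLinearMap.coe_pi', if_true, Pi.zero_apply] at h1
    rw [hs, map_smul, hdj, smul_eq_mul] at h1
    rw [hs, (mul_eq_zero.mp h1).resolve_right hp, zero_smul]
  · rw [hV]
    simp [Ψ]
  · have : Φ 0 = 0 := (hV 0).mp h0
    funext i
    by_cases hi : i = j
    · subst hi; simp [Ψ, this]
    · simp [Ψ, hi]

/-- The Morse lemma for a diagonal quadratic form with variable coefficients. -/
theorem isNode_of_quadratic {V : Set (Fin 3 → ℂ)} (h0 : 0 ∈ V)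
    (ℓ : Fin 3 → ((Fin 3 → ℂ) →L[ℂ] ℂ)) (hℓ : ∀ h, (∀ j, ℓ j h = 0) → h = 0)
    {α : Fin 3 → (Fin 3 → ℂ) → ℂ} (hα : ∀ j, AnalyticAt ℂ (α j) 0) (hα0 : ∀ j, α j 0 ≠ 0)
    (hV : ∀ w, w ∈ V ↔ ∑ j, α j w * ℓ j w ^ 2 = 0) : IsNode (HolSub V) ⟨0, h0⟩ := by
  choose S hS hS0 hSq using fun j => exists_analytic_sqrt (hα j) (hα0 j)
  set Ψ : (Fin 3 → ℂ) → (Fin 3 → ℂ) := fun w j => ℓ j w * S j w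
  set D : (Fin 3 → ℂ) →L[ℂ] (Fin 3 → ℂ) := ContinuousLinearMap.pi fun j => S j 0 • ℓ j with hDdef
  have hΨ : AnalyticAt ℂ Ψ 0 := by
    rw [analyticAt_pi_iff]
    exact fun j => ((ℓ j).analyticAt 0).mul (hS j)
  have hΨd : HasFDerivAt Ψ D 0 := by
    rw [hasFDerivAt_pi']
    intro j
    have h1 := (ℓ j).hasFDerivAt (x := 0) |>.mul (hS j).differentiableAt.hasFDerivAt
    have h2 : (ContinuousLinearMap.proj j).comp D =
        (ℓ j) 0 • fderiv ℂ (S j) 0 + S j 0 • ℓ j := by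
      ext1 h
      simp [hDdef]
    rw [h2]
    exact h1
  refine germIso_of_injective (W := cone) (w₀ := 0) hΨ hΨd ?_ ?_ h0 vertex.2 ?_
  · intro h hh
    refine hℓ h fun j => ?_
    have h1 := congrFun hh j
    simp only [hDdef, ContinuousLinearMap.coe_pi', smul_apply, smul_eq_mul,
      Pi.zero_apply] at h1
    exact (mul_eq_zero.mp h1).resolve_left (hS0 j)
  · filter_upwards [eventually_all.mpr hSq] with w hw
    rw [hV]
    have : ∑ j, α j w * ℓ j w ^ 2 = Ψ w 0 ^ 2 + Ψ w 1 ^ 2 + Ψ w 2 ^ 2 := by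
      simp only [Fin.sum_univ_three, Ψ, ← hw]
      ring
    rw [this]
    rfl
  · funext j
    simp [Ψ]

@[to_additive]
theorem prod_three_of_ne {M : Type*} [CommMonoid M] {j₁ j₂ j₃ : Fin 3} (h₁₂ : j₁ ≠ j₂)
    (h₁₃ : j₁ ≠ j₃) (h₂₃ : j₂ ≠ j₃) (f : Fin 3 → M) : ∏ j, f j = f j₁ * f j₂ * f j₃ := by
  have h : (Finset.univ : Finset (Fin 3)) = {j₁, j₂, j₃} := by
    revert j₁ j₂ j₃; decide
  rw [h, Finset.prod_insert (by simp [h₁₂, h₁₃]), Finset.prod_insert (by simp [h₂₃]),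
    Finset.prod_singleton, mul_assoc]

theorem eq_of_ne_three {j₁ j₂ j₃ : Fin 3} (h₁₂ : j₁ ≠ j₂) (h₁₃ : j₁ ≠ j₃) (h₂₃ : j₂ ≠ j₃)
    (j : Fin 3) : j = j₁ ∨ j = j₂ ∨ j = j₃ := by
  revert j j₁ j₂ j₃; decide

variable {j₁ j₂ j₃ : Fin 3} {V : Set (Fin 3 → ℂ)}

/-- The node `α x y + γ z² = 0`. -/
theorem isNode_of_mul_add_sq (h₁₂ : j₁ ≠ j₂) (h₁₃ : j₁ ≠ j₃) (h₂₃ : j₂ ≠ j₃) (h0 : 0 ∈ V)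
    {α γ : (Fin 3 → ℂ) → ℂ} (hα : AnalyticAt ℂ α 0) (hα0 : α 0 ≠ 0)
    (hγ : AnalyticAt ℂ γ 0) (hγ0 : γ 0 ≠ 0)
    (hV : ∀ w, w ∈ V ↔ α w * (w j₁ * w j₂) + γ w * w j₃ ^ 2 = 0) :
    IsNode (HolSub V) ⟨0, h0⟩ := by
  set π : Fin 3 → ((Fin 3 → ℂ) →L[ℂ] ℂ) := fun j => ContinuousLinearMap.proj j
  have hπ : ∀ j w, π j w = w j := fun j w => rfl
  set ℓ : Fin 3 → ((Fin 3 → ℂ) →L[ℂ] ℂ) := fun j =>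
    if j = j₁ then (1 / 2 : ℂ) • (π j₁ + π j₂) else if j = j₂ then
      (Complex.I / 2) • (π j₁ - π j₂) else π j₃
  have e₁ : ∀ w, ℓ j₁ w = (w j₁ + w j₂) / 2 := fun w => by simp [ℓ, hπ]; ring
  have e₂ : ∀ w, ℓ j₂ w = Complex.I / 2 * (w j₁ - w j₂) := fun w => by
    simp [ℓ, hπ, h₁₂.symm]
  have e₃ : ∀ w, ℓ j₃ w = w j₃ := fun w => by simp [ℓ, hπ, h₁₃.symm, h₂₃.symm]
  refine isNode_of_quadratic (α := fun j => if j = j₃ then γ else α) h0 ℓ ?_ ?_ ?_ ?_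
  · intro h hh
    have a₁ := hh j₁
    have a₂ := hh j₂
    have a₃ := hh j₃
    rw [e₁] at a₁
    rw [e₂] at a₂
    rw [e₃] at a₃
    have a₂' := (mul_eq_zero.mp a₂).resolve_left (by simp)
    funext j
    rcases eq_of_ne_three h₁₂ h₁₃ h₂₃ j with rfl | rfl | rfl
    · change _ = (0 : ℂ); linear_combination a₁ + a₂' / 2
    · change _ = (0 : ℂ); linear_combination a₁ - a₂' / 2
    · exact a₃
  · intro j
    split_ifs
    exacts [hγ, hα]
  · intro j
    split_ifs
    exacts [hγ0, hα0]
  · intro w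
    rw [hV, sum_three_of_ne h₁₂ h₁₃ h₂₃]
    simp only [e₁, e₂, e₃, if_neg h₁₃, if_neg h₂₃, if_true]
    have : α w * ((w j₁ + w j₂) / 2) ^ 2 + α w * (Complex.I / 2 * (w j₁ - w j₂)) ^ 2 +
        γ w * w j₃ ^ 2 = α w * (w j₁ * w j₂) + γ w * w j₃ ^ 2 := by
      linear_combination α w * (w j₁ - w j₂) ^ 2 / 4 * Complex.I_sq
    rw [this]

/-- The node `α x² + β y² + γ z² = 0`. -/
theorem isNode_of_sq_add_sq (h₁₂ : j₁ ≠ j₂) (h₁₃ : j₁ ≠ j₃) (h₂₃ : j₂ ≠ j₃) (h0 : 0 ∈ V)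
    {α β γ : (Fin 3 → ℂ) → ℂ} (hα : AnalyticAt ℂ α 0) (hα0 : α 0 ≠ 0)
    (hβ : AnalyticAt ℂ β 0) (hβ0 : β 0 ≠ 0) (hγ : AnalyticAt ℂ γ 0) (hγ0 : γ 0 ≠ 0)
    (hV : ∀ w, w ∈ V ↔ α w * w j₁ ^ 2 + β w * w j₂ ^ 2 + γ w * w j₃ ^ 2 = 0) :
    IsNode (HolSub V) ⟨0, h0⟩ := by
  refine isNode_of_quadratic (α := fun j => if j = j₁ then α else if j = j₂ then β else γ) h0
    (fun j => ContinuousLinearMap.proj j) (fun h hh => funext hh) ?_ ?_ ?_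
  · intro j
    split_ifs
    exacts [hα, hβ, hγ]
  · intro j
    split_ifs
    exacts [hα0, hβ0, hγ0]
  · intro w
    rw [hV, sum_three_of_ne h₁₂ h₁₃ h₂₃]
    simp [h₁₂.symm, h₁₃.symm, h₂₃.symm]

/-- The node at a point where two edges of the hexagon of lines meet. -/
theorem isNode_of_edges (h₁₂ : j₁ ≠ j₂) (h₁₃ : j₁ ≠ j₃) (h₂₃ : j₂ ≠ j₃) (h0 : 0 ∈ V)
    {a₁ a₀' a₁' b₁ b₀' b₁' A₀ A₁ B₁ : ℂ} (ha : a₁ ≠ 0) (ha' : a₀' ≠ 0) (hb : b₁ ≠ 0)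
    (hb' : b₀' ≠ 0) (hA : A₀ ≠ 0) (hB : B₁ ≠ 0)
    (hV : ∀ w, w ∈ V ↔ (a₁ * w j₁) * (b₁ * w j₂) * (A₀ + A₁ * w j₃ ^ 2) +
      (a₀' + a₁' * w j₁) * (b₀' + b₁' * w j₂) * (B₁ * w j₃ ^ 2) = 0) :
    IsNode (HolSub V) ⟨0, h0⟩ := by
  refine isNode_of_mul_add_sq (α := fun w => a₁ * b₁ * (A₀ + A₁ * w j₃ ^ 2))
    (γ := fun w => (a₀' + a₁' * w j₁) * (b₀' + b₁' * w j₂) * B₁) h₁₂ h₁₃ h₂₃ h0 (analyticAt_of_contDiff (by fun_prop))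
    (by simp [ha, hb, hA]) (analyticAt_of_contDiff (by fun_prop)) (by simp [ha', hb', hB]) fun w => ?_
  rw [hV]
  refine Eq.congr ?_ rfl
  ring

/-- The local structure of the hypersurface
`a(x₁) b(x₂) A(x₃) + a'(x₁) b'(x₂) B(x₃) = 0`, where the `xⱼ` are first or second powers of local
coordinates and `(a, a')`, `(b, b')`, `(A, B)` are pairs of independent affine functions. -/
theorem local_structure (h₁₂ : j₁ ≠ j₂) (h₁₃ : j₁ ≠ j₃) (h₂₃ : j₂ ≠ j₃) (h0 : 0 ∈ V)
    {a₀ a₁ a₀' a₁' b₀ b₁ b₀' b₁' A₀ A₁ B₀ B₁ : ℂ} (ha : a₀ * a₁' - a₁ * a₀' ≠ 0)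
    (hb : b₀ * b₁' - b₁ * b₀' ≠ 0) (hA : A₀ * B₁ - A₁ * B₀ ≠ 0) {κ : Fin 3 → ℕ}
    (hκ : ∀ j, κ j = 1 ∨ κ j = 2) (hκ₁ : κ j₁ = 2 → a₀ ≠ 0 ∧ a₀' ≠ 0)
    (hκ₂ : κ j₂ = 2 → b₀ ≠ 0 ∧ b₀' ≠ 0)
    (hV : ∀ w, w ∈ V ↔
      (a₀ + a₁ * w j₁ ^ κ j₁) * (b₀ + b₁ * w j₂ ^ κ j₂) * (A₀ + A₁ * w j₃ ^ κ j₃) +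
      (a₀' + a₁' * w j₁ ^ κ j₁) * (b₀' + b₁' * w j₂ ^ κ j₂) * (B₀ + B₁ * w j₃ ^ κ j₃) = 0) :
    IsSmoothPoint (HolSub V) ⟨0, h0⟩ ∨ (IsNode (HolSub V) ⟨0, h0⟩ ∧
      ((∀ j, κ j = 2) ∨ (κ j₃ = 2 ∧
        ((a₀ = 0 ∧ b₀ = 0 ∧ B₀ = 0) ∨ (a₀' = 0 ∧ b₀' = 0 ∧ A₀ = 0))))) := by
  have hκ0 : ∀ j, κ j ≠ 0 := fun j => by rcases hκ j with h | h <;> omega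
  have hP0 : a₀ * b₀ * A₀ + a₀' * b₀' * B₀ = 0 := by
    have := (hV 0).mp h0
    simpa [hκ0] using this
  have hΦ : AnalyticAt ℂ (fun w : Fin 3 → ℂ =>
      (a₀ + a₁ * w j₁ ^ κ j₁) * (b₀ + b₁ * w j₂ ^ κ j₂) * (A₀ + A₁ * w j₃ ^ κ j₃) +
      (a₀' + a₁' * w j₁ ^ κ j₁) * (b₀' + b₁' * w j₂ ^ κ j₂) * (B₀ + B₁ * w j₃ ^ κ j₃)) 0 :=
    analyticAt_of_contDiff (by fun_prop)
  by_cases hs₁ : κ j₁ = 1 ∧ a₁ * b₀ * A₀ + a₁' * b₀' * B₀ ≠ 0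
  · refine Or.inl (isSmoothPoint_of_line h0 hΦ hV j₁ hs₁.2 fun t => ?_)
    simp only [Pi.single_eq_same, Pi.single_eq_of_ne h₁₂.symm, Pi.single_eq_of_ne h₁₃.symm,
      zero_pow (hκ0 _), hs₁.1]
    linear_combination hP0
  by_cases hs₂ : κ j₂ = 1 ∧ a₀ * b₁ * A₀ + a₀' * b₁' * B₀ ≠ 0
  · refine Or.inl (isSmoothPoint_of_line h0 hΦ hV j₂ hs₂.2 fun t => ?_)
    simp only [Pi.single_eq_same, Pi.single_eq_of_ne h₁₂, Pi.single_eq_of_ne h₂₃.symm,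
      zero_pow (hκ0 _), hs₂.1]
    linear_combination hP0
  by_cases hs₃ : κ j₃ = 1 ∧ a₀ * b₀ * A₁ + a₀' * b₀' * B₁ ≠ 0
  · refine Or.inl (isSmoothPoint_of_line h0 hΦ hV j₃ hs₃.2 fun t => ?_)
    simp only [Pi.single_eq_same, Pi.single_eq_of_ne h₁₃, Pi.single_eq_of_ne h₂₃,
      zero_pow (hκ0 _), hs₃.1]
    linear_combination hP0
  refine Or.inr ?_
  have hp₁ : κ j₁ = 1 → a₁ * b₀ * A₀ + a₁' * b₀' * B₀ = 0 := fun h => by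
    by_contra h'; exact hs₁ ⟨h, h'⟩
  have hp₂ : κ j₂ = 1 → a₀ * b₁ * A₀ + a₀' * b₁' * B₀ = 0 := fun h => by
    by_contra h'; exact hs₂ ⟨h, h'⟩
  have hp₃ : κ j₃ = 1 → a₀ * b₀ * A₁ + a₀' * b₀' * B₁ = 0 := fun h => by
    by_contra h'; exact hs₃ ⟨h, h'⟩
  have q₁ : a₁ * b₀ * A₀ + a₁' * b₀' * B₀ = 0 → b₀ * A₀ = 0 ∧ b₀' * B₀ = 0 := fun h =>
    ⟨(mul_eq_zero.mp (show (a₀ * a₁' - a₁ * a₀') * (b₀ * A₀) = 0 by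
        linear_combination a₁' * hP0 - a₀' * h)).resolve_left ha,
      (mul_eq_zero.mp (show (a₀ * a₁' - a₁ * a₀') * (b₀' * B₀) = 0 by
        linear_combination a₀ * h - a₁ * hP0)).resolve_left ha⟩
  have q₂ : a₀ * b₁ * A₀ + a₀' * b₁' * B₀ = 0 → a₀ * A₀ = 0 ∧ a₀' * B₀ = 0 := fun h =>
    ⟨(mul_eq_zero.mp (show (b₀ * b₁' - b₁ * b₀') * (a₀ * A₀) = 0 by
        linear_combination b₁' * hP0 - b₀' * h)).resolve_left hb,
      (mul_eq_zero.mp (show (b₀ * b₁' - b₁ * b₀') * (a₀' * B₀) = 0 by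
        linear_combination b₀ * h - b₁ * hP0)).resolve_left hb⟩
  have q₃ : a₀ * b₀ * A₁ + a₀' * b₀' * B₁ = 0 → a₀ * b₀ = 0 ∧ a₀' * b₀' = 0 := fun h =>
    ⟨(mul_eq_zero.mp (show (A₀ * B₁ - A₁ * B₀) * (a₀ * b₀) = 0 by
        linear_combination B₁ * hP0 - B₀ * h)).resolve_left hA,
      (mul_eq_zero.mp (show (A₀ * B₁ - A₁ * B₀) * (a₀' * b₀') = 0 by
        linear_combination A₀ * h - A₁ * hP0)).resolve_left hA⟩
  have na : a₀ = 0 → a₀' ≠ 0 ∧ a₁ ≠ 0 := fun h => by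
    constructor <;> rintro h' <;> exact ha (by rw [h, h']; ring)
  have na' : a₀' = 0 → a₀ ≠ 0 ∧ a₁' ≠ 0 := fun h => by
    constructor <;> rintro h' <;> exact ha (by rw [h, h']; ring)
  have nb : b₀ = 0 → b₀' ≠ 0 ∧ b₁ ≠ 0 := fun h => by
    constructor <;> rintro h' <;> exact hb (by rw [h, h']; ring)
  have nb' : b₀' = 0 → b₀ ≠ 0 ∧ b₁' ≠ 0 := fun h => by
    constructor <;> rintro h' <;> exact hb (by rw [h, h']; ring)
  have nA : A₀ = 0 → B₀ ≠ 0 ∧ A₁ ≠ 0 := fun h => by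
    constructor <;> rintro h' <;> exact hA (by rw [h, h']; ring)
  have nB : B₀ = 0 → A₀ ≠ 0 ∧ B₁ ≠ 0 := fun h => by
    constructor <;> rintro h' <;> exact hA (by rw [h, h']; ring)
  have hcase : (κ j₁ = 1 ∧ κ j₂ = 1 ∧ κ j₃ = 2) ∧
      ((a₀ = 0 ∧ b₀ = 0 ∧ B₀ = 0) ∨ (a₀' = 0 ∧ b₀' = 0 ∧ A₀ = 0)) ∨
      (∀ j, κ j = 2) ∧ a₁ * b₀ * A₀ + a₁' * b₀' * B₀ ≠ 0 ∧
        a₀ * b₁ * A₀ + a₀' * b₁' * B₀ ≠ 0 ∧ a₀ * b₀ * A₁ + a₀' * b₀' * B₁ ≠ 0 := by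
    simp only [mul_eq_zero] at q₁ q₂ q₃
    have hall : (∀ j, κ j = 2) ↔ κ j₁ = 2 ∧ κ j₂ = 2 ∧ κ j₃ = 2 := by
      refine ⟨fun h => ⟨h _, h _, h _⟩, fun h j => ?_⟩
      rcases eq_of_ne_three h₁₂ h₁₃ h₂₃ j with rfl | rfl | rfl
      exacts [h.1, h.2.1, h.2.2]
    rw [hall]
    rcases hκ j₁ with k₁ | k₁ <;> rcases hκ j₂ with k₂ | k₂ <;> rcases hκ j₃ with k₃ | k₃ <;>
      simp only [k₁, k₂, k₃, forall_const, OfNat.ofNat_ne_one, OfNat.one_ne_ofNat, false_implies,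
        and_true, true_and, and_false, false_and, or_false, false_or, ne_eq] at *
    all_goals grind
  rcases hcase with ⟨⟨k₁, k₂, k₃⟩, h⟩ | ⟨k, p₁, p₂, p₃⟩
  · refine ⟨?_, Or.inr ⟨k₃, h⟩⟩
    rcases h with ⟨ha0, hb0, hB0⟩ | ⟨ha0, hb0, hA0⟩
    · refine isNode_of_edges h₁₂ h₁₃ h₂₃ h0 (na ha0).2 (na ha0).1 (nb hb0).2 (nb hb0).1
        (nB hB0).1 (nB hB0).2 (a₁' := a₁') (b₁' := b₁') (A₁ := A₁) fun w => ?_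
      rw [hV, k₁, k₂, k₃, ha0, hb0, hB0]
      refine Eq.congr ?_ rfl
      ring
    · refine isNode_of_edges h₁₂ h₁₃ h₂₃ h0 (na' ha0).2 (na' ha0).1 (nb' hb0).2 (nb' hb0).1
        (nA hA0).1 (nA hA0).2 (a₁' := a₁) (b₁' := b₁) (A₁ := B₁) fun w => ?_
      rw [hV, k₁, k₂, k₃, ha0, hb0, hA0]
      refine Eq.congr ?_ rfl
      ring
  · refine ⟨?_, Or.inl k⟩
    refine isNode_of_sq_add_sq
      (α := fun w => a₁ * (b₀ + b₁ * w j₂ ^ 2) * (A₀ + A₁ * w j₃ ^ 2) +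
        a₁' * (b₀' + b₁' * w j₂ ^ 2) * (B₀ + B₁ * w j₃ ^ 2))
      (β := fun w => a₀ * b₁ * (A₀ + A₁ * w j₃ ^ 2) + a₀' * b₁' * (B₀ + B₁ * w j₃ ^ 2))
      (γ := fun _ => a₀ * b₀ * A₁ + a₀' * b₀' * B₁) h₁₂ h₁₃ h₂₃ h0 (analyticAt_of_contDiff (by fun_prop))
      (by simpa using p₁) (analyticAt_of_contDiff (by fun_prop)) (by simpa using p₂) (analyticAt_of_contDiff (by fun_prop)) p₃ fun w => ?_
    rw [hV, k, k, k]
    refine Eq.congr ?_ rfl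
    linear_combination hP0

end NormalForms

section TrilinearForms

/-- The trilinear form with coefficients `c`. -/
noncomputable def tri (c : Fin 2 → Fin 2 → Fin 2 → ℂ) (y : Fin 3 → Fin 2 → ℂ) : ℂ :=
  ∑ i, ∑ k, ∑ l, c i k l * y 0 i * y 1 k * y 2 l

theorem eval_triForm (c : Fin 2 → Fin 2 → Fin 2 → ℂ) (y : Fin 3 → Fin 2 → ℂ) :
    MvPolynomial.eval (fun m : Fin 3 × Fin 2 => y m.1 m.2) (triForm c) = tri c y := by
  simp [triForm, tri]

theorem isHomogeneous_triForm (c : Fin 2 → Fin 2 → Fin 2 → ℂ) : (triForm c).IsHomogeneous 3 := by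
  refine MvPolynomial.IsHomogeneous.sum _ _ _ fun i _ => MvPolynomial.IsHomogeneous.sum _ _ _
    fun k _ => MvPolynomial.IsHomogeneous.sum _ _ _ fun l _ => ?_
  exact (((MvPolynomial.isHomogeneous_C _ _).mul (MvPolynomial.isHomogeneous_X _ _)).mul
    (MvPolynomial.isHomogeneous_X _ _)).mul (MvPolynomial.isHomogeneous_X _ _)

theorem tri_single (c : Fin 2 → Fin 2 → Fin 2 → ℂ) (i k l : Fin 2) :
    tri c ![Pi.single i 1, Pi.single k 1, Pi.single l 1] = c i k l := by
  simp only [tri, Matrix.cons_val_zero, Matrix.cons_val_one, Matrix.cons_val]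
  fin_cases i <;> fin_cases k <;> fin_cases l <;> simp

/-- A trilinear form that vanishes on the zeros of an irreducible trilinear form is a multiple
of it. -/
theorem exists_smul_of_vanishing {c c' : Fin 2 → Fin 2 → Fin 2 → ℂ}
    (hc : Irreducible (triForm c)) (hv : ∀ y, tri c y = 0 → tri c' y = 0) :
    ∃ r : ℂ, ∀ i k l, c' i k l = r * c i k l := by
  have hp : (Ideal.span {triForm c}).IsPrime :=
    (Ideal.span_singleton_prime hc.ne_zero).mpr hc.prime
  have h1 : triForm c' ∈ Ideal.span {triForm c} := by
    rw [← MvPolynomial.IsPrime.vanishingIdeal_zeroLocus (K := ℂ) (Ideal.span {triForm c})]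
    intro x hx
    have h2 : tri c (fun j i => x (j, i)) = 0 := by
      rw [← eval_triForm]
      exact hx _ (Ideal.mem_span_singleton_self _)
    have h3 := hv _ h2
    rw [← eval_triForm] at h3
    exact h3
  obtain ⟨q, hq⟩ := Ideal.mem_span_singleton.mp h1
  have key : ∃ r : ℂ, triForm c' = triForm c * MvPolynomial.C r := by
    by_cases h0 : triForm c' = 0
    · exact ⟨0, by simp [h0]⟩
    have hq0 : q ≠ 0 := by
      rintro rfl
      exact h0 (by simpa using hq)
    have h4 := congrArg MvPolynomial.totalDegree hq
    rw [MvPolynomial.totalDegree_mul_of_isDomain hc.ne_zero hq0,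
      (isHomogeneous_triForm c).totalDegree hc.ne_zero,
      (isHomogeneous_triForm c').totalDegree h0] at h4
    exact ⟨q.coeff 0, by
      rw [hq, ← MvPolynomial.totalDegree_eq_zero_iff_eq_C.mp (by omega : q.totalDegree = 0)]⟩
  obtain ⟨r, hr⟩ := key
  refine ⟨r, fun i k l => ?_⟩
  have h5 := congrArg (MvPolynomial.eval fun m : Fin 3 × Fin 2 =>
    (![Pi.single i 1, Pi.single k 1, Pi.single l 1] : Fin 3 → Fin 2 → ℂ) m.1 m.2) hr
  rw [map_mul, eval_triForm, eval_triForm, tri_single, tri_single, MvPolynomial.eval_C] at h5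
  rw [h5, mul_comm]

/-- The sign by which `(s : t) ↦ ((-1)^e s : t)` acts on the homogeneous coordinates. -/
def coordSign (e : ZMod 2) (i : Fin 2) : ℂ := if e = 1 ∧ i = 0 then -1 else 1

theorem tri_coordSign (c : Fin 2 → Fin 2 → Fin 2 → ℂ) (e : Fin 3 → ZMod 2)
    (y : Fin 3 → Fin 2 → ℂ) : tri c (fun j i => coordSign (e j) i * y j i) =
      tri (fun i k l => coordSign (e 0) i * coordSign (e 1) k * coordSign (e 2) l * c i k l) y :=
  Finset.sum_congr rfl fun i _ => Finset.sum_congr rfl fun k _ => Finset.sum_congr rfl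
    fun l _ => by ring

theorem tri_eq_zero_of_eq_zero (c : Fin 2 → Fin 2 → Fin 2 → ℂ) {y : Fin 3 → Fin 2 → ℂ} {j : Fin 3}
    (h : y j = 0) : tri c y = 0 := by
  refine Finset.sum_eq_zero fun i _ => Finset.sum_eq_zero fun k _ => Finset.sum_eq_zero fun l _ => ?_
  fin_cases j
  · simp [show y 0 = 0 from h]
  · simp [show y 1 = 0 from h]
  · simp [show y 2 = 0 from h]

theorem tri_smul (c : Fin 2 → Fin 2 → Fin 2 → ℂ) (r : Fin 3 → ℂ) (y : Fin 3 → Fin 2 → ℂ) :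
    tri c (fun j i => r j * y j i) = r 0 * r 1 * r 2 * tri c y := by
  simp only [tri, Fin.sum_univ_two]
  ring

theorem tri_of_isHom (c : Fin 2 → Fin 2 → Fin 2 → ℂ) {x : P1Cube} {y : Fin 3 → Fin 2 → ℂ}
    (h : ∀ j, IsHom (x j) (y j 0) (y j 1)) : tri c y = 0 ↔ tri c (fun j => hom (x j)) = 0 := by
  choose r hr h0 h1 using fun j => (h j).exists_smul
  have : y = fun j i => r j * hom (x j) i := by
    funext j i
    fin_cases i
    exacts [h0 j, h1 j]
  rw [this, tri_smul, mul_eq_zero, or_iff_right]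
  simp [hr]

/-- A trilinear form has a zero with two prescribed components. -/
theorem exists_tri_eq_zero (c : Fin 2 → Fin 2 → Fin 2 → ℂ) (y : Fin 3 → Fin 2 → ℂ) (j : Fin 3) :
    ∃ p : Fin 2 → ℂ, (p 0 ≠ 0 ∨ p 1 ≠ 0) ∧ tri c (Function.update y j p) = 0 := by
  have key : ∃ α β : ℂ, ∀ p : Fin 2 → ℂ, tri c (Function.update y j p) = α * p 0 + β * p 1 := by
    refine ⟨tri c (Function.update y j ![1, 0]), tri c (Function.update y j ![0, 1]), fun p => ?_⟩
    fin_cases j <;> simp [tri] <;> ring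
  obtain ⟨α, β, h⟩ := key
  by_cases h0 : α = 0 ∧ β = 0
  · exact ⟨![1, 0], by simp, by simp [h, h0.1, h0.2]⟩
  · refine ⟨![β, -α], ?_, by rw [h]; simp; ring⟩
    simp only [Matrix.cons_val_zero, Matrix.cons_val_one, neg_ne_zero]
    tauto

/-- A trilinear form that is semi-invariant under a sign change of two of the three factors. -/
theorem exists_normalForm {c : Fin 2 → Fin 2 → Fin 2 → ℂ} (hc : Irreducible (triForm c))
    {e : Fin 3 → ZMod 2} (he : e 0 + e 1 + e 2 = 0) (he0 : e ≠ 0) {r : ℂ}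
    (hr : ∀ i k l, coordSign (e 0) i * coordSign (e 1) k * coordSign (e 2) l * c i k l =
      r * c i k l) :
    ∃ (j₁ j₂ j₃ : Fin 3) (k : Fin 2) (A B : Fin 2 → ℂ), j₁ ≠ j₂ ∧ j₁ ≠ j₃ ∧ j₂ ≠ j₃ ∧
      A 0 * B 1 - A 1 * B 0 ≠ 0 ∧ ∀ y, tri c y =
        y j₁ 0 * y j₂ k * (A 0 * y j₃ 0 + A 1 * y j₃ 1) +
        y j₁ 1 * y j₂ (1 - k) * (B 0 * y j₃ 0 + B 1 * y j₃ 1) := by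
  suffices h : ∃ (j₁ j₂ j₃ : Fin 3) (k : Fin 2) (A B : Fin 2 → ℂ), j₁ ≠ j₂ ∧ j₁ ≠ j₃ ∧ j₂ ≠ j₃ ∧
      ∀ y, tri c y = y j₁ 0 * y j₂ k * (A 0 * y j₃ 0 + A 1 * y j₃ 1) +
        y j₁ 1 * y j₂ (1 - k) * (B 0 * y j₃ 0 + B 1 * y j₃ 1) by
    obtain ⟨j₁, j₂, j₃, k, A, B, h₁₂, h₁₃, h₂₃, h⟩ := h
    refine ⟨j₁, j₂, j₃, k, A, B, h₁₂, h₁₃, h₂₃, fun hdet => ?_, h⟩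
    obtain ⟨s, t, C, hA, hB⟩ : ∃ (s t : ℂ) (C : Fin 2 → ℂ), (∀ i, A i = s * C i) ∧
        ∀ i, B i = t * C i := by
      by_cases hA0 : A 0 = 0
      · by_cases hA1 : A 1 = 0
        · exact ⟨0, 1, B, fun i => by fin_cases i <;> simp [hA0, hA1], by simp⟩
        · refine ⟨1, B 1 / A 1, A, by simp, fun i => ?_⟩
          fin_cases i
          · have : A 1 * B 0 = 0 := by linear_combination B 1 * hA0 - hdet
            have := (mul_eq_zero.mp this).resolve_left hA1
            simp [this, hA0]
          · simp [hA1]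
      · refine ⟨1, B 0 / A 0, A, by simp, fun i => ?_⟩
        fin_cases i
        · simp [hA0]
        · simp only [Fin.mk_one]
          field_simp
          linear_combination hdet
    have hfac : triForm c = (MvPolynomial.C s * MvPolynomial.X (j₁, 0) * MvPolynomial.X (j₂, k) +
        MvPolynomial.C t * MvPolynomial.X (j₁, 1) * MvPolynomial.X (j₂, 1 - k)) *
        (MvPolynomial.C (C 0) * MvPolynomial.X (j₃, 0) +
          MvPolynomial.C (C 1) * MvPolynomial.X (j₃, 1)) := by
      refine MvPolynomial.funext fun v => ?_
      rw [show MvPolynomial.eval v (triForm c) = _ from eval_triForm c (fun j i => v (j, i)), h]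
      simp only [map_mul, map_add, MvPolynomial.eval_C, MvPolynomial.eval_X, hA, hB]
      ring
    rcases hc.isUnit_or_isUnit hfac with hu | hu
    · simpa using hu.map (MvPolynomial.eval (fun _ => (0 : ℂ)))
    · simpa using hu.map (MvPolynomial.eval (fun _ => (0 : ℂ)))
  have hz : ∀ i k l, coordSign (e 0) i * coordSign (e 1) k * coordSign (e 2) l ≠ r →
      c i k l = 0 := fun i k l h => by
    refine (mul_eq_zero.mp (?_ : (coordSign (e 0) i * coordSign (e 1) k *
      coordSign (e 2) l - r) * c i k l = 0)).resolve_left (sub_ne_zero.mpr h)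
    linear_combination hr i k l
  have hr1 : r ≠ 1 ∨ r ≠ -1 := by
    by_contra! h
    have := h.1.symm.trans h.2
    norm_num at this
  have hcases : e = ![0, 1, 1] ∨ e = ![1, 0, 1] ∨ e = ![1, 1, 0] := by
    clear hz hr
    revert e
    decide
  simp only [tri, Fin.sum_univ_two]
  rcases hcases with rfl | rfl | rfl <;> rcases hr1 with h | h
  · refine ⟨1, 2, 0, 1, ![c 0 0 1, c 1 0 1], ![c 0 1 0, c 1 1 0], by decide, by decide, by decide, fun y => ?_⟩
    have h00 : ∀ i, c i 0 0 = 0 := fun i => hz _ _ _ (by simpa [coordSign] using h.symm)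
    have h11 : ∀ i, c i 1 1 = 0 := fun i => hz _ _ _ (by simpa [coordSign] using h.symm)
    simp [h00, h11]
    ring
  · refine ⟨1, 2, 0, 0, ![c 0 0 0, c 1 0 0], ![c 0 1 1, c 1 1 1], by decide, by decide, by decide, fun y => ?_⟩
    have h01 : ∀ i, c i 0 1 = 0 := fun i => hz _ _ _ (by simpa [coordSign] using h.symm)
    have h10 : ∀ i, c i 1 0 = 0 := fun i => hz _ _ _ (by simpa [coordSign] using h.symm)
    simp [h01, h10]
    ring
  · refine ⟨0, 2, 1, 1, ![c 0 0 1, c 0 1 1], ![c 1 0 0, c 1 1 0], by decide, by decide, by decide, fun y => ?_⟩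
    have h00 : ∀ i, c 0 i 0 = 0 := fun i => hz _ _ _ (by simpa [coordSign] using h.symm)
    have h11 : ∀ i, c 1 i 1 = 0 := fun i => hz _ _ _ (by simpa [coordSign] using h.symm)
    simp [h00, h11]
    ring
  · refine ⟨0, 2, 1, 0, ![c 0 0 0, c 0 1 0], ![c 1 0 1, c 1 1 1], by decide, by decide, by decide, fun y => ?_⟩
    have h01 : ∀ i, c 0 i 1 = 0 := fun i => hz _ _ _ (by simpa [coordSign] using h.symm)
    have h10 : ∀ i, c 1 i 0 = 0 := fun i => hz _ _ _ (by simpa [coordSign] using h.symm)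
    simp [h01, h10]
    ring
  · refine ⟨0, 1, 2, 1, ![c 0 1 0, c 0 1 1], ![c 1 0 0, c 1 0 1], by decide, by decide, by decide, fun y => ?_⟩
    have h00 : ∀ i, c 0 0 i = 0 := fun i => hz _ _ _ (by simpa [coordSign] using h.symm)
    have h11 : ∀ i, c 1 1 i = 0 := fun i => hz _ _ _ (by simpa [coordSign] using h.symm)
    simp [h00, h11]
    ring
  · refine ⟨0, 1, 2, 0, ![c 0 0 0, c 0 0 1], ![c 1 1 0, c 1 1 1], by decide, by decide, by decide, fun y => ?_⟩
    have h01 : ∀ i, c 0 1 i = 0 := fun i => hz _ _ _ (by simpa [coordSign] using h.symm)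
    have h10 : ∀ i, c 1 0 i = 0 := fun i => hz _ _ _ (by simpa [coordSign] using h.symm)
    simp [h01, h10]
    ring

end TrilinearForms

section Equation

variable {τ : Fin 3 → UpperHalfPlane} {X : Set (T τ)} {G : AddSubgroup GG}
  {c : Fin 2 → Fin 2 → Fin 2 → ℂ}

/-- `X` is the inverse image in `T` of the irreducible divisor with the trilinear equation `c`. -/
def HasEquation (τ : Fin 3 → UpperHalfPlane) (X : Set (T τ)) (c : Fin 2 → Fin 2 → Fin 2 → ℂ) :
    Prop :=
  Irreducible (triForm c) ∧ ∀ z, toT τ z ∈ X ↔ tri c (fun j => hom (coordP (τ j) (z j))) = 0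

theorem IsBurniatHypersurface.exists_hasEquation (h : IsBurniatHypersurface τ X) :
    ∃ c, HasEquation τ X c := by
  obtain ⟨Y, -, ⟨c, hc, rfl⟩, -, -, rfl⟩ := h
  refine ⟨c, hc, fun z => ?_⟩
  rw [← eval_triForm]
  rfl

theorem HasEquation.mem_iff (hc : HasEquation τ X c) {z : Fin 3 → ℂ} {y : Fin 3 → Fin 2 → ℂ}
    (h : ∀ j, IsHom (coordP (τ j) (z j)) (y j 0) (y j 1)) : toT τ z ∈ X ↔ tri c y = 0 := by
  rw [hc.2, tri_of_isHom c h]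

theorem exists_coordP_isHom (τ : Fin 3 → UpperHalfPlane) {y : Fin 3 → Fin 2 → ℂ}
    (h : ∀ j, y j 0 ≠ 0 ∨ y j 1 ≠ 0) :
    ∃ z : Fin 3 → ℂ, ∀ j, IsHom (coordP (τ j) (z j)) (y j 0) (y j 1) := by
  choose x hx using fun j => exists_isHom (h j)
  choose z hz using fun j => coordP_surjective (τ := τ j) (x j)
  exact ⟨z, fun j => by rw [hz]; exact hx j⟩

theorem isHom_coordP_actLift {g : GG} {z : Fin 3 → ℂ} {j : Fin 3} (hg : g j 1 = 0) {p : Fin 2 → ℂ}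
    (h : IsHom (coordP (τ j) (z j)) (p 0) (p 1)) :
    IsHom (coordP (τ j) (actLift τ g z j)) (coordSign (g j 2) 0 * p 0)
      (coordSign (g j 2) 1 * p 1) := by
  have h1 : ∀ s, IsHom (coordP (τ j) (sgn s (z j))) (p 0) (p 1) := fun s => by
    rcases zmod2_cases s with rfl | rfl
    · simpa [sgn] using h
    · simpa [sgn, coordP_neg] using h
  rw [actLift, hg]
  rcases zmod2_cases (g j 2) with h0 | h0
  · simpa [shift, h0, coordSign] using h1 _
  · rw [h0]
    simp only [shift, if_true, one_ne_zero, if_false, add_zero, coordP_add_half, coordSign]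
    simpa using (h1 _).negP1

/-- The equation of an invariant hypersurface is semi-invariant. -/
theorem HasEquation.exists_semiInvariant (hc : HasEquation τ X c) {g : GG}
    (hg : ∀ x ∈ X, act τ g x ∈ X) (hg1 : ∀ j, g j 1 = 0) :
    ∃ r : ℂ, ∀ i k l, coordSign (g 0 2) i * coordSign (g 1 2) k * coordSign (g 2 2) l * c i k l =
      r * c i k l := by
  refine exists_smul_of_vanishing hc.1 fun y hy => ?_
  by_cases h0 : ∀ j, y j 0 ≠ 0 ∨ y j 1 ≠ 0
  · obtain ⟨z, hz⟩ := exists_coordP_isHom τ h0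
    have h1 := hg _ ((hc.mem_iff hz).mpr hy)
    rw [act_toT, hc.mem_iff (y := fun j i => coordSign (g j 2) i * y j i)
      fun j => isHom_coordP_actLift (hg1 j) (hz j)] at h1
    rwa [tri_coordSign c fun j => g j 2] at h1
  · push Not at h0
    obtain ⟨j, h0, h1⟩ := h0
    refine tri_eq_zero_of_eq_zero _ (j := j) ?_
    funext i
    fin_cases i
    exacts [h0, h1]

theorem IsGBTPair.zeta_eq_one (h : IsGBTPair τ X G) (hc : HasEquation τ X c) {g : GG} (hg : g ∈ G)
    (hg0 : g ≠ 0) (hg1 : ∀ j, g j 1 = 0) (hg2 : ∀ j, g j 2 = 0) (j : Fin 3) : g j 0 = 1 := by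
  by_contra hj
  have hj0 : g j 0 = 0 := (zmod2_cases _).resolve_right hj
  obtain ⟨p, hp, hp0⟩ := exists_tri_eq_zero c (fun i => hom (coordP (τ i) 0)) j
  obtain ⟨x, hx⟩ := exists_isHom hp
  obtain ⟨w, rfl⟩ := coordP_surjective (τ := τ j) x
  have hmem : toT τ (Function.update 0 j w) ∈ X := by
    refine (hc.mem_iff fun i => ?_).mpr hp0
    by_cases hi : i = j
    · subst hi
      simpa using hx
    · simpa [hi] using isHom_hom _
  refine h.free g hg hg0 _ hmem ?_
  rw [act_toT]
  congr 1
  funext i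
  by_cases hi : i = j
  · subst hi
    simp [actLift, hg1, hg2, hj0, sgn, shift]
  · simp [actLift, hg1, hg2, hi, sgn, shift]

theorem IsGBTPair.eta_eq (h : IsGBTPair τ X G) {g : GG} (hg : g ∈ G) (j : Fin 3) :
    g j 1 = g 0 1 := by
  obtain ⟨h1, h2, -⟩ := h.le hg
  fin_cases j
  exacts [rfl, h1.symm, (h1.trans h2).symm]

theorem IsGBTPair.exists_epsilon_ne_zero (h : IsGBTPair τ X G) (hc : HasEquation τ X c) :
    ∃ g ∈ G, (∀ j, g j 1 = 0) ∧ (fun j => g j 2) ≠ 0 := by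
  by_contra! hno
  have hinj : Function.Injective fun g : G => (g.1 0 1, g.1 0 0) := by
    rintro ⟨g, hg⟩ ⟨k, hk⟩ hgk
    simp only [Prod.mk.injEq] at hgk
    by_contra hne
    have hne' : g - k ≠ 0 := fun h0 => hne (Subtype.ext (sub_eq_zero.mp h0))
    have hmem := G.sub_mem hg hk
    have h1 : ∀ j, (g - k) j 1 = 0 := fun j => by
      rw [h.eta_eq hmem]
      simp [hgk.1]
    have h2 := h.zeta_eq_one hc hmem hne' h1 (fun j => congrFun (hno _ hmem h1) j) 0
    simp [hgk.2] at h2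
  have := Nat.card_le_card_of_injective _ hinj
  rw [h.card_eq] at this
  simp at this

/-- If `G` does not contain `z ↦ -z`, then `η` and `ε` take all values allowed on `G`. -/
theorem IsGBTPair.exists_of_eta_epsilon (h : IsGBTPair τ X G)
    (hno : ∀ g ∈ G, (∀ j, g j 1 = 0) → (∀ j, g j 2 = 0) → g = 0) (a : ZMod 2) {b : Fin 3 → ZMod 2}
    (hb : b 0 + b 1 + b 2 = 0) : ∃ g ∈ G, (∀ j, g j 1 = a) ∧ ∀ j, g j 2 = b j := by
  have hinj : Function.Injective fun g : G => (g.1 0 1, g.1 0 2, g.1 1 2) := by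
    rintro ⟨g, hg⟩ ⟨k, hk⟩ hgk
    simp only [Prod.mk.injEq] at hgk
    have hmem := G.sub_mem hg hk
    refine Subtype.ext (sub_eq_zero.mp (hno _ hmem (fun j => ?_) fun j => ?_))
    · rw [h.eta_eq hmem]
      simp [hgk.1]
    · have h1 := (h.le hmem).2.2
      have h2 : (g - k) 0 2 = 0 := by simp [hgk.2.1]
      have h3 : (g - k) 1 2 = 0 := by simp [hgk.2.2]
      rw [h2, h3] at h1
      fin_cases j
      exacts [h2, h3, by simpa using h1]
  have hbij := (Nat.bijective_iff_injective_and_card _).mpr ⟨hinj, by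
    rw [h.card_eq]; simp⟩
  obtain ⟨⟨g, hg⟩, hgk⟩ := hbij.2 (a, b 0, b 1)
  simp only [Prod.mk.injEq] at hgk
  refine ⟨g, hg, fun j => by rw [h.eta_eq hg, hgk.1], fun j => ?_⟩
  have h1 := (h.le hg).2.2
  fin_cases j
  · exact hgk.2.1
  · exact hgk.2.2
  · change g 2 2 = b 2
    rw [hgk.2.1, hgk.2.2] at h1
    linear_combination h1 - hb

end Equation

section Points

variable {τ : Fin 3 → UpperHalfPlane} {X : Set (T τ)} {G : AddSubgroup GG}
  {c : Fin 2 → Fin 2 → Fin 2 → ℂ}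

theorem exists_lineAt_eq (p : P1) : ∃ s : Fin 2 → ℂ, (∀ t i, lineAt p t i = hom p i + s i * t) ∧
    hom p 0 * s 1 - s 0 * hom p 1 ≠ 0 := by
  induction p using OnePoint.rec with
  | infty => exact ⟨![0, 1], fun t i => by fin_cases i <;> simp, by simp⟩
  | coe v => exact ⟨![1, 0], fun t i => by fin_cases i <;> simp, by simp⟩

/-- The germ of `X` in the standard charts of `(ℙ¹)³`. -/
theorem HasEquation.germIso (hc : HasEquation τ X c) {z : Fin 3 → ℂ} (hz : toT τ z ∈ X)
    (h0 : (0 : Fin 3 → ℂ) ∈ {w : Fin 3 → ℂ | tri c (fun j =>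
      lineAt (coordP (τ j) (z j)) (w j ^ ramIndex (τ j) (z j))) = 0}) :
    GermIso (HolSub {w | toT τ w ∈ X}) ⟨z, hz⟩ (HolSub {w : Fin 3 → ℂ | tri c (fun j =>
      lineAt (coordP (τ j) (z j)) (w j ^ ramIndex (τ j) (z j))) = 0}) ⟨0, h0⟩ := by
  choose u hu hu0 hud hue using fun j => exists_local_coordinate (τ j) (z j)
  refine germIso_of_injective (Ψ := fun w j => u j (w j)) (D := ContinuousLinearMap.pi fun j =>
    deriv (u j) (z j) • ContinuousLinearMap.proj j) ?_ ?_ ?_ ?_ hz h0 (funext hu0)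
  · rw [analyticAt_pi_iff]
    exact fun j => AnalyticAt.fun_comp (f := fun w : Fin 3 → ℂ => w j) (hu j) (analyticAt_apply j z)
  · rw [hasFDerivAt_pi']
    intro j
    have h1 := (hu j).differentiableAt.hasDerivAt.comp_hasFDerivAt (f := fun w : Fin 3 → ℂ => w j) z
      (ContinuousLinearMap.proj (R := ℂ) (φ := fun _ : Fin 3 => ℂ) j).hasFDerivAt
    exact h1
  · intro h hh
    funext j
    have h1 := congrFun hh j
    simpa [hud j] using h1
  · have h1 : ∀ᶠ w in 𝓝 z, ∀ j, IsHom (coordP (τ j) (w j))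
        (lineAt (coordP (τ j) (z j)) (u j (w j) ^ ramIndex (τ j) (z j)) 0)
        (lineAt (coordP (τ j) (z j)) (u j (w j) ^ ramIndex (τ j) (z j)) 1) :=
      eventually_all.mpr fun j => (continuous_apply j).continuousAt.eventually (hue j)
    filter_upwards [h1] with w hw
    exact hc.mem_iff hw

variable {j₁ j₂ j₃ : Fin 3} {k : Fin 2} {A B : Fin 2 → ℂ}

/-- The trilinear form is `y₁₀ y₂ₖ A(y₃) + y₁₁ y₂₁₋ₖ B(y₃)`, up to a permutation of the factors. -/
structure NormalForm (c : Fin 2 → Fin 2 → Fin 2 → ℂ) (j₁ j₂ j₃ : Fin 3) (k : Fin 2)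
    (A B : Fin 2 → ℂ) : Prop where
  h₁₂ : j₁ ≠ j₂
  h₁₃ : j₁ ≠ j₃
  h₂₃ : j₂ ≠ j₃
  det : A 0 * B 1 - A 1 * B 0 ≠ 0
  eq : ∀ y, tri c y = y j₁ 0 * y j₂ k * (A 0 * y j₃ 0 + A 1 * y j₃ 1) +
    y j₁ 1 * y j₂ (1 - k) * (B 0 * y j₃ 0 + B 1 * y j₃ 1)

/-- The linear forms `B` and `A`, in the order in which they vanish at the exceptional points. -/
def pencil (A B : Fin 2 → ℂ) (i : Fin 2) : Fin 2 → ℂ := if i = 0 then B else A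

/-- The points of `X` that lie over the vertex `i` of the hexagon of lines. -/
def IsVertexPoint (j₁ j₂ j₃ : Fin 3) (k : Fin 2) (A B : Fin 2 → ℂ) (i : Fin 2) (x : P1Cube) : Prop :=
  hom (x j₁) i = 0 ∧ hom (x j₂) (i + k) = 0 ∧
    pencil A B i 0 * hom (x j₃) 0 + pencil A B i 1 * hom (x j₃) 1 = 0

theorem HasEquation.local_structure (hc : HasEquation τ X c) (hN : NormalForm c j₁ j₂ j₃ k A B)
    {z : Fin 3 → ℂ} (hz : toT τ z ∈ X) :
    IsSmoothPoint (HolT τ X) ⟨toT τ z, hz⟩ ∨ (IsNode (HolT τ X) ⟨toT τ z, hz⟩ ∧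
      ((∀ j, 2 * z j ∈ (periods (τ j)).lattice) ∨ (2 * z j₃ ∈ (periods (τ j₃)).lattice ∧
        ∃ i, IsVertexPoint j₁ j₂ j₃ k A B i fun j => coordP (τ j) (z j)))) := by
  have hr : ∀ j, ramIndex (τ j) (z j) = 2 → 2 * z j ∈ (periods (τ j)).lattice := fun j h => by
    by_contra h'
    simp [ramIndex, h'] at h
  have hne : ∀ j, ramIndex (τ j) (z j) = 2 → ∀ i, hom (coordP (τ j) (z j)) i ≠ 0 := fun j h i =>
    hom_coordP_ne_zero (hr j h) i
  have h0 : (0 : Fin 3 → ℂ) ∈ {w : Fin 3 → ℂ | tri c (fun j =>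
      lineAt (coordP (τ j) (z j)) (w j ^ ramIndex (τ j) (z j))) = 0} := by
    have : ∀ j, (0 : ℂ) ^ ramIndex (τ j) (z j) = 0 := fun j => by
      rcases ramIndex_eq (τ j) (z j) with h | h <;> simp [h]
    simpa [this, lineAt_zero] using (hc.2 z).mp hz
  have hgerm := (GermIso.symm (isLocalPred_holSub _) (germIso_toT τ X hz)).trans (hc.germIso hz h0)
  choose s hs hdet using fun j => exists_lineAt_eq (coordP (τ j) (z j))
  set y : Fin 3 → Fin 2 → ℂ := fun j => hom (coordP (τ j) (z j)) with hy
  have hk : y j₂ k * s j₂ (1 - k) - s j₂ k * y j₂ (1 - k) ≠ 0 := by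
    have hall : ∀ k : Fin 2, y j₂ k * s j₂ (1 - k) - s j₂ k * y j₂ (1 - k) ≠ 0 :=
      Fin.forall_fin_two.mpr ⟨hdet j₂, fun h => hdet j₂ (by
        change y j₂ 1 * s j₂ 0 - s j₂ 1 * y j₂ 0 = 0 at h
        linear_combination -h)⟩
    exact hall k
  have hAB : (A 0 * y j₃ 0 + A 1 * y j₃ 1) * (B 0 * s j₃ 0 + B 1 * s j₃ 1) -
      (A 0 * s j₃ 0 + A 1 * s j₃ 1) * (B 0 * y j₃ 0 + B 1 * y j₃ 1) ≠ 0 := by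
    intro h
    exact mul_ne_zero hN.det (hdet j₃) (by linear_combination h)
  rcases Burniat.local_structure hN.h₁₂ hN.h₁₃ hN.h₂₃ h0 (hdet j₁) hk hAB
    (κ := fun j => ramIndex (τ j) (z j)) (fun j => ramIndex_eq _ _)
    (fun h => ⟨hne j₁ h _, hne j₁ h _⟩) (fun h => ⟨hne j₂ h _, hne j₂ h _⟩) (fun w => by
      rw [Set.mem_ofPred_eq, hN.eq]
      simp only [hs]
      refine Eq.congr ?_ rfl
      ring) with h | ⟨h, h'⟩
  · exact Or.inl (hgerm.trans h)
  · refine Or.inr ⟨hgerm.trans h, ?_⟩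
    rcases h' with h' | ⟨h₃, h' | h'⟩
    · exact Or.inl fun j => hr j (h' j)
    · exact Or.inr ⟨hr j₃ h₃, 0, h'.1, by simpa using h'.2.1, h'.2.2⟩
    · refine Or.inr ⟨hr j₃ h₃, 1, h'.1, ?_, h'.2.2⟩
      rw [show 1 + k = 1 - k from (by decide : ∀ k : Fin 2, 1 + k = 1 - k) k]
      exact h'.2.1

theorem eq_of_hom_eq_zero {x y : P1} (L : Fin 2 → ℂ) (hL : L ≠ 0)
    (hx : L 0 * hom x 0 + L 1 * hom x 1 = 0) (hy : L 0 * hom y 0 + L 1 * hom y 1 = 0) : x = y := by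
  rw [(isHom_hom x).eq_iff (isHom_hom y)]
  by_contra h
  have h' := sub_ne_zero.mpr h
  refine hL (funext fun i => ?_)
  fin_cases i
  · exact (mul_eq_zero.mp (by linear_combination hom y 1 * hx - hom x 1 * hy :
      (hom x 0 * hom y 1 - hom y 0 * hom x 1) * L 0 = 0)).resolve_left h'
  · exact (mul_eq_zero.mp (by linear_combination hom x 0 * hy - hom y 0 * hx :
      (hom x 0 * hom y 1 - hom y 0 * hom x 1) * L 1 = 0)).resolve_left h'

theorem NormalForm.vertex_unique (hN : NormalForm c j₁ j₂ j₃ k A B) {i : Fin 2} {x y : P1Cube}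
    (hx : IsVertexPoint j₁ j₂ j₃ k A B i x) (hy : IsVertexPoint j₁ j₂ j₃ k A B i y) : x = y := by
  have hsum : ∀ (x : P1) (i : Fin 2), hom x i = 0 →
      (Pi.single i (1 : ℂ) : Fin 2 → ℂ) 0 * hom x 0 + (Pi.single i (1 : ℂ) : Fin 2 → ℂ) 1 * hom x 1 = 0 := by
    intro x i h
    fin_cases i <;> simpa using h
  have hs : ∀ i : Fin 2, (Pi.single i (1 : ℂ) : Fin 2 → ℂ) ≠ 0 := fun i h => by
    simpa using congrFun h i
  funext j
  rcases eq_of_ne_three hN.h₁₂ hN.h₁₃ hN.h₂₃ j with rfl | rfl | rfl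
  · exact eq_of_hom_eq_zero _ (hs i) (hsum _ _ hx.1) (hsum _ _ hy.1)
  · exact eq_of_hom_eq_zero _ (hs _) (hsum _ _ hx.2.1) (hsum _ _ hy.2.1)
  · refine eq_of_hom_eq_zero _ ?_ hx.2.2 hy.2.2
    intro h
    refine hN.det ?_
    have h0 := congrFun h 0
    have h1 := congrFun h 1
    simp only [Pi.zero_apply] at h0 h1
    fin_cases i <;> simp [pencil] at h0 h1 <;> rw [h0, h1] <;> ring

theorem sub_mem_of_coordP_eq {τ : UpperHalfPlane} {z w : ℂ} (h : coordP τ z = coordP τ w)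
    (hw : 2 * w ∈ (periods τ).lattice) : z - w ∈ (periods τ).lattice := by
  rcases coordP_eq_iff.mp h with h | h
  · exact h
  · have := sub_mem h hw
    rwa [show z + w - 2 * w = z - w by ring] at this

/-- At most four points of `T` lie over a vertex of the hexagon and are ramified over the third
factor. -/
theorem NormalForm.exists_finset (hN : NormalForm c j₁ j₂ j₃ k A B) (τ : Fin 3 → UpperHalfPlane)
    (i : Fin 2) : ∃ t : Finset (T τ), t.card ≤ 4 ∧ ∀ z, 2 * z j₃ ∈ (periods (τ j₃)).lattice →
      IsVertexPoint j₁ j₂ j₃ k A B i (fun j => coordP (τ j) (z j)) → toT τ z ∈ t := by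
  classical
  by_cases hex : ∃ w : Fin 3 → ℂ, 2 * w j₃ ∈ (periods (τ j₃)).lattice ∧
      IsVertexPoint j₁ j₂ j₃ k A B i fun j => coordP (τ j) (w j)
  · obtain ⟨w, hw3, hw⟩ := hex
    refine ⟨Finset.univ.image fun s : ZMod 2 × ZMod 2 => toT τ fun j =>
      sgn (if j = j₁ then s.1 else if j = j₂ then s.2 else 0) (w j),
      Finset.card_image_le.trans (by simp), fun z hz3 hz => ?_⟩
    have heq := fun j => congrFun (hN.vertex_unique hz hw) j
    have hsign : ∀ j, ∃ s, toE (τ j) (z j) = toE (τ j) (sgn s (w j)) := fun j => by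
      rcases coordP_eq_iff.mp (heq j) with h | h
      · exact ⟨0, toE_eq_iff.mpr (by simpa [sgn] using h)⟩
      · exact ⟨1, toE_eq_iff.mpr (by simpa [sgn] using h)⟩
    obtain ⟨s₁, h₁⟩ := hsign j₁
    obtain ⟨s₂, h₂⟩ := hsign j₂
    refine Finset.mem_image.mpr ⟨(s₁, s₂), Finset.mem_univ _, funext fun j => ?_⟩
    rcases eq_of_ne_three hN.h₁₂ hN.h₁₃ hN.h₂₃ j with rfl | rfl | rfl
    · simpa [toT] using h₁.symm
    · simpa [toT, hN.h₁₂.symm] using h₂.symm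
    · simpa [toT, hN.h₁₃.symm, hN.h₂₃.symm, sgn] using
        (toE_eq_iff.mpr (sub_mem_of_coordP_eq (heq j) hw3)).symm
  · push Not at hex
    exact ⟨∅, by simp, fun z h1 h2 => absurd h2 (hex z h1)⟩

theorem IsGBTPair.exists_normalForm (h : IsGBTPair τ X G) (hc : HasEquation τ X c) :
    ∃ (j₁ j₂ j₃ : Fin 3) (k : Fin 2) (A B : Fin 2 → ℂ), NormalForm c j₁ j₂ j₃ k A B := by
  obtain ⟨g, hg, hg1, hg2⟩ := h.exists_epsilon_ne_zero hc
  obtain ⟨r, hr⟩ := hc.exists_semiInvariant (h.invariant g hg) hg1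
  obtain ⟨j₁, j₂, j₃, k, A, B, h₁₂, h₁₃, h₂₃, hdet, heq⟩ :=
    Burniat.exists_normalForm hc.1 (e := fun j => g j 2) (h.le hg).2.2 hg2 hr
  exact ⟨j₁, j₂, j₃, k, A, B, h₁₂, h₁₃, h₂₃, hdet, heq⟩

/-- The singular points form one orbit if `G` contains `z ↦ -z`. -/
theorem IsGBTPair.transitive_of_neg_mem (h : IsGBTPair τ X G) (hc : HasEquation τ X c)
    (hN : NormalForm c j₁ j₂ j₃ k A B) {g : GG} (hg : g ∈ G) (hg0 : g ≠ 0) (hg1 : ∀ j, g j 1 = 0)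
    (hg2 : ∀ j, g j 2 = 0) (x : X) (hx : x ∈ singularLocus (HolT τ X)) (y : X)
    (hy : y ∈ singularLocus (HolT τ X)) : ∃ g ∈ G, act τ g x.1 = y.1 := by
  classical
  choose t ht hmem using fun i => hN.exists_finset τ i
  have hsub : Subtype.val '' singularLocus (HolT τ X) ⊆ ((t 0 ∪ t 1 : Finset (T τ)) : Set (T τ)) := by
    rintro _ ⟨⟨v, hv⟩, hvs, rfl⟩
    obtain ⟨z, rfl⟩ := toT_surjective τ v
    rcases (hc.local_structure hN hv).resolve_left hvs with ⟨-, h1 | ⟨h1, i, h2⟩⟩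
    · refine absurd ?_ (h.free g hg hg0 _ hv)
      rw [act_toT]
      refine funext fun j => toE_eq_iff.mpr ?_
      have h3 := neg_mem (h1 j)
      rw [show -(2 * z j) = -z j - z j by ring] at h3
      simpa [actLift, hg1, hg2, h.zeta_eq_one hc hg hg0 hg1 hg2, sgn, shift] using h3
    · rw [Finset.mem_coe, Finset.mem_union]
      fin_cases i
      exacts [Or.inl (hmem 0 z h1 h2), Or.inr (hmem 1 z h1 h2)]
  have hfin : (singularLocus (HolT τ X)).Finite :=
    ((Finset.finite_toSet _).subset hsub).of_finite_image Subtype.val_injective.injOn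
  have hle : (singularLocus (HolT τ X)).ncard ≤ 8 := by
    rw [← Set.ncard_image_of_injective _ Subtype.val_injective]
    refine (Set.ncard_le_ncard hsub (Finset.finite_toSet _)).trans ?_
    rw [Set.ncard_coe_finset]
    have := Finset.card_union_le (t 0) (t 1)
    have h0 := ht 0
    have h1 := ht 1
    omega
  have horb := Set.eq_of_subset_of_ncard_le (h.orbit_subset hx) (by rwa [h.ncard_orbit]) hfin
  rw [← horb] at hy
  obtain ⟨g, rfl⟩ := hy
  exact ⟨g.1, g.2, rfl⟩

end Points

section TwoTorsion

variable {τ : Fin 3 → UpperHalfPlane} {X : Set (T τ)} {G : AddSubgroup GG}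
  {c : Fin 2 → Fin 2 → Fin 2 → ℂ} {j₁ j₂ j₃ : Fin 3} {k : Fin 2} {A B : Fin 2 → ℂ}

/-- If `G` does not contain `z ↦ -z`, then the equation of `X` has two monomials. -/
theorem IsGBTPair.exists_monomials (h : IsGBTPair τ X G) (hc : HasEquation τ X c)
    (hN : NormalForm c j₁ j₂ j₃ k A B)
    (hno : ∀ g ∈ G, (∀ j, g j 1 = 0) → (∀ j, g j 2 = 0) → g = 0) :
    ∃ l : Fin 2, A (1 - l) = 0 ∧ B l = 0 ∧ A l ≠ 0 ∧ B (1 - l) ≠ 0 := by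
  obtain ⟨g, hg, hg1, hg2⟩ := h.exists_of_eta_epsilon hno 0 (b := fun j => if j = j₂ then 0 else 1)
    (by fin_cases j₂ <;> decide)
  obtain ⟨r, hr⟩ := hc.exists_semiInvariant (h.invariant g hg) hg1
  have hs : ∀ y, tri c (fun j i => coordSign (g j 2) i * y j i) = r * tri c y := fun y => by
    rw [tri_coordSign c (fun j => g j 2)]
    simp only [hr, tri, Finset.mul_sum]
    exact Finset.sum_congr rfl fun i _ => Finset.sum_congr rfl fun k _ => Finset.sum_congr rfl
      fun l _ => by ring
  have hcs : ∀ e, coordSign e 1 = 1 := fun e => by simp [coordSign]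
  have h0 : ∀ i, coordSign 0 i = 1 := fun i => by simp [coordSign]
  have h1 : coordSign 1 0 = -1 := by simp [coordSign]
  have hkk : ∀ k : Fin 2, 1 - k ≠ k := by decide
  have hA : ∀ p : Fin 2 → ℂ, -(-(A 0 * p 0) + A 1 * p 1) = r * (A 0 * p 0 + A 1 * p 1) := fun p => by
    have := hs fun j => if j = j₁ then ![1, 0] else if j = j₂ then Pi.single k 1 else p
    simp only [hN.eq, hg2] at this
    simp [hN.h₁₂, hN.h₁₂.symm, hN.h₁₃.symm, hN.h₂₃.symm, h0, h1, hcs] at this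
    linear_combination this
  have hB : ∀ p : Fin 2 → ℂ, -(B 0 * p 0) + B 1 * p 1 = r * (B 0 * p 0 + B 1 * p 1) := fun p => by
    have := hs fun j => if j = j₁ then ![0, 1] else if j = j₂ then Pi.single (1 - k) 1 else p
    simp only [hN.eq, hg2] at this
    simp [hN.h₁₂, hN.h₁₂.symm, hN.h₁₃.symm, hN.h₂₃.symm, h0, h1, hcs] at this
    linear_combination this
  have hA0 := hA ![1, 0]
  have hA1 := hA ![0, 1]
  have hB0 := hB ![1, 0]
  have hB1 := hB ![0, 1]
  simp only [Matrix.cons_val_zero, Matrix.cons_val_one, mul_one, mul_zero, neg_zero, add_zero,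
    zero_add, neg_neg] at hA0 hA1 hB0 hB1
  have hdet := hN.det
  by_cases hr1 : r = 1
  · have a1 : A 1 = 0 := by rw [hr1] at hA1; linear_combination -hA1 / 2
    have b0 : B 0 = 0 := by rw [hr1] at hB0; linear_combination -hB0 / 2
    rw [a1, b0] at hdet
    exact ⟨0, a1, b0, fun h => hdet (by rw [h]; ring), fun h => hdet (by
      rw [show B 1 = 0 from h]; ring)⟩
  · have hr1' := sub_ne_zero.mpr hr1
    have a0 : A 0 = 0 := (mul_eq_zero.mp (by linear_combination -hA0 :
      (r - 1) * A 0 = 0)).resolve_left hr1'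
    have b1 : B 1 = 0 := (mul_eq_zero.mp (by linear_combination -hB1 :
      (r - 1) * B 1 = 0)).resolve_left hr1'
    rw [a0, b1] at hdet
    exact ⟨1, a0, b1, fun h => hdet (by rw [h]; ring), fun h => hdet (by
      rw [show B 0 = 0 from h]; ring)⟩

/-- Two zeros of `a y₀ₘ₀ y₁ₘ₁ y₂ₘ₂ + b y₀₁₋ₘ₀ y₁₁₋ₘ₁ y₂₁₋ₘ₂` that agree in two of the factors. -/
theorem eq_of_binomial {a b : ℂ} (ha : a ≠ 0) (m : Fin 3 → Fin 2)
    {y y' : Fin 3 → Fin 2 → ℂ} {j : Fin 3} (h : ∀ i, i ≠ j → y i = y' i)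
    (hne : ∀ i, i ≠ j → ∀ n, y' i n ≠ 0)
    (hy : a * ∏ i, y i (m i) + b * ∏ i, y i (1 - m i) = 0)
    (hy' : a * ∏ i, y' i (m i) + b * ∏ i, y' i (1 - m i) = 0) : y j 0 * y' j 1 = y' j 0 * y j 1 := by
  have hsplit : ∀ f : Fin 3 → ℂ, ∏ i, f i = f j * ∏ i ∈ Finset.univ.erase j, f i := fun f =>
    (Finset.mul_prod_erase _ _ (Finset.mem_univ j)).symm
  have hcongr : ∀ m : Fin 3 → Fin 2, ∏ i ∈ Finset.univ.erase j, y i (m i) =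
      ∏ i ∈ Finset.univ.erase j, y' i (m i) := fun m =>
    Finset.prod_congr rfl fun i hi => by rw [h i (Finset.ne_of_mem_erase hi)]
  have hne' : ∀ m : Fin 3 → Fin 2, ∏ i ∈ Finset.univ.erase j, y' i (m i) ≠ 0 := fun m =>
    Finset.prod_ne_zero_iff.mpr fun i hi => hne i (Finset.ne_of_mem_erase hi) _
  rw [hsplit, hsplit fun i => y i (1 - m i), hcongr m, hcongr fun i => 1 - m i] at hy
  rw [hsplit, hsplit fun i => y' i (1 - m i)] at hy'
  have hM := mul_ne_zero ha (hne' m)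
  set M := ∏ i ∈ Finset.univ.erase j, y' i (m i)
  set N := ∏ i ∈ Finset.univ.erase j, y' i (1 - m i)
  have key : y j (m j) * y' j (1 - m j) = y' j (m j) * y j (1 - m j) := by
    refine mul_left_cancel₀ hM ?_
    linear_combination y' j (1 - m j) * hy - y j (1 - m j) * hy'
  have hall : ∀ n : Fin 2, y j n * y' j (1 - n) = y' j n * y j (1 - n) →
      y j 0 * y' j 1 = y' j 0 * y j 1 :=
    Fin.forall_fin_two.mpr ⟨id, fun h => by
      change y j 1 * y' j 0 = y' j 1 * y j 0 at h
      linear_combination -h⟩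
  exact hall _ key

/-- The difference of two points of order two in `ℂ / ⟨1, τ⟩`. -/
theorem exists_shift_of_two_mul_mem {τ : UpperHalfPlane} {z w : ℂ}
    (hz : 2 * z ∈ (periods τ).lattice) (hw : 2 * w ∈ (periods τ).lattice) :
    ∃ a b : ZMod 2, z + shift a ((τ : ℂ) / 2) + shift b (1 / 2) - w ∈ (periods τ).lattice := by
  obtain ⟨m, n, hmn⟩ := PeriodPair.mem_lattice.mp (sub_mem hw hz)
  change (m : ℂ) * 1 + n * (τ : ℂ) = _ at hmn
  have hshift : ∀ (m : ℤ) (x : ℂ), ∃ (s : ZMod 2) (q : ℤ), shift s (x / 2) = m * x / 2 + q * x := by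
    intro m x
    obtain ⟨q, hq | hq⟩ := m.even_or_odd'
    · exact ⟨0, -q, by simp [shift, hq]; ring⟩
    · exact ⟨1, -q, by simp [shift, hq]; ring⟩
  obtain ⟨a, p, ha⟩ := hshift n τ
  obtain ⟨b, q, hb⟩ := hshift m 1
  refine ⟨a, b, PeriodPair.mem_lattice.mpr ⟨q, p, ?_⟩⟩
  rw [ha, hb]
  change (q : ℂ) * 1 + p * (τ : ℂ) = _
  linear_combination -hmn / 2

/-- The singular points form one orbit if `G` does not contain `z ↦ -z`. -/
theorem IsGBTPair.transitive_of_neg_notMem (h : IsGBTPair τ X G) (hc : HasEquation τ X c)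
    (hN : NormalForm c j₁ j₂ j₃ k A B)
    (hno : ∀ g ∈ G, (∀ j, g j 1 = 0) → (∀ j, g j 2 = 0) → g = 0) (x : X)
    (hx : x ∈ singularLocus (HolT τ X)) (y : X) (hy : y ∈ singularLocus (HolT τ X)) :
    ∃ g ∈ G, act τ g x.1 = y.1 := by
  obtain ⟨l, hAl, hBl, hA, hB⟩ := h.exists_monomials hc hN hno
  have hlin : ∀ l : Fin 2, A (1 - l) = 0 → B l = 0 → ∀ p : Fin 2 → ℂ,
      A 0 * p 0 + A 1 * p 1 = A l * p l ∧ B 0 * p 0 + B 1 * p 1 = B (1 - l) * p (1 - l) :=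
    Fin.forall_fin_two.mpr ⟨fun h h' p => by
      change A 1 = 0 at h
      rw [h, h']
      exact ⟨by ring, by change _ = B 1 * p 1; ring⟩, fun h h' p => by
      change A 0 = 0 at h
      rw [h, h']
      exact ⟨by ring, by change _ = B 0 * p 0; ring⟩⟩
  replace hlin := hlin l hAl hBl
  have htors : ∀ z : Fin 3 → ℂ, ∀ hz : toT τ z ∈ X, ⟨toT τ z, hz⟩ ∈ singularLocus (HolT τ X) →
      ∀ j, 2 * z j ∈ (periods (τ j)).lattice := by
    intro z hz hs
    rcases (hc.local_structure hN hz).resolve_left hs with ⟨-, h1 | ⟨h1, i, -, -, h2⟩⟩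
    · exact h1
    · exfalso
      have hne := hom_coordP_ne_zero h1
      by_cases hi : i = 0
      · simp only [pencil, hi, if_true, (hlin _).2] at h2
        exact mul_ne_zero hB (hne _) h2
      · simp only [pencil, hi, if_false, (hlin _).1] at h2
        exact mul_ne_zero hA (hne _) h2
  obtain ⟨x, hxX⟩ := x
  obtain ⟨y, hyX⟩ := y
  obtain ⟨z, rfl⟩ := toT_surjective τ x
  obtain ⟨w, rfl⟩ := toT_surjective τ y
  have hz := htors z hxX hx
  have hw := htors w hyX hy
  choose a b hab using fun j => exists_shift_of_two_mul_mem (hz j) (hw j)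
  obtain ⟨a₀, b₀, j, hb₀, haj, hbj⟩ : ∃ (a₀ : ZMod 2) (b₀ : Fin 3 → ZMod 2) (j : Fin 3),
      b₀ 0 + b₀ 1 + b₀ 2 = 0 ∧ (∀ i, i ≠ j → a i = a₀) ∧ ∀ i, i ≠ j → b i = b₀ i := by
    obtain ⟨a₀, j, haj⟩ : ∃ (a₀ : ZMod 2) (j : Fin 3), ∀ i, i ≠ j → a i = a₀ := by
      clear hab
      revert a
      decide
    refine ⟨a₀, Function.update b j (b j + (b 0 + b 1 + b 2)), j, ?_, haj, fun i hi => by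
      rw [Function.update_of_ne hi]⟩
    clear haj hab
    revert b
    revert j
    decide
  obtain ⟨g, hg, hg1, hg2⟩ := h.exists_of_eta_epsilon hno a₀ hb₀
  refine ⟨g, hg, ?_⟩
  have hmem := h.invariant g hg _ hxX
  rw [act_toT] at hmem ⊢
  have hother : ∀ i, i ≠ j → actLift τ g z i - w i ∈ (periods (τ i)).lattice := fun i hi => by
    have h1 := hab i
    rw [haj i hi, hbj i hi] at h1
    rcases zmod2_cases (g i 0 + g i 1 + g i 2) with h2 | h2
    · rwa [actLift, h2, hg1, hg2, sgn, if_pos rfl]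
    · rw [actLift, h2, hg1, hg2, sgn, if_neg one_ne_zero]
      convert sub_mem h1 (hz i) using 1
      ring
  have hF : ∀ y, tri c y = A l * ∏ i, y i ((fun i => if i = j₁ then 0 else if i = j₂ then k else l) i)
      + B (1 - l) * ∏ i, y i (1 - (fun i => if i = j₁ then 0 else if i = j₂ then k else l) i) := by
    intro y
    rw [hN.eq, (hlin _).1, (hlin _).2, prod_three_of_ne hN.h₁₂ hN.h₁₃ hN.h₂₃,
      prod_three_of_ne hN.h₁₂ hN.h₁₃ hN.h₂₃]
    simp only [if_true, if_neg hN.h₁₂.symm, if_neg hN.h₁₃.symm, if_neg hN.h₂₃.symm, sub_zero]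
    ring
  have hz0 := (hc.2 _).mp hmem
  have hw0 := (hc.2 _).mp hyX
  rw [hF] at hz0 hw0
  have hj := eq_of_binomial hA _ (j := j) (fun i hi => by
    rw [coordP_eq_iff.mpr (Or.inl (hother i hi))]) (fun i _ n => hom_coordP_ne_zero (hw i) n) hz0 hw0
  have hj' := sub_mem_of_coordP_eq (((isHom_hom _).eq_iff (isHom_hom _)).mpr hj) (hw j)
  refine funext fun i => toE_eq_iff.mpr ?_
  by_cases hi : i = j
  · exact hi ▸ hj'
  · exact hother i hi

end TwoTorsion

end Burniat

theorem mainTheorem5 (τ : Fin 3 → UpperHalfPlane) (X : Set (Burniat.T τ))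
    (G : AddSubgroup Burniat.GG) (hXG : Burniat.IsGBTPair τ X G) :
    (Burniat.singularLocus (Burniat.HolT τ X) = ∅ ∧
        Burniat.singularLocus (Burniat.HolModel τ X G) = ∅) ∨
      ((Burniat.singularLocus (Burniat.HolT τ X)).ncard = 8 ∧
        (∀ x ∈ Burniat.singularLocus (Burniat.HolT τ X), Burniat.IsNode (Burniat.HolT τ X) x) ∧
        ∃ q : Burniat.Model τ X G, Burniat.singularLocus (Burniat.HolModel τ X G) = {q} ∧
          Burniat.IsNode (Burniat.HolModel τ X G) q) := by
  obtain ⟨c, hc⟩ := hXG.burniat.exists_hasEquation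
  obtain ⟨j₁, j₂, j₃, k, A, B, hN⟩ := hXG.exists_normalForm hc
  refine hXG.conclusion ?_ ?_
  · rintro ⟨x, hx⟩ hs
    obtain ⟨z, rfl⟩ := Burniat.toT_surjective τ x
    exact ((hc.local_structure hN hx).resolve_left hs).1
  · by_cases hno : ∀ g ∈ G, (∀ j, g j 1 = 0) → (∀ j, g j 2 = 0) → g = 0
    · exact fun x hx y hy => hXG.transitive_of_neg_notMem hc hN hno x hx y hy
    · push Not at hno
      obtain ⟨g, hg, hg1, hg2, hg0⟩ := hno
      exact fun x hx y hy => hXG.transitive_of_neg_mem hc hN hg hg0 hg1 hg2 x hx y hy
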